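/- Assume the Riemann Hypothesis. Then, as $t\to\infty$, $$\int_{t-h}^{t+h}\log\left|\zeta\left(\tfrac12+iu\right)\right|\,du=\Omega_{\pm}\left(h\sqrt{\frac{\log t}{\log\log t}}\right)$$ uniformly for $h\in[0,(\log\log t)^{-1}]$, in the following sense. There are absolute constants $c_1,c_2>0$ and $T_0$ such that for every $T\ge T_0$ and every $h\in[0,(\log\log T)^{-1}]$ there is a $t\in[T,2T]$ with $$\int_{t-h}^{t+h}\log\left|\zeta\left(\tfrac12+iu\right)\right|\,du\ \ge\ c_1\,h\sqrt{\frac{\log t}{\log\log t}},$$ and there is a $t'\in[T,2T]$ with $$\int_{t'-h}^{t'+h}\log\left|\zeta\left(\tfrac12+iu\right)\right|\,du\ \le\ -c_2\,h\sqrt{\frac{\log t'}{\log\log t'}}.$$ -/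

import Mathlib

open Filter

open MeasureTheory Set Topology Asymptotics

/-! The proof is a resonance argument. Let `R` be a Dirichlet polynomial of length at most
`T^(1/8)`, and average `log |ζ|` against the positive weight `|R(t)|²` times a Gaussian of width
`√T` centred at `3T/2`. If the weighted average is large of either sign compared with the total mass
of the weight, then `log |ζ|` itself takes such values; applied to short averages of `log |ζ|`, this
gives the theorem.

Under RH, `(s - 1) ζ(s) / s` has a holomorphic logarithm on `Re s > 1/2`, and on the critical line
its modulus is `|ζ|`. Against a frequency `(m/n)^(it)` and a Gaussian, the contour moves to `Re s =
2`, where the logarithm is a Dirichlet series plus a small pole factor. Only the index `k` with `k n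
= m` survives (`norm_integral_sub_diagTerm_le`). Letting `σ → 1/2` from the right requires control
of the logarithmic singularities; the outcome is `abs_integral_sub_resonanceMain_le`, which turns
the weighted average of `log |ζ|` into an explicit quadratic form in the coefficients of `R`.

The resonator is supported on products of boundedly many primes from `(log T, (log T)^(3/2)]`, with
coefficients proportional to `p^(-1/2)` at each prime and a sign `ε = ±1` per prime factor
(`eventually_exists_resonator`). The ratio of the form to the mass then has sign `ε` and size at
least a constant times `√(log T / log log T)`. It keeps this size when the argument is shifted by
any `|v| ≤ 1 / log log T`, because `|v| log p ≤ 3/2 < π/2` for the primes used. Integrating over `v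
∈ [-h, h]` and exchanging integrals (`two_mul_le_mul_integral_of_averages`) produces the integrals
over `[t - h, t + h]`, uniformly in `h`. -/

/-! ### Continuation and growth of `ζ` in `Re s > 0` -/

/-- The Mellin-type integral `∫_1^∞ {t} t^{-s-1} dt`. -/
noncomputable def fractMellin (s : ℂ) : ℂ :=
  ∫ t in Ioi (1 : ℝ), ((Int.fract t : ℝ) : ℂ) * (t : ℂ) ^ (-(s + 1))

lemma fractMellin_eq_mellin (s : ℂ) :
    fractMellin s = mellin ((Ioi (1 : ℝ)).indicator fun t ↦ ((Int.fract t : ℝ) : ℂ)) (-s) := by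
  rw [fractMellin, mellin]
  have h1 : ∀ t : ℝ, (t : ℂ) ^ (-s - 1) • (Ioi (1 : ℝ)).indicator (fun t ↦ ((Int.fract t : ℝ) : ℂ)) t
      = (Ioi (1 : ℝ)).indicator (fun t ↦ ((Int.fract t : ℝ) : ℂ) * (t : ℂ) ^ (-(s + 1))) t := by
    intro t
    by_cases ht : t ∈ Ioi (1 : ℝ)
    · simp [indicator_of_mem ht, mul_comm, sub_eq_add_neg, add_comm]
    · simp [indicator_of_notMem ht]
  simp_rw [h1]
  rw [setIntegral_indicator measurableSet_Ioi]
  congr 2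
  ext t
  simp only [mem_Ioi, mem_inter_iff]
  constructor
  · intro h; exact ⟨by linarith, h⟩
  · exact fun h ↦ h.2

lemma differentiableAt_fractMellin {s : ℂ} (hs : 0 < s.re) :
    DifferentiableAt ℂ fractMellin s := by
  have hb : ∀ t : ℝ, ‖(Ioi (1 : ℝ)).indicator (fun t ↦ ((Int.fract t : ℝ) : ℂ)) t‖ ≤ 1 := by
    intro t
    by_cases ht : t ∈ Ioi (1 : ℝ)
    · rw [indicator_of_mem ht, Complex.norm_real, Real.norm_of_nonneg (Int.fract_nonneg t)]
      exact (Int.fract_lt_one t).le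
    · simp [indicator_of_notMem ht]
  have hm : Measurable ((Ioi (1 : ℝ)).indicator (fun t ↦ ((Int.fract t : ℝ) : ℂ))) :=
    (Complex.measurable_ofReal.comp measurable_fract).indicator measurableSet_Ioi
  have h : DifferentiableAt ℂ
      (mellin ((Ioi (1 : ℝ)).indicator fun t ↦ ((Int.fract t : ℝ) : ℂ))) (-s) := by
    refine mellin_differentiableAt_of_isBigO_rpow (a := 0) (b := -s.re - 1) ?_ ?_ (by simpa) ?_
      (by simp)
    · apply LocallyIntegrable.locallyIntegrableOn
      intro x
      refine ⟨Icc (x - 1) (x + 1), Icc_mem_nhds (by linarith) (by linarith), ?_⟩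
      exact Measure.integrableOn_of_bounded (M := 1) (by simp)
        hm.aestronglyMeasurable (ae_of_all _ hb)
    · refine IsBigO.of_bound 1 (Eventually.of_forall fun t ↦ ?_)
      simpa using hb t
    · refine IsBigO.of_bound 1 ?_
      have : ∀ᶠ t : ℝ in 𝓝[>] 0, t < 1 :=
        (eventually_lt_nhds one_pos).filter_mono nhdsWithin_le_nhds
      filter_upwards [this] with t ht
      rw [indicator_of_notMem (by simpa using ht.le)]
      simp
  have h2 : fractMellin = fun s ↦
      mellin ((Ioi (1 : ℝ)).indicator fun t ↦ ((Int.fract t : ℝ) : ℂ)) (-s) :=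
    funext fractMellin_eq_mellin
  rw [h2]
  exact h.comp s differentiableAt_id.neg

lemma norm_fractMellin_le {s : ℂ} (hs : 0 < s.re) : ‖fractMellin s‖ ≤ s.re⁻¹ := by
  have hi : IntegrableOn (fun t : ℝ ↦ t ^ (-s.re - 1)) (Ioi 1) :=
    integrableOn_Ioi_rpow_of_lt (by linarith) one_pos
  have h1 : ∫ t in Ioi (1 : ℝ), t ^ (-s.re - 1) = s.re⁻¹ := by
    rw [integral_Ioi_rpow_of_lt (by linarith) one_pos]
    simp
  rw [← h1]
  refine norm_integral_le_of_norm_le hi ?_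
  refine (ae_restrict_iff' measurableSet_Ioi).2 (ae_of_all _ fun t ht ↦ ?_)
  have ht0 : (0 : ℝ) < t := one_pos.trans ht
  rw [norm_mul, Complex.norm_real, Real.norm_of_nonneg (Int.fract_nonneg t),
    Complex.norm_cpow_eq_rpow_re_of_pos ht0]
  have : (-(s + 1)).re = -s.re - 1 := by simp; ring
  rw [this]
  exact mul_le_of_le_one_left (by positivity) (Int.fract_lt_one t).le

lemma riemannZeta_eq_fractMellin {s : ℂ} (hs : 1 < s.re) :
    riemannZeta s = s / (s - 1) - s * fractMellin s := by
  have h0 : 0 < s.re := by linarith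
  have hs1 : s - 1 ≠ 0 := by
    intro h
    have : s = 1 := by linear_combination h
    simp [this] at hs
  have h := LSeries_eq_mul_integral_of_nonneg (fun _ ↦ 1) zero_le_one hs
    (by simpa using isBigO_refl _ _) (by simp)
  have e1 : LSeries (fun _ ↦ ((1 : ℝ) : ℂ)) s = riemannZeta s := by
    rw [← LSeries_one_eq_riemannZeta hs]; congr
  rw [e1] at h
  rw [h]
  have hint1 : IntegrableOn (fun t : ℝ ↦ (t : ℂ) ^ (-s)) (Ioi 1) :=
    integrableOn_Ioi_cpow_of_lt (by simpa using hs) one_pos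
  have hint2 : IntegrableOn (fun t : ℝ ↦ ((Int.fract t : ℝ) : ℂ) * (t : ℂ) ^ (-(s + 1))) (Ioi 1) := by
    have hi : IntegrableOn (fun t : ℝ ↦ (t : ℂ) ^ (-(s + 1))) (Ioi 1) :=
      integrableOn_Ioi_cpow_of_lt (by simp; linarith) one_pos
    refine hi.bdd_mul (c := 1) (Complex.measurable_ofReal.comp measurable_fract).aestronglyMeasurable
      (ae_of_all _ fun t ↦ ?_)
    simp only [Complex.norm_real]
    rw [Real.norm_of_nonneg (Int.fract_nonneg t)]
    exact (Int.fract_lt_one t).le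
  -- Partial summation has produced `⌊t⌋ = t - {t}`; the part `t` integrates to the polar term.
  have key : ∫ t in Ioi (1 : ℝ), (∑ k ∈ Finset.Icc 1 ⌊t⌋₊, ((1 : ℝ) : ℂ)) * (t : ℂ) ^ (-(s + 1))
      = (∫ t in Ioi (1 : ℝ), (t : ℂ) ^ (-s)) - fractMellin s := by
    rw [fractMellin, ← integral_sub hint1 hint2]
    refine setIntegral_congr_fun measurableSet_Ioi fun t ht ↦ ?_
    have ht0 : (0 : ℝ) < t := one_pos.trans ht
    have htc : (t : ℂ) ≠ 0 := by exact_mod_cast ht0.ne'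
    have e2 : (t : ℂ) ^ (-s) = t * (t : ℂ) ^ (-(s + 1)) := by
      rw [neg_add, ← sub_eq_add_neg, Complex.cpow_sub _ _ htc, Complex.cpow_one]
      field_simp
    have e3 : ((⌊t⌋₊ : ℝ) : ℂ) = t - (Int.fract t : ℝ) := by
      rw [← Complex.ofReal_sub]
      congr 1
      rw [Int.self_sub_fract, natCast_floor_eq_intCast_floor ht0.le]
    simp only [e2, Complex.ofReal_one, Finset.sum_const, Nat.card_Icc, Nat.add_sub_cancel,
      nsmul_eq_mul, mul_one]
    rw [← sub_mul, ← e3]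
    simp
  rw [key, integral_Ioi_cpow_of_lt (by simpa using hs) one_pos]
  have : -s + 1 ≠ 0 := by
    intro h; apply hs1; linear_combination -h
  simp only [Complex.ofReal_one, Complex.one_cpow]
  field_simp
  ring

/-- Clearing the pole makes both sides analytic on `Re s > 0`, so the identity theorem extends the
formula from a neighbourhood of `2`. -/
lemma riemannZeta₁_eq {s : ℂ} (hs : 0 < s.re) :
    riemannZeta₁ s = s - s * (s - 1) * fractMellin s := by
  have hopen : IsOpen {s : ℂ | 0 < s.re} := isOpen_lt continuous_const Complex.continuous_re
  have hA : AnalyticOnNhd ℂ riemannZeta₁ {s : ℂ | 0 < s.re} :=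
    differentiable_riemannZeta₁.differentiableOn.analyticOnNhd hopen
  have hB : AnalyticOnNhd ℂ (fun s ↦ s - s * (s - 1) * fractMellin s) {s : ℂ | 0 < s.re} := by
    refine DifferentiableOn.analyticOnNhd (fun z hz ↦ ?_) hopen
    have := differentiableAt_fractMellin (s := z) hz
    exact DifferentiableAt.differentiableWithinAt (by fun_prop)
  refine hA.eqOn_of_preconnected_of_eventuallyEq hB
    (convex_halfSpace_re_gt 0).isPreconnected (z₀ := 2) (by simp) ?_ hs
  have : ∀ᶠ z : ℂ in 𝓝 2, 1 < z.re :=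
    (isOpen_lt continuous_const Complex.continuous_re).mem_nhds (by simp)
  filter_upwards [this] with z hz
  have hz1 : z ≠ 1 := by rintro rfl; simp at hz
  have hz2 : z - 1 ≠ 0 := sub_ne_zero.2 hz1
  have h1 := riemannZeta_eq_fractMellin hz
  rw [riemannZeta_eq_inv_sub_mul hz1] at h1
  field_simp at h1
  linear_combination h1

/-! ### The quotient `(s - 1) ζ(s) / s` -/

/-- The function `(s - 1) ζ(s) / s`. -/
noncomputable def zetaQuot (s : ℂ) : ℂ := riemannZeta₁ s / s

lemma norm_zetaQuot_le {s : ℂ} (hs : 1 / 2 ≤ s.re) : ‖zetaQuot s‖ ≤ 3 + 2 * ‖s‖ := by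
  have h0 : 0 < s.re := by linarith
  have hs0 : s ≠ 0 := by rintro rfl; simp at h0
  have : zetaQuot s = 1 - (s - 1) * fractMellin s := by
    rw [zetaQuot, riemannZeta₁_eq h0]; field_simp
  rw [this]
  have h2 : ‖fractMellin s‖ ≤ 2 := (norm_fractMellin_le h0).trans (by
    rw [inv_le_comm₀ h0 two_pos]; linarith)
  calc ‖1 - (s - 1) * fractMellin s‖ ≤ ‖(1 : ℂ)‖ + ‖(s - 1) * fractMellin s‖ := norm_sub_le _ _
    _ ≤ 1 + (‖s‖ + 1) * 2 := by
        rw [norm_mul, norm_one]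
        gcongr
        exact (norm_sub_le _ _).trans (by simp)
    _ = 3 + 2 * ‖s‖ := by ring

lemma zetaQuot_eq {s : ℂ} (hs : s ≠ 1) : zetaQuot s = (s - 1) / s * riemannZeta s := by
  rw [zetaQuot, riemannZeta_eq_inv_sub_mul hs]
  have : s - 1 ≠ 0 := sub_ne_zero.2 hs
  field_simp

lemma zetaQuot_one : zetaQuot 1 = 1 := by simp [zetaQuot]

lemma differentiableAt_zetaQuot {s : ℂ} (hs : s ≠ 0) : DifferentiableAt ℂ zetaQuot s :=
  (differentiable_riemannZeta₁ s).div differentiableAt_id hs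

lemma differentiableOn_zetaQuot : DifferentiableOn ℂ zetaQuot {0}ᶜ :=
  fun _ hs ↦ (differentiableAt_zetaQuot hs).differentiableWithinAt

/-- On the critical line `s - 1` is minus the conjugate of `s`, so the factor that removes the pole
has modulus one there. -/
lemma norm_zetaQuot_half (t : ℝ) :
    ‖zetaQuot (1 / 2 + Complex.I * t)‖ = ‖riemannZeta (1 / 2 + Complex.I * t)‖ := by
  have h1 : (1 / 2 + Complex.I * t : ℂ) ≠ 1 := by
    intro h
    have := congrArg Complex.re h
    norm_num at this
  have h0 : (1 / 2 + Complex.I * t : ℂ) ≠ 0 := by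
    intro h
    have := congrArg Complex.re h
    norm_num at this
  have h2 : ‖(1 / 2 + Complex.I * t - 1 : ℂ)‖ = ‖(1 / 2 + Complex.I * t : ℂ)‖ := by
    rw [← norm_neg, ← Complex.norm_conj]
    congr 1
    have : (starRingEnd ℂ) 2 = 2 := Complex.conj_ofNat 2
    simp [this]
    ring
  rw [zetaQuot_eq h1, norm_mul, norm_div, h2, div_self (by simpa using h0), one_mul]

lemma zetaQuot_ne_zero (hRH : RiemannHypothesis) {s : ℂ} (hs : 1 / 2 < s.re) :
    zetaQuot s ≠ 0 := by
  by_cases h1 : s = 1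
  · simp [h1, zetaQuot_one]
  have hs0 : s ≠ 0 := by rintro rfl; norm_num at hs
  rw [zetaQuot_eq h1]
  refine mul_ne_zero (div_ne_zero (sub_ne_zero.2 h1) hs0) fun h ↦ ?_
  have := hRH s h ?_ h1
  · linarith
  · rintro ⟨n, rfl⟩
    have : (-2 * ((n : ℂ) + 1)).re = -2 * ((n : ℝ) + 1) := by simp
    rw [this] at hs
    have : (0 : ℝ) ≤ n := n.cast_nonneg
    linarith

/-! ### The holomorphic logarithm under RH -/

/-- A continuous logarithm of a holomorphic function is holomorphic. -/
lemma ContinuousOn.differentiableOn_of_exp_eq {U : Set ℂ} (hU : IsOpen U) {f l : ℂ → ℂ}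
    (hf : DifferentiableOn ℂ f U) (hl : ContinuousOn l U) (h : ∀ z ∈ U, Complex.exp (l z) = f z) :
    DifferentiableOn ℂ l U := by
  intro z hz
  have hlc : ContinuousAt l z := hl.continuousAt (hU.mem_nhds hz)
  -- Continuity keeps `l w - l z` within distance `1 < π` of zero, hence in the strip where the
  -- principal logarithm inverts `exp`.
  have hev : (fun w ↦ l z + Complex.log (f w / f z)) =ᶠ[𝓝 z] l := by
    have h1 : ∀ᶠ w in 𝓝 z, ‖l w - l z‖ < 1 := by
      have : Tendsto (fun w ↦ ‖l w - l z‖) (𝓝 z) (𝓝 0) := by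
        have := (hlc.sub (continuousAt_const (y := l z))).norm
        simpa [ContinuousAt] using this
      exact this.eventually (gt_mem_nhds one_pos)
    filter_upwards [h1, hU.mem_nhds hz] with w hw hwU
    rw [← h w hwU, ← h z hz, ← Complex.exp_sub]
    have him : |(l w - l z).im| < 1 := (Complex.abs_im_le_norm _).trans_lt hw
    rw [abs_lt] at him
    rw [Complex.log_exp]
    · ring
    · linarith [Real.pi_gt_three]
    · linarith [Real.pi_gt_three]
  have hfz : f z ≠ 0 := by rw [← h z hz]; exact Complex.exp_ne_zero _
  refine DifferentiableAt.differentiableWithinAt ?_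
  refine DifferentiableAt.congr_of_eventuallyEq ?_ hev.symm
  refine DifferentiableAt.const_add _ ?_
  refine DifferentiableAt.clog ((hf.differentiableAt (hU.mem_nhds hz)).div_const _) ?_
  simp [div_self hfz]

lemma Convex.isSimplyConnected_of_nonempty {U : Set ℂ} (hU : Convex ℝ U) (hne : U.Nonempty) :
    IsSimplyConnected U := by
  have := hU.contractibleSpace hne
  unfold IsSimplyConnected
  infer_instance

/-- The coefficients of the Dirichlet series of `log ζ`. -/
noncomputable def logZetaCoeff (k : ℕ) : ℝ := ArithmeticFunction.vonMangoldt k / Real.log k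

lemma logZetaCoeff_nonneg (k : ℕ) : 0 ≤ logZetaCoeff k :=
  div_nonneg ArithmeticFunction.vonMangoldt_nonneg (Real.log_natCast_nonneg k)

lemma logZetaCoeff_le_one (k : ℕ) : logZetaCoeff k ≤ 1 :=
  div_le_one_of_le₀ ArithmeticFunction.vonMangoldt_le_log (Real.log_natCast_nonneg k)

/-- The logarithm of `(s - 1) ζ(s) / s` given by the Dirichlet series of `log ζ`. -/
noncomputable def logSeries (t : ℝ) : ℂ :=
  ∑' k : ℕ, (logZetaCoeff k : ℂ) * (k : ℂ) ^ (-(2 + Complex.I * t))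

lemma norm_logZetaTerm_le (k : ℕ) (t : ℝ) :
    ‖(logZetaCoeff k : ℂ) * (k : ℂ) ^ (-(2 + Complex.I * t))‖ ≤ ((k : ℝ) ^ 2)⁻¹ := by
  rcases Nat.eq_zero_or_pos k with rfl | hk
  · simp [logZetaCoeff]
  rw [norm_mul, Complex.norm_real, Real.norm_of_nonneg (logZetaCoeff_nonneg k),
    Complex.norm_natCast_cpow_of_pos hk]
  have : (-(2 + Complex.I * (t : ℂ))).re = -2 := by simp
  rw [this, Real.rpow_neg (by positivity)]
  norm_cast
  exact mul_le_of_le_one_left (by positivity) (logZetaCoeff_le_one k)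

lemma summable_inv_sq : Summable fun k : ℕ ↦ ((k : ℝ) ^ 2)⁻¹ :=
  Real.summable_nat_pow_inv.2 one_lt_two

lemma continuous_logZetaTerm (k : ℕ) :
    Continuous fun t : ℝ ↦ (logZetaCoeff k : ℂ) * (k : ℂ) ^ (-(2 + Complex.I * t)) := by
  rcases Nat.eq_zero_or_pos k with rfl | hk
  · simp [logZetaCoeff, continuous_const]
  refine continuous_const.mul (Continuous.const_cpow (by fun_prop) (Or.inl ?_))
  exact_mod_cast hk.ne'

lemma continuous_logSeries : Continuous logSeries :=
  continuous_tsum continuous_logZetaTerm summable_inv_sq norm_logZetaTerm_le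

lemma norm_logSeries_le (t : ℝ) : ‖logSeries t‖ ≤ ∑' k : ℕ, ((k : ℝ) ^ 2)⁻¹ :=
  tsum_of_norm_bounded summable_inv_sq.hasSum fun k ↦ norm_logZetaTerm_le k t

lemma exp_logSeries (t : ℝ) : Complex.exp (logSeries t) = riemannZeta (2 + Complex.I * t) := by
  have h := riemannZeta_eq_exp_LSeries (s := 2 + Complex.I * t) (by simp)
  rw [← h, LSeries_def₀ (by simp)]
  congr 1
  refine tsum_congr fun k ↦ ?_
  rw [logZetaCoeff, Complex.cpow_neg]
  push_cast
  rw [div_eq_mul_inv (_ / _)]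

/-- The logarithm of `1 - 1 / s` on the line `Re s = 2`. -/
noncomputable def logPoleFactor (t : ℝ) : ℂ := Complex.log (1 - (2 + Complex.I * t)⁻¹)

lemma norm_inv_two_add_le (t : ℝ) : ‖(2 + Complex.I * t : ℂ)⁻¹‖ ≤ 1 / 2 := by
  rw [norm_inv, inv_le_comm₀ ?_ (by norm_num)]
  · have := Complex.abs_re_le_norm (2 + Complex.I * t : ℂ)
    simp at this
    simpa using this
  · have := Complex.abs_re_le_norm (2 + Complex.I * t : ℂ)
    simp at this
    linarith

lemma two_add_ne_zero (t : ℝ) : (2 + Complex.I * t : ℂ) ≠ 0 := by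
  intro h
  have := congrArg Complex.re h
  simp at this

lemma continuous_logPoleFactor : Continuous logPoleFactor := by
  refine Continuous.clog (by
    refine continuous_const.sub (Continuous.inv₀ (by fun_prop) two_add_ne_zero)) fun t ↦ ?_
  left
  have h := (Complex.abs_re_le_norm _).trans (norm_inv_two_add_le t)
  rw [abs_le] at h
  simp only [Complex.sub_re, Complex.one_re]
  linarith [h.2]

lemma norm_logPoleFactor_le (t : ℝ) : ‖logPoleFactor t‖ ≤ 2 * ‖(2 + Complex.I * t : ℂ)⁻¹‖ := by
  have := Complex.norm_log_one_add_half_le_self (z := -(2 + Complex.I * t : ℂ)⁻¹)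
    (by rw [norm_neg]; exact norm_inv_two_add_le t)
  rw [norm_neg] at this
  rw [logPoleFactor, sub_eq_add_neg]
  refine this.trans ?_
  linarith [norm_nonneg (2 + Complex.I * t : ℂ)⁻¹]

lemma exp_logSeries_add (t : ℝ) :
    Complex.exp (logSeries t + logPoleFactor t) = zetaQuot (2 + Complex.I * t) := by
  have h1 : (2 + Complex.I * t : ℂ) ≠ 1 := by
    intro h
    have := congrArg Complex.re h
    simp at this
  have h2 : 1 - (2 + Complex.I * t : ℂ)⁻¹ ≠ 0 := by
    intro h
    have := norm_inv_two_add_le t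
    rw [← sub_eq_zero.1 h] at this
    norm_num at this
  rw [Complex.exp_add, exp_logSeries, logPoleFactor, Complex.exp_log h2, zetaQuot_eq h1, mul_comm]
  congr 1
  have := two_add_ne_zero t
  field_simp

/-- Under the Riemann hypothesis, the holomorphic logarithm of `(s - 1) ζ(s) / s`. -/
lemma exists_log_zetaQuot (hRH : RiemannHypothesis) :
    ∃ l : ℂ → ℂ, DifferentiableOn ℂ l {s | 1 / 2 < s.re} ∧
      (∀ s : ℂ, 1 / 2 < s.re → Complex.exp (l s) = zetaQuot s) ∧
      ∀ t : ℝ, l (2 + Complex.I * t) = logSeries t + logPoleFactor t := by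
  set U : Set ℂ := {s | 1 / 2 < s.re} with hU
  have hopen : IsOpen U := isOpen_lt continuous_const Complex.continuous_re
  have hconv : Convex ℝ U := convex_halfSpace_re_gt (1 / 2)
  have hdiff : DifferentiableOn ℂ zetaQuot U := by
    refine differentiableOn_zetaQuot.mono fun s hs ↦ ?_
    rintro rfl
    norm_num [hU] at hs
  -- Nonvanishing on a simply connected half-plane yields a continuous branch; it still has to be
  -- matched with the Dirichlet series.
  obtain ⟨l, hlc, hle⟩ := Complex.exists_continuousOn_eqOn_exp_comp
    (hconv.isSimplyConnected_of_nonempty ⟨1, by norm_num [hU]⟩) hopen hdiff.continuousOn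
    (by rintro ⟨s, hs, h0⟩; exact zetaQuot_ne_zero hRH hs h0)
  have hld : DifferentiableOn ℂ l U := hlc.differentiableOn_of_exp_eq hopen hdiff hle
  have hline : Continuous fun t : ℝ ↦ l (2 + Complex.I * t) :=
    hlc.comp_continuous (by fun_prop) fun t ↦ by norm_num [hU]
  set d : ℝ → ℂ := fun t ↦ l (2 + Complex.I * t) - (logSeries t + logPoleFactor t) with hd
  have hdc : Continuous d := hline.sub (continuous_logSeries.add continuous_logPoleFactor)
  have hdexp : ∀ t, Complex.exp (d t) = 1 := by
    intro t
    rw [hd]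
    simp only
    rw [Complex.exp_sub, exp_logSeries_add]
    have := hle (x := 2 + Complex.I * t) (by norm_num [hU])
    simp only [Function.comp] at this
    rw [this]
    exact div_self (zetaQuot_ne_zero hRH (by norm_num))
  -- The two logarithms differ on `Re s = 2` by a continuous function with values in `2πiℤ`, which
  -- must be constant and can be subtracted from the branch.
  have hconst : ∀ t, d t = d 0 := by
    have hint : ∀ t, ∃ n : ℤ, (d t).im / (2 * Real.pi) = n := by
      intro t
      obtain ⟨n, hn⟩ := Complex.exp_eq_one_iff.1 (hdexp t)
      refine ⟨n, ?_⟩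
      rw [hn]
      simp
    have hre : ∀ t, (d t).re = 0 := by
      intro t
      obtain ⟨n, hn⟩ := Complex.exp_eq_one_iff.1 (hdexp t)
      rw [hn]; simp
    choose n hn using hint
    have hcont : Continuous fun t ↦ ((n t : ℤ) : ℝ) := by
      have : (fun t ↦ ((n t : ℤ) : ℝ)) = fun t ↦ (d t).im / (2 * Real.pi) := funext fun t ↦ (hn t).symm
      rw [this]
      fun_prop
    have hcn : Continuous n := Int.isClosedEmbedding_coe_real.isEmbedding.continuous_iff.2 hcont
    intro t
    have hn0 : n t = n 0 := PreconnectedSpace.constant inferInstance hcn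
    apply Complex.ext
    · rw [hre, hre]
    · have h1 := hn t
      have h2 := hn 0
      rw [hn0, ← h2] at h1
      field_simp at h1
      exact h1
  refine ⟨fun s ↦ l s - d 0, hld.sub_const _, fun s hs ↦ ?_, fun t ↦ ?_⟩
  · rw [Complex.exp_sub, hdexp, div_one]
    exact hle hs
  · simp only
    rw [← hconst t, hd]
    ring

/-- Growth of a logarithm of `(s - 1) ζ(s) / s` in vertical strips. -/
lemma exists_norm_log_zetaQuot_le {l : ℂ → ℂ} (hd : DifferentiableOn ℂ l {s | 1 / 2 < s.re})
    (he : ∀ s : ℂ, 1 / 2 < s.re → Complex.exp (l s) = zetaQuot s)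
    (h2 : ∀ t : ℝ, l (2 + Complex.I * t) = logSeries t + logPoleFactor t)
    {σ : ℝ} (hσ : 1 / 2 < σ) :
    ∃ C : ℝ, 0 ≤ C ∧ ∀ x ∈ Icc σ 2, ∀ y : ℝ, ‖l (x + Complex.I * y)‖ ≤ C * (1 + |y|) := by
  set S := ∑' k : ℕ, ((k : ℝ) ^ 2)⁻¹ with hS
  have hS0 : 0 ≤ S := tsum_nonneg fun k ↦ by positivity
  set e := σ - 1 / 2 with he'
  have he0 : 0 < e := by linarith
  -- These are the Borel–Carathéodory constants for the disc of radius `3/2` about `2 + iy`, which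
  -- just touches `Re s = 1/2`. The denominator `3/2 - (2 - x) = x - 1/2` is at least `e`.
  refine ⟨(2 * 10 * (3 / 2) + (S + 1) * 3) / e, by positivity, fun x hx y ↦ ?_⟩
  have hmaps : ∀ z ∈ Metric.ball (0 : ℂ) (3 / 2), 1 / 2 < (2 + Complex.I * y + z).re := by
    intro z hz
    have h := (Complex.abs_re_le_norm z).trans_lt (mem_ball_zero_iff.1 hz)
    rw [abs_lt] at h
    simp
    linarith [h.1]
  have hdiff : DifferentiableOn ℂ (fun z ↦ l (2 + Complex.I * y + z)) (Metric.ball 0 (3 / 2)) :=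
    hd.comp (by fun_prop) hmaps
  have hre : MapsTo (fun z ↦ l (2 + Complex.I * y + z)) (Metric.ball 0 (3 / 2))
      {z | z.re ≤ 10 * (1 + |y|)} := by
    intro z hz
    have hz' := mem_ball_zero_iff.1 hz
    have h1 := norm_zetaQuot_le (hmaps z hz).le
    rw [← he _ (hmaps z hz), Complex.norm_exp] at h1
    have h3 : ‖2 + Complex.I * y + z‖ ≤ 2 + |y| + 3 / 2 := by
      refine (norm_add_le _ _).trans (add_le_add ((norm_add_le _ _).trans ?_) hz'.le)
      simp
    -- The real part of `l` is `log |zetaQuot|`, so a bound from above is available although `l` has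
    -- no a priori bound; linear growth suffices.
    have h4 := Real.add_one_le_exp (l (2 + Complex.I * y + z)).re
    simp only [Set.mem_ofPred_eq]
    have := abs_nonneg y
    nlinarith
  have hz : (((x - 2 : ℝ)) : ℂ) ∈ Metric.ball (0 : ℂ) (3 / 2) := by
    rw [mem_ball_zero_iff, Complex.norm_real, Real.norm_eq_abs, abs_lt]
    constructor <;> linarith [hx.1, hx.2]
  have h := Complex.borelCaratheodory (by positivity) hdiff hre (by norm_num) hz
  have e1 : (2 + Complex.I * y + ((x - 2 : ℝ) : ℂ)) = x + Complex.I * y := by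
    push_cast; ring
  simp only [e1, add_zero] at h
  have hn : ‖((x - 2 : ℝ) : ℂ)‖ = 2 - x := by
    rw [Complex.norm_real, Real.norm_eq_abs, abs_sub_comm, abs_of_nonneg (by linarith [hx.2])]
  rw [hn] at h
  have h0 : ‖l (2 + Complex.I * y)‖ ≤ S + 1 := by
    rw [h2]
    refine (norm_add_le _ _).trans (add_le_add (norm_logSeries_le y) ?_)
    linarith [norm_logPoleFactor_le y, norm_inv_two_add_le y]
  refine h.trans ?_
  rw [← add_div, div_mul_eq_mul_div]
  have hy := abs_nonneg y
  apply div_le_div₀ (by positivity) _ he0 (by rw [he']; linarith [hx.1])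
  have a1 : 2 * (10 * (1 + |y|)) * (2 - x) ≤ 2 * 10 * (3 / 2) * (1 + |y|) := by
    nlinarith [hx.1]
  have a2 : ‖l (2 + Complex.I * y)‖ * (3 / 2 + (2 - x)) ≤ (S + 1) * 3 :=
    mul_le_mul h0 (by linarith [hx.1]) (by linarith [hx.2]) (by linarith)
  nlinarith

/-! ### Contour shifts and Gaussian weights -/

/-- Integrals of a holomorphic function along two vertical lines agree if it decays uniformly in
the strip between them. -/
lemma integral_verticalLine_eq {H : ℂ → ℂ} {a b : ℝ} (hab : a ≤ b)
    (hd : DifferentiableOn ℂ H {s | s.re ∈ Icc a b}) {B : ℝ → ℝ}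
    (hB : ∀ x ∈ Icc a b, ∀ y : ℝ, ‖H (x + Complex.I * y)‖ ≤ B y) (hBi : Integrable B)
    (hB1 : Tendsto B atTop (𝓝 0)) (hB2 : Tendsto B atBot (𝓝 0)) :
    ∫ y : ℝ, H (a + Complex.I * y) = ∫ y : ℝ, H (b + Complex.I * y) := by
  have hint : ∀ x ∈ Icc a b, Integrable fun y : ℝ ↦ H (x + Complex.I * y) := by
    intro x hx
    have hc : Continuous fun y : ℝ ↦ H (x + Complex.I * y) :=
      hd.continuousOn.comp_continuous (by fun_prop) fun y ↦ by simpa using hx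
    exact hBi.mono' hc.aestronglyMeasurable (ae_of_all _ (hB x hx))
  have hl : ∀ x ∈ Icc a b, Tendsto (fun n : ℝ ↦ ∫ y in (-n)..n, H (x + Complex.I * y)) atTop
      (𝓝 (∫ y : ℝ, H (x + Complex.I * y))) := fun x hx ↦
    intervalIntegral_tendsto_integral (hint x hx) tendsto_neg_atTop_atBot tendsto_id
  have hhor : ∀ c : ℝ → ℝ, Tendsto (fun n ↦ B (c n)) atTop (𝓝 0) →
      Tendsto (fun n : ℝ ↦ ∫ x in a..b, H (x + (c n : ℝ) * Complex.I)) atTop (𝓝 0) := by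
    intro c hc
    refine squeeze_zero_norm (a := fun n ↦ B (c n) * |b - a|) (fun n ↦ ?_) (by
      simpa using hc.mul_const |b - a|)
    refine intervalIntegral.norm_integral_le_of_norm_le_const fun x hx ↦ ?_
    rw [uIoc_of_le hab] at hx
    rw [mul_comm]
    exact hB x ⟨hx.1.le, hx.2⟩ _
  have hrect : ∀ n : ℝ, (∫ x in a..b, H (x + ((-n : ℝ)) * Complex.I))
      - (∫ x in a..b, H (x + (n : ℝ) * Complex.I))
      + Complex.I * ((∫ y in (-n)..n, H (b + Complex.I * y))
        - ∫ y in (-n)..n, H (a + Complex.I * y)) = 0 := by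
    intro n
    have := Complex.integral_boundary_rect_eq_zero_of_differentiableOn H
      (a + (-n : ℝ) * Complex.I) (b + (n : ℝ) * Complex.I) (hd.mono fun s hs ↦ by
        have := hs.1
        simp [uIcc_of_le hab] at this
        simpa using this)
    simp only [Complex.add_re, Complex.ofReal_re, Complex.mul_re, Complex.I_re, mul_zero,
      Complex.ofReal_im, Complex.I_im, mul_one, sub_self, add_zero, Complex.add_im,
      Complex.mul_im, zero_add, smul_eq_mul] at this
    simp only [mul_comm Complex.I (Complex.ofReal _)]
    linear_combination this
  have hlim := ((hhor (fun n ↦ -n) (hB2.comp tendsto_neg_atTop_atBot)).sub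
    (hhor (fun n ↦ n) hB1)).add
    (((hl b ⟨hab, le_rfl⟩).sub (hl a ⟨le_rfl, hab⟩)).const_mul Complex.I)
  have h0 := tendsto_nhds_unique hlim (by simp only [hrect]; exact tendsto_const_nhds)
  simp only [sub_self, zero_add, mul_eq_zero, Complex.I_ne_zero, false_or] at h0
  exact (sub_eq_zero.1 h0).symm

/-- The Gaussian weight of width `L` centred at `τ`. -/
noncomputable def gaussW (L τ u : ℝ) : ℝ := Real.exp (-((u - τ) / L) ^ 2)

/-- The entire extension of the Gaussian weight. -/
noncomputable def gaussC (L τ : ℝ) (z : ℂ) : ℂ := Complex.exp (-((z - τ) / L) ^ 2)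

lemma gaussW_pos (L τ u : ℝ) : 0 < gaussW L τ u := Real.exp_pos _

lemma gaussW_le_one (L τ u : ℝ) : gaussW L τ u ≤ 1 := by
  rw [gaussW, Real.exp_le_one_iff]; nlinarith [sq_nonneg ((u - τ) / L)]

lemma continuous_gaussW (L τ : ℝ) : Continuous (gaussW L τ) := by
  unfold gaussW; fun_prop

lemma differentiable_gaussC (L τ : ℝ) : Differentiable ℂ (gaussC L τ) := by
  unfold gaussC; fun_prop

lemma gaussC_ofReal (L τ u : ℝ) : gaussC L τ u = (gaussW L τ u : ℂ) := by
  simp [gaussC, gaussW]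

/-- Leaving the real axis by a bounded `δ` costs only a bounded factor once `L ≥ 1`, so contour
shifts of bounded length are cheap. -/
lemma norm_gaussC (L τ u δ : ℝ) :
    ‖gaussC L τ (u - Complex.I * δ)‖ = Real.exp ((δ / L) ^ 2) * gaussW L τ u := by
  rw [gaussC, gaussW, Complex.norm_exp, ← Real.exp_add]
  congr 1
  have : ((u - Complex.I * δ - τ : ℂ) / L) = (((u - τ) / L : ℝ) : ℂ) - ((δ / L : ℝ) : ℂ) * Complex.I := by
    push_cast; ring
  rw [this]
  simp [sq]
  ring

lemma gaussW_eq (L τ u : ℝ) : gaussW L τ u = Real.exp (-(L⁻¹ ^ 2) * (u - τ) ^ 2) := by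
  rw [gaussW]; congr 1; ring

lemma integrable_gaussW {L : ℝ} (hL : 0 < L) (τ : ℝ) : Integrable (gaussW L τ) := by
  have h := (integrable_exp_neg_mul_sq (b := L⁻¹ ^ 2) (by positivity)).comp_sub_right τ
  exact h.congr (ae_of_all _ fun u ↦ (gaussW_eq L τ u).symm)

lemma integral_gaussW {L : ℝ} (hL : 0 < L) (τ : ℝ) :
    ∫ u, gaussW L τ u = L * √Real.pi := by
  simp_rw [gaussW_eq]
  rw [integral_sub_right_eq_self (fun u ↦ Real.exp (-(L⁻¹ ^ 2) * u ^ 2)) τ, integral_gaussian]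
  rw [inv_pow, div_inv_eq_mul, mul_comm, Real.sqrt_mul (by positivity), Real.sqrt_sq hL.le]

lemma integrable_abs_mul_exp_neg_mul_sq {b : ℝ} (hb : 0 < b) :
    Integrable fun u : ℝ ↦ |u| * Real.exp (-b * u ^ 2) := by
  have := (integrable_mul_exp_neg_mul_sq hb).norm
  refine this.congr (ae_of_all _ fun u ↦ ?_)
  simp [abs_of_pos (Real.exp_pos _)]

lemma integral_abs_mul_exp_neg_mul_sq {b : ℝ} (hb : 0 < b) :
    ∫ u : ℝ, |u| * Real.exp (-b * u ^ 2) = b⁻¹ := by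
  have h := integral_comp_abs (f := fun u ↦ u * Real.exp (-b * u ^ 2))
  simp only [sq_abs] at h
  rw [h]
  have h2 := integral_mul_cexp_neg_mul_sq (b := (b : ℂ)) (by simpa)
  have h3 : ∫ r in Ioi (0 : ℝ), r * Real.exp (-b * r ^ 2) = (2 * b)⁻¹ := by
    have : ((∫ r in Ioi (0 : ℝ), r * Real.exp (-b * r ^ 2) : ℝ) : ℂ) = (((2 * b)⁻¹ : ℝ) : ℂ) := by
      rw [← integral_complex_ofReal]
      push_cast
      exact h2
    exact_mod_cast this
  rw [h3]
  field_simp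

lemma integrable_one_add_abs_sub_mul_gaussW {L : ℝ} (hL : 0 < L) (τ : ℝ) :
    Integrable fun u ↦ (1 + |u - τ|) * gaussW L τ u := by
  simp_rw [gaussW_eq, add_mul, one_mul]
  have h1 := (integrable_exp_neg_mul_sq (b := L⁻¹ ^ 2) (by positivity))
  have h2 := (integrable_abs_mul_exp_neg_mul_sq (b := L⁻¹ ^ 2) (by positivity))
  exact (h1.add h2).comp_sub_right τ

lemma integral_one_add_abs_sub_mul_gaussW {L : ℝ} (hL : 0 < L) (τ : ℝ) :
    ∫ u, (1 + |u - τ|) * gaussW L τ u = L * √Real.pi + L ^ 2 := by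
  have h1 := (integrable_exp_neg_mul_sq (b := L⁻¹ ^ 2) (by positivity))
  have h2 := (integrable_abs_mul_exp_neg_mul_sq (b := L⁻¹ ^ 2) (by positivity))
  have h3 := integral_gaussW hL 0
  simp_rw [gaussW_eq, sub_zero] at h3
  simp_rw [gaussW_eq, add_mul, one_mul]
  rw [integral_sub_right_eq_self
    (fun u ↦ Real.exp (-(L⁻¹ ^ 2) * u ^ 2) + |u| * Real.exp (-(L⁻¹ ^ 2) * u ^ 2)) τ,
    integral_add h1 h2, h3, integral_abs_mul_exp_neg_mul_sq (by positivity)]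
  simp

/-- A Peetre-type inequality: it recentres linear growth at `τ`, and with the variables exchanged it
recentres decay. -/
lemma one_add_abs_le (t τ : ℝ) : 1 + |t| ≤ (1 + |τ|) * (1 + |t - τ|) := by
  have h : |t| ≤ |τ| + |t - τ| := by
    have := abs_add_le τ (t - τ)
    simpa using this
  nlinarith [abs_nonneg τ, abs_nonneg (t - τ), mul_nonneg (abs_nonneg τ) (abs_nonneg (t - τ))]

lemma integrable_one_add_abs_mul_gaussW {L : ℝ} (hL : 0 < L) (τ : ℝ) :
    Integrable fun u ↦ (1 + |u|) * gaussW L τ u := by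
  refine ((integrable_one_add_abs_sub_mul_gaussW hL τ).const_mul (1 + |τ|)).mono'
    (by have := continuous_gaussW L τ; fun_prop) (ae_of_all _ fun u ↦ ?_)
  have h0 := (gaussW_pos L τ u).le
  rw [Real.norm_of_nonneg (by positivity), ← mul_assoc]
  exact mul_le_mul_of_nonneg_right (one_add_abs_le u τ) h0

lemma integral_one_add_abs_mul_gaussW_le {L : ℝ} (hL : 0 < L) (τ : ℝ) :
    ∫ u, (1 + |u|) * gaussW L τ u ≤ (1 + |τ|) * (L * √Real.pi + L ^ 2) := by
  rw [← integral_one_add_abs_sub_mul_gaussW hL τ, ← integral_const_mul]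
  refine integral_mono (integrable_one_add_abs_mul_gaussW hL τ)
    ((integrable_one_add_abs_sub_mul_gaussW hL τ).const_mul _) fun u ↦ ?_
  simp only
  rw [← mul_assoc]
  exact mul_le_mul_of_nonneg_right (one_add_abs_le u τ) (gaussW_pos L τ u).le

lemma tendsto_one_add_abs_mul_gaussW {L : ℝ} (hL : 0 < L) (τ : ℝ) :
    Tendsto (fun u ↦ (1 + |u|) * gaussW L τ u) (cocompact ℝ) (𝓝 0) := by
  have h1 : Tendsto (fun u : ℝ ↦ |u| ^ (1 : ℝ) * Real.exp (-(L⁻¹ ^ 2) * u ^ 2)) (cocompact ℝ) (𝓝 0) :=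
    tendsto_rpow_abs_mul_exp_neg_mul_sq_cocompact (by positivity) 1
  have h0 : Tendsto (fun u : ℝ ↦ |u| ^ (0 : ℝ) * Real.exp (-(L⁻¹ ^ 2) * u ^ 2)) (cocompact ℝ) (𝓝 0) :=
    tendsto_rpow_abs_mul_exp_neg_mul_sq_cocompact (by positivity) 0
  have h2 := ((h0.add h1).comp (Homeomorph.subRight τ).isClosedEmbedding.tendsto_cocompact).const_mul
    (1 + |τ|)
  simp only [Real.rpow_zero, Real.rpow_one, add_zero, mul_zero, one_mul] at h2
  refine squeeze_zero (fun u ↦ by have := gaussW_pos L τ u; positivity) (fun u ↦ ?_) h2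
  simp only [Function.comp, Homeomorph.subRight_apply]
  rw [gaussW_eq, ← one_add_mul, ← mul_assoc]
  exact mul_le_mul_of_nonneg_right (one_add_abs_le u τ) (Real.exp_pos _).le

/-- The Fourier transform of a shifted Gaussian. The factor `exp(-L² μ² / 4)` suppresses every
frequency much larger than `1 / L`. -/
lemma integral_cexp_mul_gaussC {L : ℝ} (hL : 0 < L) (τ δ μ : ℝ) :
    ∫ t : ℝ, Complex.exp (Complex.I * μ * t) * gaussC L τ (t - Complex.I * δ) =
      (L * √Real.pi : ℝ) *
        Complex.exp (-(L ^ 2 * μ ^ 2 / 4 : ℝ) + Complex.I * μ * (τ + Complex.I * δ)) := by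
  have hLc : (L : ℂ) ≠ 0 := by exact_mod_cast hL.ne'
  have h := integral_cexp_quadratic (b := ((-(L⁻¹ ^ 2) : ℝ) : ℂ))
    (by simp only [Complex.ofReal_re]; have : 0 < L⁻¹ ^ 2 := by positivity
        linarith)
    (Complex.I * μ + 2 * (τ + Complex.I * δ) / L ^ 2) (-(τ + Complex.I * δ) ^ 2 / L ^ 2)
  convert h using 1
  · congr 1; ext t
    rw [gaussC, ← Complex.exp_add]
    congr 1
    push_cast
    field_simp
    ring
  · congr 1
    · have e : (Real.pi : ℂ) / -((-(L⁻¹ ^ 2) : ℝ) : ℂ) = ((L ^ 2 * Real.pi : ℝ) : ℂ) := by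
        push_cast; field_simp
      rw [e]
      have e2 : (1 / 2 : ℂ) = ((1 / 2 : ℝ) : ℂ) := by push_cast; ring
      rw [e2, ← Complex.ofReal_cpow (by positivity), ← Real.sqrt_eq_rpow,
        Real.sqrt_mul (by positivity), Real.sqrt_sq hL.le]
    · congr 1
      push_cast
      field_simp
      ring_nf
      simp only [Complex.I_sq]
      ring

/-! ### Twisted Gaussian averages of the logarithm -/

/-- A branch of the logarithm of `(s - 1) ζ(s) / s` on the half-plane `Re s > 1/2`, normalised on
the line `Re s = 2`. -/
structure IsLogZetaQuot (l : ℂ → ℂ) : Prop where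
  differentiableOn : DifferentiableOn ℂ l {s | 1 / 2 < s.re}
  exp_eq : ∀ s : ℂ, 1 / 2 < s.re → Complex.exp (l s) = zetaQuot s
  line_two : ∀ t : ℝ, l (2 + Complex.I * t) = logSeries t + logPoleFactor t

lemma IsLogZetaQuot.exists_norm_le {l : ℂ → ℂ} (hl : IsLogZetaQuot l) {σ : ℝ} (hσ : 1 / 2 < σ) :
    ∃ C : ℝ, 0 ≤ C ∧ ∀ x ∈ Icc σ 2, ∀ y : ℝ, ‖l (x + Complex.I * y)‖ ≤ C * (1 + |y|) :=
  exists_norm_log_zetaQuot_le hl.1 hl.2 hl.3 hσ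

lemma IsLogZetaQuot.continuous_line {l : ℂ → ℂ} (hl : IsLogZetaQuot l) {σ : ℝ} (hσ : 1 / 2 < σ) :
    Continuous fun t : ℝ ↦ l (σ + Complex.I * t) :=
  hl.1.continuousOn.comp_continuous (by fun_prop) fun y ↦ by simpa using hσ

lemma IsLogZetaQuot.re_eq {l : ℂ → ℂ} (hl : IsLogZetaQuot l) {s : ℂ} (hs : 1 / 2 < s.re) :
    (l s).re = Real.log ‖zetaQuot s‖ := by
  rw [← hl.exp_eq s hs, Complex.norm_exp, Real.log_exp]

/-- The kernel is continued holomorphically through `t = -i(s - σ)`, which becomes `t - i(2 - σ)` on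
`Re s = 2`. The Gaussian beats the linear growth of `l`. -/
lemma IsLogZetaQuot.integral_shift {l : ℂ → ℂ} (hl : IsLogZetaQuot l) {σ : ℝ} (hσ : 1 / 2 < σ)
    (hσ2 : σ ≤ 2) {L : ℝ} (hL : 0 < L) (τ μ : ℝ) :
    ∫ t : ℝ, l (σ + Complex.I * t) * (Complex.exp (Complex.I * μ * t) * gaussC L τ t) =
      ∫ t : ℝ, l (2 + Complex.I * t) * (Complex.exp (Complex.I * μ * (t - Complex.I * (2 - σ : ℝ))) *
        gaussC L τ (t - Complex.I * (2 - σ : ℝ))) := by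
  obtain ⟨C, hC0, hC⟩ := hl.exists_norm_le hσ
  set H : ℂ → ℂ := fun s ↦ l s * (Complex.exp (Complex.I * μ * (-Complex.I * (s - σ))) *
    gaussC L τ (-Complex.I * (s - σ))) with hH
  have hdiff : DifferentiableOn ℂ H {s | s.re ∈ Icc σ 2} := by
    have h1 : DifferentiableOn ℂ l {s | s.re ∈ Icc σ 2} :=
      hl.1.mono fun s hs ↦ lt_of_lt_of_le hσ hs.1
    have h2 : Differentiable ℂ fun s : ℂ ↦ gaussC L τ (-Complex.I * (s - σ)) :=
      (differentiable_gaussC L τ).comp (by fun_prop)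
    exact h1.mul (Differentiable.mul (by fun_prop) h2).differentiableOn
  have harg : ∀ x y : ℝ, -Complex.I * ((x : ℂ) + Complex.I * y - σ) =
      y - Complex.I * (x - σ : ℝ) := by
    intro x y
    push_cast
    linear_combination (-(y : ℂ)) * Complex.I_sq
  set K : ℝ := C * (Real.exp (|μ| * 2) * Real.exp ((2 / L) ^ 2)) with hK
  have key := integral_verticalLine_eq (H := H) hσ2 hdiff
    (B := fun y ↦ K * ((1 + |y|) * gaussW L τ y)) ?_
    ((integrable_one_add_abs_mul_gaussW hL τ).const_mul K) ?_ ?_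
  · rw [hH] at key
    simp only [harg] at key
    simp only [sub_self, Complex.ofReal_zero, mul_zero, sub_zero, Complex.ofReal_ofNat] at key
    exact key
  · intro x hx y
    rw [hH]
    simp only [harg, norm_mul, norm_gaussC]
    have e1 : ‖Complex.exp (Complex.I * μ * (y - Complex.I * (x - σ : ℝ)))‖
        ≤ Real.exp (|μ| * 2) := by
      rw [Complex.norm_exp]
      apply Real.exp_le_exp.2
      have : (Complex.I * μ * (y - Complex.I * (x - σ : ℝ))).re = μ * (x - σ) := by
        simp
        ring
      rw [this]
      have h1 := le_abs_self μ
      have h2 := abs_nonneg μ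
      have : x - σ ≤ 2 := by linarith [hx.2]
      have : 0 ≤ x - σ := by linarith [hx.1]
      nlinarith
    have e2 : Real.exp (((x - σ) / L) ^ 2) ≤ Real.exp ((2 / L) ^ 2) := by
      apply Real.exp_le_exp.2
      have : 0 ≤ x - σ := by linarith [hx.1]
      have : x - σ ≤ 2 := by linarith [hx.2]
      gcongr
    have h0 := gaussW_pos L τ y
    calc _ ≤ (C * (1 + |y|)) * (Real.exp (|μ| * 2) * (Real.exp ((2 / L) ^ 2) * gaussW L τ y)) := by
          gcongr
          exact hC x hx y
      _ = _ := by rw [hK]; ring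
  · simpa using ((tendsto_one_add_abs_mul_gaussW hL τ).mono_left atTop_le_cocompact).const_mul K
  · simpa using ((tendsto_one_add_abs_mul_gaussW hL τ).mono_left atBot_le_cocompact).const_mul K

/-- The value of the `k`-th term of the Dirichlet series integrated against a shifted Gaussian. -/
noncomputable def gaussTerm (L τ δ μ : ℝ) (k : ℕ) : ℂ :=
  ∫ t : ℝ, (logZetaCoeff k : ℂ) * (k : ℂ) ^ (-(2 + Complex.I * t)) *
    (Complex.exp (Complex.I * μ * (t - Complex.I * δ)) * gaussC L τ (t - Complex.I * δ))

lemma natCast_cpow_neg_two_add {k : ℕ} (hk : 0 < k) (t : ℝ) :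
    (k : ℂ) ^ (-(2 + Complex.I * t)) =
      (((k : ℝ) ^ 2)⁻¹ : ℝ) * Complex.exp (-(Complex.I * Real.log k * t)) := by
  have hkc : (k : ℂ) ≠ 0 := by exact_mod_cast hk.ne'
  rw [neg_add, Complex.cpow_add _ _ hkc, Complex.cpow_neg]
  congr 1
  · push_cast
    congr 1
    exact_mod_cast Complex.cpow_natCast (k : ℂ) 2
  · rw [Complex.cpow_def_of_ne_zero hkc, ← Complex.natCast_log]
    congr 1
    ring

lemma gaussTerm_eq {L : ℝ} (hL : 0 < L) (τ δ μ : ℝ) {k : ℕ} (hk : 0 < k) :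
    gaussTerm L τ δ μ k = (logZetaCoeff k * ((k : ℝ) ^ 2)⁻¹ * Real.exp (μ * δ) * (L * √Real.pi) : ℝ) *
      Complex.exp (-(L ^ 2 * (μ - Real.log k) ^ 2 / 4 : ℝ) +
        Complex.I * (μ - Real.log k : ℝ) * (τ + Complex.I * δ)) := by
  have h := integral_cexp_mul_gaussC hL τ δ (μ - Real.log k)
  push_cast
  push_cast at h
  rw [mul_assoc, ← h, gaussTerm, ← integral_const_mul]
  congr 1
  ext t
  rw [natCast_cpow_neg_two_add hk]
  have e1 : Complex.exp (Complex.I * μ * (t - Complex.I * δ)) =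
      Complex.exp (μ * δ) * Complex.exp (Complex.I * μ * t) := by
    rw [← Complex.exp_add]
    congr 1
    linear_combination (-(μ : ℂ) * δ) * Complex.I_sq
  have e2 : Complex.exp (Complex.I * (μ - Real.log k) * t) =
      Complex.exp (Complex.I * μ * t) * Complex.exp (-(Complex.I * Real.log k * t)) := by
    rw [← Complex.exp_add]
    congr 1
    ring
  push_cast at e2 ⊢
  rw [e1, e2]
  ring

lemma norm_gaussTerm {L : ℝ} (hL : 0 < L) (τ δ μ : ℝ) {k : ℕ} (hk : 0 < k) :
    ‖gaussTerm L τ δ μ k‖ = logZetaCoeff k * ((k : ℝ) ^ 2)⁻¹ * Real.exp (μ * δ) * (L * √Real.pi) *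
      Real.exp (-(L ^ 2 * (μ - Real.log k) ^ 2 / 4) - (μ - Real.log k) * δ) := by
  rw [gaussTerm_eq hL τ δ μ hk, norm_mul, Complex.norm_real, Complex.norm_exp,
    Real.norm_of_nonneg]
  · congr 2
    generalize μ - Real.log k = ν
    rw [Complex.add_re, ← Complex.ofReal_neg, Complex.ofReal_re]
    simp
    ring
  · have := logZetaCoeff_nonneg k
    positivity

lemma gaussTerm_zero (L τ δ μ : ℝ) : gaussTerm L τ δ μ 0 = 0 := by
  simp [gaussTerm, logZetaCoeff]

/-- At the resonant frequency `μ = log k` the oscillation disappears, and `exp(μ (2 - σ))` converts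
`k^(-2)` back into `k^(-σ)`: the diagonal remembers the original line. -/
lemma gaussTerm_log {L : ℝ} (hL : 0 < L) (τ σ : ℝ) {k : ℕ} (hk : 0 < k) :
    gaussTerm L τ (2 - σ) (Real.log k) k =
      (L * √Real.pi * (logZetaCoeff k * (k : ℝ) ^ (-σ)) : ℝ) := by
  rw [gaussTerm_eq hL τ _ _ hk]
  have hk' : (0 : ℝ) < k := by exact_mod_cast hk
  have : Real.exp (Real.log k * (2 - σ)) = (k : ℝ) ^ 2 * (k : ℝ) ^ (-σ) := by
    rw [← Real.rpow_def_of_pos hk', sub_eq_add_neg, Real.rpow_add hk']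
    norm_cast
  rw [this, sub_self]
  have e : (logZetaCoeff k * ((k : ℝ) ^ 2)⁻¹ * ((k : ℝ) ^ 2 * (k : ℝ) ^ (-σ)) * (L * √Real.pi)) =
      L * √Real.pi * (logZetaCoeff k * (k : ℝ) ^ (-σ)) := by
    field_simp
  rw [e]
  simp

/-- If `a < b`, then `log (b/a) ≥ 1 - a/b ≥ 1/(a + 1) ≥ 1/(2N)`. Only one of the integers needs to
be at most `N`; in the application the other is `k n` with `k` unrestricted. -/
lemma inv_le_abs_log_sub_log {a b N : ℕ} (ha : 0 < a) (hb : 0 < b) (hab : a ≠ b)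
    (hN : a ≤ N) : 1 / (2 * N : ℝ) ≤ |Real.log a - Real.log b| := by
  wlog h : a < b generalizing a b
  · rw [abs_sub_comm]
    exact this hb ha hab.symm (by omega) (by omega)
  have ha' : (0 : ℝ) < a := by exact_mod_cast ha
  have hb' : (0 : ℝ) < b := by exact_mod_cast hb
  have h1 := Real.one_sub_inv_le_log_of_pos (div_pos hb' ha')
  rw [Real.log_div hb'.ne' ha'.ne', inv_div] at h1
  have h2 : (a : ℝ) + 1 ≤ b := by exact_mod_cast h
  have h3 : (1 : ℝ) ≤ a := by exact_mod_cast ha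
  have h4 : (a : ℝ) ≤ N := by exact_mod_cast hN
  have h5 : (0 : ℝ) < N := by linarith
  rw [abs_sub_comm]
  refine le_trans ?_ (h1.trans (le_abs_self _))
  rw [one_sub_div hb'.ne', div_le_div_iff₀ (by positivity) hb']
  nlinarith

lemma exp_neg_le_inv {x : ℝ} (hx : 0 < x) : Real.exp (-x) ≤ x⁻¹ := by
  rw [Real.exp_neg]
  apply inv_anti₀ hx
  linarith [Real.add_one_le_exp x]

/-- Spacing of logarithms gives `|μ| ≥ 1/(2N)` for the remaining frequency `μ`. With `32 N ≤ L²`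
this means `L² |μ| ≥ 16`, so half of the Gaussian exponent absorbs the term `2 |μ|` caused by the
contour shift. The factor `k^(-2)` keeps the bound summable. -/
lemma norm_gaussTerm_le_of_ne {L : ℝ} (hL : 0 < L) (τ : ℝ) {δ : ℝ} (hδ0 : 0 ≤ δ) (hδ : δ ≤ 2)
    {m n N k : ℕ} (hm : 0 < m) (hn : 0 < n) (hmN : m ≤ N)
    (hLN : 32 * (N : ℝ) ≤ L ^ 2) (hk : k * n ≠ m) :
    ‖gaussTerm L τ δ (Real.log m - Real.log n) k‖ ≤
      ((k : ℝ) ^ 2)⁻¹ * ((N : ℝ) ^ 2 * (L * √Real.pi) * (32 * N ^ 2 / L ^ 2)) := by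
  rcases Nat.eq_zero_or_pos k with rfl | hk0
  · simp [gaussTerm_zero]
  rw [norm_gaussTerm hL _ _ _ hk0]
  have hN : 0 < N := hm.trans_le hmN
  have hN' : (1 : ℝ) ≤ N := by exact_mod_cast hN
  have hk0' : (0 : ℝ) < k := by exact_mod_cast hk0
  have hn0' : (0 : ℝ) < n := by exact_mod_cast hn
  set μ := Real.log m - Real.log n - Real.log k with hμ
  have hμ1 : 1 / (2 * N : ℝ) ≤ |μ| := by
    have := inv_le_abs_log_sub_log hm (Nat.mul_pos hk0 hn) (Ne.symm hk) hmN
    rwa [Nat.cast_mul, Real.log_mul hk0'.ne' hn0'.ne',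
      show Real.log m - (Real.log k + Real.log n) = μ by rw [hμ]; ring] at this
  have hμ0 : 0 < |μ| := lt_of_lt_of_le (by positivity) hμ1
  have h16 : 16 ≤ L ^ 2 * |μ| := by
    have : 32 * (N : ℝ) * (1 / (2 * N)) ≤ L ^ 2 * |μ| := by gcongr
    have e : 32 * (N : ℝ) * (1 / (2 * N)) = 16 := by field_simp; norm_num
    linarith
  have hexp1 : Real.exp (-(L ^ 2 * μ ^ 2 / 4) - μ * δ) ≤ 32 * N ^ 2 / L ^ 2 := by
    have h1 : -(L ^ 2 * μ ^ 2 / 4) - μ * δ ≤ -(L ^ 2 * μ ^ 2 / 8) := by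
      have a1 : -(μ * δ) ≤ |μ| * 2 := by
        calc -(μ * δ) ≤ |μ * δ| := neg_le_abs _
          _ = |μ| * δ := by rw [abs_mul, abs_of_nonneg hδ0]
          _ ≤ |μ| * 2 := by gcongr
      have a2 : μ ^ 2 = |μ| * |μ| := by rw [← sq, sq_abs]
      rw [a2]
      nlinarith
    refine (Real.exp_le_exp.2 h1).trans ?_
    have hμ2 : (1 / (2 * N : ℝ)) ^ 2 ≤ μ ^ 2 := by
      rw [← sq_abs μ]; gcongr
    have hpos : 0 < L ^ 2 * μ ^ 2 / 8 := by
      have : 0 < μ ^ 2 := lt_of_lt_of_le (by positivity) hμ2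
      positivity
    refine (exp_neg_le_inv hpos).trans ?_
    calc (L ^ 2 * μ ^ 2 / 8)⁻¹ ≤ (L ^ 2 * (1 / (2 * N : ℝ)) ^ 2 / 8)⁻¹ := by gcongr
      _ = 32 * N ^ 2 / L ^ 2 := by field_simp; norm_num
  have hexp2 : Real.exp ((Real.log m - Real.log n) * δ) ≤ (N : ℝ) ^ 2 := by
    have h1 : Real.log m ≤ Real.log N :=
      Real.log_le_log (by exact_mod_cast hm) (by exact_mod_cast hmN)
    have h2 : 0 ≤ Real.log n := Real.log_natCast_nonneg n
    have h3 : 0 ≤ Real.log N := Real.log_natCast_nonneg N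
    calc _ ≤ Real.exp (Real.log N * 2) := by
          apply Real.exp_le_exp.2
          nlinarith
      _ = (N : ℝ) ^ 2 := by
          rw [← Real.rpow_def_of_pos (by linarith)]
          norm_cast
  calc _ ≤ 1 * ((k : ℝ) ^ 2)⁻¹ * (N : ℝ) ^ 2 * (L * √Real.pi) * (32 * N ^ 2 / L ^ 2) := by
        have := logZetaCoeff_nonneg k
        gcongr
        exact logZetaCoeff_le_one k
    _ = _ := by ring

/-- The diagonal contribution attached to a pair of integers. -/
noncomputable def diagTerm (σ : ℝ) (m n : ℕ) : ℝ :=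
  if n ∣ m then logZetaCoeff (m / n) * ((m / n : ℕ) : ℝ) ^ (-σ) else 0

/-- The implied constant in the twisted Gaussian averages. -/
noncomputable def twistConst : ℝ := 32 * √Real.pi * (∑' k : ℕ, ((k : ℝ) ^ 2)⁻¹) + 24 * Real.exp 4

lemma twistConst_nonneg : 0 ≤ twistConst := by
  have : 0 ≤ ∑' k : ℕ, ((k : ℝ) ^ 2)⁻¹ := tsum_nonneg fun k ↦ by positivity
  unfold twistConst; positivity

lemma continuous_shiftedKernel (L τ δ μ : ℝ) : Continuous fun t : ℝ ↦
    Complex.exp (Complex.I * μ * (t - Complex.I * δ)) * gaussC L τ (t - Complex.I * δ) := by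
  have := (differentiable_gaussC L τ).continuous
  fun_prop

lemma norm_shiftedKernel (L τ δ μ t : ℝ) :
    ‖Complex.exp (Complex.I * μ * (t - Complex.I * δ)) * gaussC L τ (t - Complex.I * δ)‖ =
      Real.exp (μ * δ) * Real.exp ((δ / L) ^ 2) * gaussW L τ t := by
  rw [norm_mul, norm_gaussC, Complex.norm_exp, ← mul_assoc]
  congr 3
  simp

lemma hasSum_gaussTerm {L : ℝ} (hL : 0 < L) (τ δ μ : ℝ) :
    HasSum (gaussTerm L τ δ μ) (∫ t : ℝ, logSeries t *
      (Complex.exp (Complex.I * μ * (t - Complex.I * δ)) * gaussC L τ (t - Complex.I * δ))) := by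
  have hk := norm_shiftedKernel L τ δ μ
  have hkc := continuous_shiftedKernel L τ δ μ
  set Kf : ℝ → ℂ := fun t ↦ Complex.exp (Complex.I * μ * (t - Complex.I * δ)) *
    gaussC L τ (t - Complex.I * δ) with hKf
  have hg := (integrable_gaussW hL τ).const_mul (Real.exp (μ * δ) * Real.exp ((δ / L) ^ 2))
  have hb : ∀ k : ℕ, ∀ t : ℝ, ‖(logZetaCoeff k : ℂ) * (k : ℂ) ^ (-(2 + Complex.I * t)) * Kf t‖ ≤
      ((k : ℝ) ^ 2)⁻¹ * (Real.exp (μ * δ) * Real.exp ((δ / L) ^ 2) * gaussW L τ t) := by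
    intro k t
    rw [norm_mul, ← hk]
    exact mul_le_mul_of_nonneg_right (norm_logZetaTerm_le k t) (norm_nonneg _)
  have hint : ∀ k : ℕ, Integrable fun t : ℝ ↦
      (logZetaCoeff k : ℂ) * (k : ℂ) ^ (-(2 + Complex.I * t)) * Kf t := fun k ↦
    (hg.const_mul _).mono' ((continuous_logZetaTerm k).mul hkc).aestronglyMeasurable
      (ae_of_all _ (hb k))
  have := hasSum_integral_of_summable_integral_norm hint ?_
  · simp only [tsum_mul_right] at this
    exact this
  · refine Summable.of_nonneg_of_le (fun k ↦ integral_nonneg fun t ↦ norm_nonneg _) (fun k ↦ ?_)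
      (summable_inv_sq.mul_right
        (∫ t, Real.exp (μ * δ) * Real.exp ((δ / L) ^ 2) * gaussW L τ t))
    rw [← integral_const_mul]
    exact integral_mono (hint k).norm (hg.const_mul _) (hb k)

lemma norm_logPoleFactor_le_div (t τ : ℝ) :
    ‖logPoleFactor t‖ ≤ 4 / (1 + |τ|) * (1 + |t - τ|) := by
  refine (norm_logPoleFactor_le t).trans ?_
  have h1 := Complex.abs_re_le_norm (2 + Complex.I * t : ℂ)
  have h2 := Complex.abs_im_le_norm (2 + Complex.I * t : ℂ)
  simp at h1 h2
  have h3 : (1 + |t|) / 2 ≤ ‖(2 + Complex.I * t : ℂ)‖ := by linarith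
  have h4 : 1 + |τ| ≤ (1 + |t|) * (1 + |t - τ|) := by
    have := one_add_abs_le τ t
    rwa [abs_sub_comm] at this
  have h0 := abs_nonneg t
  have h5 := abs_nonneg τ
  rw [norm_inv]
  calc 2 * ‖(2 + Complex.I * t : ℂ)‖⁻¹ ≤ 2 * ((1 + |t|) / 2)⁻¹ := by gcongr
    _ = 4 / (1 + |t|) := by field_simp; norm_num
    _ ≤ 4 / (1 + |τ|) * (1 + |t - τ|) := by
        rw [div_mul_eq_mul_div, div_le_div_iff₀ (by positivity) (by positivity)]
        linarith

/-- On `Re s = 2` the Dirichlet series contributes its resonant term, and its nonresonant terms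
total `O(N⁴ / L)`. The logarithm of the pole factor has size about `1 / |t|`, which gives the term
in `L² / (1 + |τ|)`. The factors `N²` come from `exp(μ δ) ≤ (m/n)^δ` with `δ ≤ 2`. -/
lemma IsLogZetaQuot.norm_integral_sub_diagTerm_le {l : ℂ → ℂ} (hl : IsLogZetaQuot l) {σ : ℝ}
    (hσ : 1 / 2 < σ) (hσ2 : σ ≤ 2) {L : ℝ} (hL : 1 ≤ L) (τ : ℝ)
    {m n N : ℕ} (hm : 0 < m) (hn : 0 < n) (hmN : m ≤ N)
    (hLN : 32 * (N : ℝ) ≤ L ^ 2) :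
    ‖(∫ t : ℝ, l (σ + Complex.I * t) *
      (Complex.exp (Complex.I * (Real.log m - Real.log n : ℝ) * t) * gaussC L τ t)) -
      (L * √Real.pi * diagTerm σ m n : ℝ)‖ ≤
      twistConst * (N : ℝ) ^ 2 * ((N : ℝ) ^ 2 / L + L ^ 2 / (1 + |τ|)) := by
  have hL0 : 0 < L := by linarith
  set μ := Real.log m - Real.log n with hμ
  set δ := 2 - σ with hδ
  have hδ0 : 0 ≤ δ := by linarith
  have hδ2 : δ ≤ 2 := by linarith
  have hN : 0 < N := hm.trans_le hmN
  have hN' : (1 : ℝ) ≤ N := by exact_mod_cast hN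
  rw [hl.integral_shift hσ hσ2 hL0]
  have hkc := continuous_shiftedKernel L τ δ μ
  have hk := norm_shiftedKernel L τ δ μ
  have hs := hasSum_gaussTerm hL0 τ δ μ
  set Kf : ℝ → ℂ := fun t ↦ Complex.exp (Complex.I * μ * (t - Complex.I * δ)) *
    gaussC L τ (t - Complex.I * δ) with hKf
  have hg := (integrable_gaussW hL0 τ).const_mul (Real.exp (μ * δ) * Real.exp ((δ / L) ^ 2))
  have hKi : Integrable Kf := hg.mono' hkc.aestronglyMeasurable
    (ae_of_all _ fun t ↦ (hk t).le)
  have hi1 : Integrable fun t ↦ logSeries t * Kf t :=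
    hKi.bdd_mul continuous_logSeries.aestronglyMeasurable (ae_of_all _ norm_logSeries_le)
  have hi2 : Integrable fun t ↦ logPoleFactor t * Kf t :=
    hKi.bdd_mul (c := 1) continuous_logPoleFactor.aestronglyMeasurable
      (ae_of_all _ fun t ↦ by linarith [norm_logPoleFactor_le t, norm_inv_two_add_le t])
  have e1 : ∫ t : ℝ, l (2 + Complex.I * t) * Kf t =
      (∫ t, logSeries t * Kf t) + ∫ t, logPoleFactor t * Kf t := by
    rw [← integral_add hi1 hi2]
    congr 1; ext t
    rw [hl.line_two, add_mul]
  have hexpμ : Real.exp (μ * δ) ≤ (N : ℝ) ^ 2 := by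
    have h1 : Real.log m ≤ Real.log N :=
      Real.log_le_log (by exact_mod_cast hm) (by exact_mod_cast hmN)
    have h2 : 0 ≤ Real.log n := Real.log_natCast_nonneg n
    have h3 : 0 ≤ Real.log N := Real.log_natCast_nonneg N
    calc _ ≤ Real.exp (Real.log N * 2) := by
          apply Real.exp_le_exp.2
          nlinarith
      _ = (N : ℝ) ^ 2 := by
          rw [← Real.rpow_def_of_pos (by linarith)]
          norm_cast
  have hexpδ : Real.exp ((δ / L) ^ 2) ≤ Real.exp 4 := by
    apply Real.exp_le_exp.2
    have : δ / L ≤ 2 := (div_le_self hδ0 hL).trans hδ2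
    have : 0 ≤ δ / L := by positivity
    nlinarith
  have hpole : ‖∫ t, logPoleFactor t * Kf t‖ ≤
      24 * Real.exp 4 * (N : ℝ) ^ 2 * (L ^ 2 / (1 + |τ|)) := by
    have hb : ∀ t, ‖logPoleFactor t * Kf t‖ ≤ (4 / (1 + |τ|) * ((N : ℝ) ^ 2 * Real.exp 4)) *
        ((1 + |t - τ|) * gaussW L τ t) := by
      intro t
      rw [norm_mul, hk]
      have h0 := gaussW_pos L τ t
      have h5 := abs_nonneg τ
      calc _ ≤ (4 / (1 + |τ|) * (1 + |t - τ|)) * ((N : ℝ) ^ 2 * Real.exp 4 * gaussW L τ t) := by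
            gcongr
            exact norm_logPoleFactor_le_div t τ
        _ = _ := by ring
    refine (norm_integral_le_of_norm_le ((integrable_one_add_abs_sub_mul_gaussW hL0 τ).const_mul _)
      (ae_of_all _ hb)).trans ?_
    rw [integral_const_mul, integral_one_add_abs_sub_mul_gaussW hL0]
    have hpi : √Real.pi ≤ 2 := by
      rw [Real.sqrt_le_left (by norm_num)]
      linarith [Real.pi_lt_four]
    have h5 := abs_nonneg τ
    have : L * √Real.pi + L ^ 2 ≤ 6 * L ^ 2 := by nlinarith
    calc _ ≤ 4 / (1 + |τ|) * ((N : ℝ) ^ 2 * Real.exp 4) * (6 * L ^ 2) := by gcongr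
      _ = _ := by ring
  have hser : ‖(∫ t, logSeries t * Kf t) - (L * √Real.pi * diagTerm σ m n : ℝ)‖ ≤
      32 * √Real.pi * (∑' k : ℕ, ((k : ℝ) ^ 2)⁻¹) * (N : ℝ) ^ 2 * ((N : ℝ) ^ 2 / L) := by
    -- At most one `k` satisfies `k n = m`, so the diagonal is a series with at most one nonzero
    -- term and can be subtracted termwise.
    have hd : HasSum (fun k : ℕ ↦ if k * n = m then gaussTerm L τ δ μ k else 0)
        ((L * √Real.pi * diagTerm σ m n : ℝ) : ℂ) := by
      by_cases hnm : n ∣ m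
      · obtain ⟨k, rfl⟩ := hnm
        have hk0 : 0 < k := Nat.pos_of_mul_pos_left hm
        have hn' : (n : ℝ) ≠ 0 := by exact_mod_cast hn.ne'
        have hk' : (k : ℝ) ≠ 0 := by exact_mod_cast hk0.ne'
        have hμk : μ = Real.log k := by
          rw [hμ]; push_cast; rw [Real.log_mul hn' hk']; ring
        have e : ((L * √Real.pi * diagTerm σ (n * k) n : ℝ) : ℂ) =
            (if k * n = n * k then gaussTerm L τ δ μ k else 0) := by
          rw [if_pos (mul_comm _ _), hμk, gaussTerm_log hL0 τ σ hk0, diagTerm,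
            if_pos (Dvd.intro k rfl), Nat.mul_div_cancel_left k hn]
        rw [e]
        refine hasSum_single k fun k' hk' ↦ if_neg fun h ↦ hk' ?_
        rw [mul_comm] at h
        exact Nat.eq_of_mul_eq_mul_left hn h
      · have : (fun k : ℕ ↦ if k * n = m then gaussTerm L τ δ μ k else 0) = fun _ ↦ 0 := by
          funext k
          exact if_neg fun h ↦ hnm ⟨k, by rw [← h, mul_comm]⟩
        rw [this, diagTerm, if_neg hnm]
        simp
    have hdiff := hs.sub hd
    rw [← hdiff.tsum_eq]
    have hS := summable_inv_sq.hasSum.mul_right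
      ((N : ℝ) ^ 2 * (L * √Real.pi) * (32 * N ^ 2 / L ^ 2))
    refine (tsum_of_norm_bounded hS fun k ↦ ?_).trans (le_of_eq ?_)
    · by_cases hkm : k * n = m
      · simp [hkm]
        positivity
      · rw [if_neg hkm, sub_zero]
        exact norm_gaussTerm_le_of_ne hL0 τ hδ0 hδ2 hm hn hmN hLN hkm
    · field_simp
  rw [e1, add_sub_right_comm]
  refine (norm_add_le _ _).trans ((add_le_add hser hpole).trans ?_)
  have hS0 : 0 ≤ ∑' k : ℕ, ((k : ℝ) ^ 2)⁻¹ := tsum_nonneg fun k ↦ by positivity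
  have hL2 : 0 ≤ (N : ℝ) ^ 2 * (L ^ 2 / (1 + |τ|)) := by positivity
  have hL3 : 0 ≤ (N : ℝ) ^ 2 * ((N : ℝ) ^ 2 / L) := by positivity
  have h4 : 0 ≤ 24 * Real.exp 4 := by positivity
  have h6 : 0 ≤ 32 * √Real.pi * (∑' k : ℕ, ((k : ℝ) ^ 2)⁻¹) := by positivity
  rw [twistConst]
  nlinarith [mul_nonneg h4 hL3, mul_nonneg h6 hL2]

/-! ### Passage to the critical line -/

/-- `log |(s - 1) ζ(s) / s|` on the vertical line `Re s = σ`. -/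
noncomputable def logNormQuot (σ u : ℝ) : ℝ := Real.log ‖zetaQuot (σ + Complex.I * u)‖

lemma logNormQuot_half (u : ℝ) :
    logNormQuot (1 / 2) u = Real.log ‖riemannZeta (1 / 2 + Complex.I * u)‖ := by
  rw [logNormQuot, ← norm_zetaQuot_half]
  norm_num

lemma continuous_zetaQuot_line {σ : ℝ} (hσ : 1 / 2 ≤ σ) :
    Continuous fun u : ℝ ↦ zetaQuot (σ + Complex.I * u) := by
  refine differentiableOn_zetaQuot.continuousOn.comp_continuous (by fun_prop) fun u h ↦ ?_
  have := congrArg Complex.re (Set.mem_singleton_iff.1 h)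
  simp at this
  linarith

lemma measurable_logNormQuot {σ : ℝ} (hσ : 1 / 2 ≤ σ) : Measurable (logNormQuot σ) :=
  Real.measurable_log.comp (continuous_zetaQuot_line hσ).norm.measurable

lemma logNormQuot_le {σ : ℝ} (hσ : 1 / 2 ≤ σ) (hσ2 : σ ≤ 2) (u : ℝ) :
    logNormQuot σ u ≤ 7 * (1 + |u|) := by
  have h1 := norm_zetaQuot_le (s := σ + Complex.I * u) (by simpa using hσ)
  have h2 : ‖(σ + Complex.I * u : ℂ)‖ ≤ 2 + |u| := by
    refine (norm_add_le _ _).trans ?_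
    simp only [Complex.norm_real, norm_mul, Complex.norm_I, one_mul, Real.norm_eq_abs]
    rw [abs_of_nonneg (by linarith)]
    linarith
  have h0 := abs_nonneg u
  refine (Real.log_le_self (norm_nonneg _)).trans ?_
  linarith

/-- The implied constant in the weighted `L¹` bound for `log |ζ|`. -/
noncomputable def logL1Const : ℝ := 42 + 2 * twistConst

lemma logL1Const_nonneg : 0 ≤ logL1Const := by
  have := twistConst_nonneg
  unfold logL1Const; positivity

lemma IsLogZetaQuot.re_line {l : ℂ → ℂ} (hl : IsLogZetaQuot l) {σ : ℝ} (hσ : 1 / 2 < σ) (u : ℝ) :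
    (l (σ + Complex.I * u)).re = logNormQuot σ u :=
  hl.re_eq (by simpa using hσ)

lemma IsLogZetaQuot.integrable_mul {l : ℂ → ℂ} (hl : IsLogZetaQuot l) {σ : ℝ} (hσ : 1 / 2 < σ)
    (hσ2 : σ ≤ 2) {L : ℝ} (hL : 0 < L) (τ : ℝ) {G : ℝ → ℂ} (hG : Continuous G) {K : ℝ}
    (hK : ∀ u, ‖G u‖ ≤ K * gaussW L τ u) :
    Integrable fun u : ℝ ↦ l (σ + Complex.I * u) * G u := by
  obtain ⟨C, hC0, hC⟩ := hl.exists_norm_le hσ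
  refine ((integrable_one_add_abs_mul_gaussW hL τ).const_mul (C * K)).mono'
    ((hl.continuous_line hσ).mul hG).aestronglyMeasurable (ae_of_all _ fun u ↦ ?_)
  rw [norm_mul]
  calc _ ≤ (C * (1 + |u|)) * (K * gaussW L τ u) := by
        have := norm_nonneg (G u)
        exact mul_le_mul (hC σ ⟨le_rfl, hσ2⟩ u) (hK u) this (by positivity)
    _ = _ := by ring

lemma IsLogZetaQuot.integrable_logNormQuot_mul {l : ℂ → ℂ} (hl : IsLogZetaQuot l) {σ : ℝ}
    (hσ : 1 / 2 < σ) (hσ2 : σ ≤ 2) {L : ℝ} (hL : 0 < L) (τ : ℝ) {G : ℝ → ℝ} (hG : Continuous G)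
    {K : ℝ} (hK : ∀ u, |G u| ≤ K * gaussW L τ u) :
    Integrable fun u : ℝ ↦ logNormQuot σ u * G u := by
  have h := (hl.integrable_mul hσ hσ2 hL τ (G := fun u ↦ (G u : ℂ)) (by fun_prop)
    (by simpa using hK)).re
  refine h.congr (ae_of_all _ fun u ↦ ?_)
  simp [hl.re_line hσ]

/-- The logarithm is bounded above by polynomial growth and its signed Gaussian average is under
control, so its negative part cannot be large on average. The bound is uniform in `σ`. -/
lemma IsLogZetaQuot.integral_abs_logNormQuot_le {l : ℂ → ℂ} (hl : IsLogZetaQuot l) {σ : ℝ}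
    (hσ : 1 / 2 < σ) (hσ2 : σ ≤ 2) {L : ℝ} (hL : 6 ≤ L) (τ : ℝ) :
    ∫ u, |logNormQuot σ u| * gaussW L τ u ≤ logL1Const * (1 + |τ|) * L ^ 2 := by
  have hL0 : 0 < L := by linarith
  have hi : Integrable fun u : ℝ ↦ logNormQuot σ u * gaussW L τ u :=
    hl.integrable_logNormQuot_mul hσ hσ2 hL0 τ (continuous_gaussW L τ) (K := 1) fun u ↦ by
      rw [one_mul, abs_of_pos (gaussW_pos L τ u)]
  have hi' : Integrable fun u : ℝ ↦ |logNormQuot σ u| * gaussW L τ u := by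
    refine hi.norm.congr (ae_of_all _ fun u ↦ ?_)
    simp [abs_of_pos (gaussW_pos L τ u)]
  have hpi : √Real.pi ≤ 2 := by
    rw [Real.sqrt_le_left (by norm_num)]
    linarith [Real.pi_lt_four]
  have hτ := abs_nonneg τ
  have h1 : |∫ u, logNormQuot σ u * gaussW L τ u| ≤ 2 * twistConst * L ^ 2 := by
    -- The trivial frequency `m = n = 1` has no diagonal term, since `Λ(1) = 0`. The condition `32 ≤
    -- L²` is the reason for `6 ≤ L`.
    have h := hl.norm_integral_sub_diagTerm_le hσ hσ2 (by linarith : 1 ≤ L) τ (m := 1) (n := 1)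
      (N := 1) one_pos one_pos le_rfl (by norm_num; nlinarith)
    have hd : diagTerm σ 1 1 = 0 := by simp [diagTerm, logZetaCoeff]
    rw [hd] at h
    simp only [sub_self, Complex.ofReal_zero, mul_zero, zero_mul, Complex.exp_zero, one_mul,
      sub_zero, Nat.cast_one, one_pow, mul_one, gaussC_ofReal] at h
    have e : ∫ u, logNormQuot σ u * gaussW L τ u =
        (∫ u : ℝ, l (σ + Complex.I * u) * (gaussW L τ u : ℂ)).re := by
      have := integral_re (hl.integrable_mul hσ hσ2 hL0 τ (G := fun u ↦ (gaussW L τ u : ℂ))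
        (by have := continuous_gaussW L τ; fun_prop) (K := 1) fun u ↦ by
          simp [abs_of_pos (gaussW_pos L τ u)])
      simp only [RCLike.re_to_complex] at this
      rw [← this]
      congr 1; ext u
      simp [hl.re_line hσ]
    rw [e]
    refine (Complex.abs_re_le_norm _).trans (h.trans ?_)
    have a1 : 1 / L ≤ L ^ 2 := by
      rw [div_le_iff₀ hL0]; nlinarith [sq_nonneg L]
    have a2 : L ^ 2 / (1 + |τ|) ≤ L ^ 2 := div_le_self (by positivity) (by linarith)
    nlinarith [mul_le_mul_of_nonneg_left (add_le_add a1 a2) twistConst_nonneg]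
  have h2 : ∫ u, |logNormQuot σ u| * gaussW L τ u ≤
      ∫ u, (14 * ((1 + |u|) * gaussW L τ u) - logNormQuot σ u * gaussW L τ u) := by
    refine integral_mono hi' (((integrable_one_add_abs_mul_gaussW hL0 τ).const_mul 14).sub hi)
      fun u ↦ ?_
    have h3 := logNormQuot_le hσ.le hσ2 u
    have h4 := gaussW_pos L τ u
    have h5 := abs_nonneg u
    have h6 : |logNormQuot σ u| ≤ 14 * (1 + |u|) - logNormQuot σ u := by
      rw [abs_le]; constructor <;> linarith
    calc _ ≤ (14 * (1 + |u|) - logNormQuot σ u) * gaussW L τ u := by gcongr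
      _ = _ := by ring
  rw [integral_sub ((integrable_one_add_abs_mul_gaussW hL0 τ).const_mul 14) hi,
    integral_const_mul] at h2
  have h3 := integral_one_add_abs_mul_gaussW_le hL0 τ
  have h4 : L * √Real.pi + L ^ 2 ≤ 3 * L ^ 2 := by nlinarith
  have h5 : (1 + |τ|) * (L * √Real.pi + L ^ 2) ≤ (1 + |τ|) * (3 * L ^ 2) := by gcongr
  have h6 := (abs_le.1 h1).1
  have h7 : 0 ≤ 2 * twistConst * L ^ 2 * |τ| := by
    have := twistConst_nonneg
    positivity
  have h8 : 0 ≤ (1 + |τ|) * L ^ 2 := by positivity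
  rw [logL1Const]
  nlinarith

lemma ae_zetaQuot_half_ne_zero : ∀ᵐ u : ℝ, zetaQuot ((1 / 2 : ℝ) + Complex.I * u) ≠ 0 := by
  have hc : {u : ℝ | zetaQuot ((1 / 2 : ℝ) + Complex.I * u) = 0}.Countable := by
    have hinj : Function.Injective fun u : ℝ ↦ (1 / 2 + Complex.I * u : ℂ) := by
      intro a b h
      simpa using h
    have hsub : {u : ℝ | zetaQuot ((1 / 2 : ℝ) + Complex.I * u) = 0} ⊆
        ⋃ k : ℕ, (fun u : ℝ ↦ (1 / 2 + Complex.I * u : ℂ)) ⁻¹'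
          (Metric.closedBall 0 k ∩ riemannZetaZeros) := by
      intro u hu
      obtain ⟨k, hk⟩ := exists_nat_ge ‖(1 / 2 + Complex.I * u : ℂ)‖
      refine mem_iUnion.2 ⟨k, by simpa using hk, ?_⟩
      rw [mem_riemannZetaZeros, ← norm_eq_zero, ← norm_zetaQuot_half, norm_eq_zero]
      simpa using hu
    refine (countable_iUnion fun k ↦ ?_).mono hsub
    exact (((isCompact_closedBall (0 : ℂ) (k : ℝ)).inter_riemannZetaZeros_finite).preimage
      hinj.injOn).countable
  have := hc.ae_notMem volume
  simpa using this

lemma ae_tendsto_logNormQuot :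
    ∀ᵐ u : ℝ, Tendsto (fun σ ↦ logNormQuot σ u) (𝓝[>] (1 / 2)) (𝓝 (logNormQuot (1 / 2) u)) := by
  filter_upwards [ae_zetaQuot_half_ne_zero] with u hu
  have h0 : ((1 / 2 : ℝ) + Complex.I * u : ℂ) ≠ 0 := by
    intro h
    have := congrArg Complex.re h
    norm_num at this
  have h1 : ContinuousAt (fun σ : ℝ ↦ zetaQuot (σ + Complex.I * u)) (1 / 2) :=
    ContinuousAt.comp (f := fun σ : ℝ ↦ (σ + Complex.I * u : ℂ))
      (differentiableAt_zetaQuot h0).continuousAt (by fun_prop)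
  exact (h1.norm.log (norm_ne_zero_iff.2 hu)).tendsto.mono_left nhdsWithin_le_nhds

/-- `log |(s - 1) ζ(s) / s|` is dominated by an integrable function near the critical line. -/
lemma exists_logNormQuot_bound (hRH : RiemannHypothesis) (A : ℝ) :
    ∃ δ > 0, ∃ b : ℝ → ℝ, (∀ x y, IntervalIntegrable b volume x y) ∧ (∀ u, 0 ≤ b u) ∧
      ∀ σ ∈ Ioo (1 / 2) (1 / 2 + δ), ∀ᵐ u : ℝ, u ∈ Icc (-A) A → |logNormQuot σ u| ≤ b u := by
  refine IsCompact.induction_on (s := Icc (-A) A) (p := fun S ↦ ∃ δ > 0, ∃ b : ℝ → ℝ,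
    (∀ x y, IntervalIntegrable b volume x y) ∧ (∀ u, 0 ≤ b u) ∧
      ∀ σ ∈ Ioo (1 / 2) (1 / 2 + δ), ∀ᵐ u : ℝ, u ∈ S → |logNormQuot σ u| ≤ b u)
    isCompact_Icc ?_ ?_ ?_ ?_
  · exact ⟨1, one_pos, 0, fun _ _ ↦ IntervalIntegrable.zero, fun _ ↦ le_rfl, fun _ _ ↦ by simp⟩
  · rintro S T hST ⟨δ, hδ, b, hb, hb0, h⟩
    exact ⟨δ, hδ, b, hb, hb0, fun σ hσ ↦ (h σ hσ).mono fun u hu hS ↦ hu (hST hS)⟩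
  · rintro S T ⟨δ, hδ, b, hb, hb0, h⟩ ⟨δ', hδ', b', hb', hb0', h'⟩
    refine ⟨min δ δ', lt_min hδ hδ', b + b', fun x y ↦ (hb x y).add (hb' x y),
      fun u ↦ add_nonneg (hb0 u) (hb0' u), fun σ hσ ↦ ?_⟩
    have h1 := min_le_left δ δ'
    have h2 := min_le_right δ δ'
    filter_upwards [h σ ⟨hσ.1, by linarith [hσ.2]⟩, h' σ ⟨hσ.1, by linarith [hσ.2]⟩]
      with u hu hu' hST
    rw [Pi.add_apply]
    rcases hST with hS | hT
    · linarith [hu hS, hb0' u]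
    · linarith [hu' hT, hb0 u]
  · intro u₀ _
    set s₀ : ℂ := (1 / 2 : ℝ) + Complex.I * u₀ with hs₀
    have h0 : s₀ ≠ 0 := by
      intro h
      have := congrArg Complex.re h
      norm_num [hs₀] at this
    have han : AnalyticAt ℂ zetaQuot s₀ :=
      differentiableOn_zetaQuot.analyticAt (isOpen_compl_singleton.mem_nhds h0)
    -- RH excludes zeros immediately to the right of `s₀`, so the order of vanishing there is
    -- finite.
    have hne : ¬ ∀ᶠ z in 𝓝 s₀, zetaQuot z = 0 := by
      intro h
      have ht : Tendsto (fun σ : ℝ ↦ (σ + Complex.I * u₀ : ℂ)) (𝓝[>] (1 / 2)) (𝓝 s₀) := by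
        have : Continuous fun σ : ℝ ↦ (σ + Complex.I * u₀ : ℂ) := by fun_prop
        exact (this.tendsto (1 / 2)).mono_left nhdsWithin_le_nhds
      have h2 := (ht.eventually h).and (self_mem_nhdsWithin)
      obtain ⟨σ, hσ0, hσ⟩ := h2.exists
      exact zetaQuot_ne_zero hRH (by simpa using hσ) hσ0
    obtain ⟨n, g, hg, hg0, hfg⟩ := (han.exists_eventuallyEq_pow_smul_nonzero_iff).2 hne
    set K := |Real.log ‖g s₀‖| + 1 with hK
    have hgK : ∀ᶠ z in 𝓝 s₀, |Real.log ‖g z‖| < K := by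
      have : ContinuousAt (fun z ↦ |Real.log ‖g z‖|) s₀ :=
        (hg.continuousAt.norm.log (norm_ne_zero_iff.2 hg0)).abs
      exact this.eventually (gt_mem_nhds (by rw [hK]; linarith))
    have hgne : ∀ᶠ z in 𝓝 s₀, g z ≠ 0 := hg.continuousAt.eventually_ne hg0
    obtain ⟨ε, hε, hball⟩ := Metric.eventually_nhds_iff_ball.1 (hfg.and (hgK.and hgne))
    set e := min ε 1 / 2 with he
    have he0 : 0 < e := by positivity
    refine ⟨Ioo (u₀ - e) (u₀ + e), mem_nhdsWithin_of_mem_nhds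
      (Ioo_mem_nhds (by linarith) (by linarith)), e, he0,
      fun u ↦ n * |Real.log (u - u₀)| + K, fun x y ↦ ?_, fun u ↦ by positivity, fun σ hσ ↦ ?_⟩
    · have h1 : IntervalIntegrable (fun u ↦ Real.log (u - u₀)) volume x y := by
        have := (intervalIntegral.intervalIntegrable_log' (a := x - u₀) (b := y - u₀)).comp_sub_right u₀
        simpa using this
      exact (h1.abs.const_mul n).add intervalIntegrable_const
    · have hne0 : ∀ᵐ u : ℝ, u ≠ u₀ := by
        have := (countable_singleton u₀).ae_notMem (volume : Measure ℝ)
        simpa using this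
      filter_upwards [hne0] with u hu hmem
      set s : ℂ := σ + Complex.I * u with hs
      have hsub : s - s₀ = ((σ - 1 / 2 : ℝ) : ℂ) + Complex.I * ((u - u₀ : ℝ) : ℂ) := by
        rw [hs, hs₀]; push_cast; ring
      have hnorm_lt : ‖s - s₀‖ < min ε 1 := by
        rw [hsub]
        refine (norm_add_le _ _).trans_lt ?_
        simp only [Complex.norm_real, norm_mul, Complex.norm_I, one_mul, Real.norm_eq_abs]
        have h1 : |σ - 1 / 2| < e := by
          rw [abs_lt]; constructor <;> linarith [hσ.1, hσ.2]
        have h2 : |u - u₀| < e := by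
          rw [abs_lt]; constructor <;> linarith [hmem.1, hmem.2]
        have : e + e = min ε 1 := by rw [he]; ring
        linarith
      obtain ⟨hf1, hf2, hf3⟩ := hball s (by
        rw [mem_ball_iff_norm]; exact hnorm_lt.trans_le (min_le_left _ _))
      have hlow : |u - u₀| ≤ ‖s - s₀‖ := by
        have := Complex.abs_im_le_norm (s - s₀)
        rw [hsub] at this ⊢
        simpa using this
      have hpos : 0 < |u - u₀| := abs_pos.2 (sub_ne_zero.2 hu)
      -- Within distance one of `s₀` the logarithm is nonpositive, and `|s - s₀| ≥ |u - u₀|`. The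
      -- singularity is thus dominated by `|log |u - u₀||`, independently of `σ`.
      have hlog : |Real.log ‖s - s₀‖| ≤ |Real.log (u - u₀)| := by
        have h1 := Real.log_le_log hpos hlow
        rw [Real.log_abs] at h1
        have h2 : Real.log ‖s - s₀‖ ≤ 0 :=
          Real.log_nonpos (norm_nonneg _) (hnorm_lt.le.trans (min_le_right _ _))
        rw [abs_of_nonpos h2]
        exact (neg_le_neg h1).trans (neg_le_abs _)
      have heq : logNormQuot σ u = n * Real.log ‖s - s₀‖ + Real.log ‖g s‖ := by
        rw [logNormQuot, ← hs, hf1, smul_eq_mul, norm_mul, norm_pow,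
          Real.log_mul (pow_ne_zero _ (hpos.trans_le hlow).ne') (norm_ne_zero_iff.2 hf3),
          Real.log_pow]
      rw [heq]
      refine (abs_add_le _ _).trans (add_le_add ?_ hf2.le)
      rw [abs_mul, Nat.abs_cast]
      gcongr

/-- Fatou's lemma along a sequence `σ → 1/2` transfers the uniform `L¹` bound to the critical line.
-/
lemma IsLogZetaQuot.integrable_half_and_integral_le {l : ℂ → ℂ} (hl : IsLogZetaQuot l) {L : ℝ}
    (hL : 6 ≤ L) (τ : ℝ) :
    Integrable (fun u ↦ |logNormQuot (1 / 2) u| * gaussW L τ u) ∧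
      ∫ u, |logNormQuot (1 / 2) u| * gaussW L τ u ≤ logL1Const * (1 + |τ|) * L ^ 2 := by
  have hL0 : 0 < L := by linarith
  set M := logL1Const * (1 + |τ|) * L ^ 2 with hM
  have hM0 : 0 ≤ M := by
    have := logL1Const_nonneg
    positivity
  set f : ℝ → ℝ → ℝ := fun σ u ↦ |logNormQuot σ u| * gaussW L τ u with hf
  have hmeas : ∀ σ, 1 / 2 ≤ σ → AEStronglyMeasurable (f σ) volume := fun σ hσ ↦
    ((measurable_logNormQuot hσ).abs.mul (continuous_gaussW L τ).measurable).aestronglyMeasurable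
  have hnn : ∀ σ u, 0 ≤ f σ u := fun σ u ↦ mul_nonneg (abs_nonneg _) (gaussW_pos L τ u).le
  obtain ⟨σ, -, hσ, hσlim⟩ := exists_seq_strictAnti_tendsto' (show (1 / 2 : ℝ) < 2 by norm_num)
  have hlim : Tendsto σ atTop (𝓝[>] (1 / 2)) :=
    tendsto_nhdsWithin_iff.2 ⟨hσlim, Eventually.of_forall fun n ↦ (hσ n).1⟩
  have hfat := Lp.eLpNorm_lim_le_liminf_eLpNorm (p := 1) (fun n ↦ hmeas (σ n) (hσ n).1.le)
    (f (1 / 2)) (by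
      filter_upwards [ae_tendsto_logNormQuot] with u hu
      exact ((hu.comp hlim).abs).mul_const _)
  have hle : eLpNorm (f (1 / 2)) 1 volume ≤ ENNReal.ofReal M := by
    refine hfat.trans (liminf_le_of_le (by isBoundedDefault) fun b hb ↦ ?_)
    obtain ⟨n, hn⟩ := hb.exists
    refine hn.trans ?_
    rw [eLpNorm_one_eq_lintegral_enorm, ← ofReal_integral_norm_eq_lintegral_enorm]
    · apply ENNReal.ofReal_le_ofReal
      simp_rw [Real.norm_of_nonneg (hnn _ _)]
      exact hl.integral_abs_logNormQuot_le (hσ n).1 (hσ n).2.le hL τ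
    · have := (hl.integrable_logNormQuot_mul (hσ n).1 (hσ n).2.le hL0 τ (continuous_gaussW L τ)
        (K := 1) fun u ↦ by rw [one_mul, abs_of_pos (gaussW_pos L τ u)]).norm
      refine this.congr (ae_of_all _ fun u ↦ ?_)
      simp [hf, abs_of_pos (gaussW_pos L τ u)]
  have hint : Integrable (f (1 / 2)) := by
    rw [← memLp_one_iff_integrable]
    exact ⟨hmeas _ le_rfl, hle.trans_lt ENNReal.ofReal_lt_top⟩
  refine ⟨hint, ?_⟩
  rw [eLpNorm_one_eq_lintegral_enorm, ← ofReal_integral_norm_eq_lintegral_enorm hint,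
    ENNReal.ofReal_le_ofReal_iff hM0] at hle
  simp_rw [Real.norm_of_nonneg (hnn _ _)] at hle
  exact hle

/-- Since `exp(-x²) = exp(-3x²/4) exp(-(x/2)²)`, tails can be measured against the wider Gaussian,
for which a uniform `L¹` bound is known. -/
lemma gaussW_le_mul_wide {L : ℝ} (hL : 0 < L) (τ : ℝ) {ε : ℝ} (hε : 0 < ε) :
    ∃ A : ℝ, 0 < A ∧ ∀ u, u ∉ Icc (-A) A → gaussW L τ u ≤ ε * gaussW (2 * L) τ u := by
  refine ⟨|τ| + 2 * L * (1 + ε⁻¹), by positivity, fun u hu ↦ ?_⟩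
  have hL' : L ≠ 0 := hL.ne'
  have e : gaussW L τ u = Real.exp (-(3 / 4 * ((u - τ) / L) ^ 2)) * gaussW (2 * L) τ u := by
    rw [gaussW, gaussW, ← Real.exp_add]
    congr 1
    field_simp
    ring
  rw [e]
  refine mul_le_mul_of_nonneg_right ?_ (gaussW_pos _ _ _).le
  have hεi : 0 < ε⁻¹ := by positivity
  have h1 : 2 * L * (1 + ε⁻¹) < |u - τ| := by
    have hu' : |τ| + 2 * L * (1 + ε⁻¹) < |u| := by
      by_contra h
      exact hu (by rw [mem_Icc, ← abs_le]; linarith)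
    have := abs_sub_abs_le_abs_sub u τ
    linarith
  have h2 : 2 * (1 + ε⁻¹) ≤ |(u - τ) / L| := by
    rw [abs_div, abs_of_pos hL, le_div_iff₀ hL]
    linarith
  have h3 : ε⁻¹ ≤ 3 / 4 * ((u - τ) / L) ^ 2 := by
    rw [← sq_abs]
    nlinarith
  refine (exp_neg_le_inv (hεi.trans_le h3)).trans ?_
  calc (3 / 4 * ((u - τ) / L) ^ 2)⁻¹ ≤ (ε⁻¹)⁻¹ := inv_anti₀ hεi h3
    _ = ε := inv_inv ε

lemma intervalIntegrable_logNormQuot_half (x y : ℝ) :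
    IntervalIntegrable (logNormQuot (1 / 2)) volume x y := by
  have : MeromorphicOn (fun u : ℝ ↦ zetaQuot ((1 / 2 : ℝ) + Complex.I * u)) (uIcc x y) := by
    intro u _
    have h0 : ((1 / 2 : ℝ) + Complex.I * u : ℂ) ≠ 0 := by
      intro h
      have := congrArg Complex.re h
      norm_num at this
    have han : AnalyticAt ℝ zetaQuot ((1 / 2 : ℝ) + Complex.I * u) :=
      (differentiableOn_zetaQuot.analyticAt (isOpen_compl_singleton.mem_nhds h0)).restrictScalars
    have hg : AnalyticAt ℝ (fun u : ℝ ↦ ((1 / 2 : ℝ) + Complex.I * u : ℂ)) u := by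
      refine AnalyticAt.add analyticAt_const (AnalyticAt.mul analyticAt_const ?_)
      exact Complex.ofRealCLM.analyticAt u
    exact (AnalyticAt.comp (g := zetaQuot) (f := fun u : ℝ ↦ ((1 / 2 : ℝ) + Complex.I * u : ℂ))
      han hg).meromorphicAt
  exact this.intervalIntegrable_log_norm

lemma IsLogZetaQuot.integrable_half_mul {l : ℂ → ℂ} (hl : IsLogZetaQuot l) {L : ℝ} (hL : 6 ≤ L)
    (τ : ℝ) {G : ℝ → ℝ} (hG : Continuous G) {K : ℝ} (hK : ∀ u, |G u| ≤ K * gaussW L τ u) :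
    Integrable fun u ↦ logNormQuot (1 / 2) u * G u := by
  refine ((hl.integrable_half_and_integral_le hL τ).1.const_mul K).mono'
    ((measurable_logNormQuot le_rfl).mul hG.measurable).aestronglyMeasurable
    (ae_of_all _ fun u ↦ ?_)
  rw [norm_mul, Real.norm_eq_abs, Real.norm_eq_abs]
  calc _ ≤ |logNormQuot (1 / 2) u| * (K * gaussW L τ u) := by
        gcongr; exact hK u
    _ = _ := by ring

/-- Gaussian averages of `log |(s - 1) ζ(s) / s|` are continuous up to the critical line. -/
lemma IsLogZetaQuot.tendsto_integral {l : ℂ → ℂ} (hl : IsLogZetaQuot l)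
    (hRH : RiemannHypothesis) {L : ℝ} (hL : 6 ≤ L)
    (τ : ℝ) {G : ℝ → ℝ} (hG : Continuous G) {K : ℝ} (hK : ∀ u, |G u| ≤ K * gaussW L τ u) :
    Tendsto (fun σ ↦ ∫ u, logNormQuot σ u * G u) (𝓝[>] (1 / 2))
      (𝓝 (∫ u, logNormQuot (1 / 2) u * G u)) := by
  have hL0 : 0 < L := by linarith
  have hK0 : 0 ≤ K := by
    have := (abs_nonneg _).trans (hK 0)
    exact nonneg_of_mul_nonneg_left this (gaussW_pos L τ 0)
  set M := logL1Const * (1 + |τ|) * (2 * L) ^ 2 with hM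
  have hM0 : 0 ≤ M := by
    have := logL1Const_nonneg
    positivity
  rw [Metric.tendsto_nhds]
  intro ε hε
  set η := ε / (2 * (2 * (K * M) + 1)) with hη
  have hη0 : 0 < η := by positivity
  obtain ⟨A, hA, hAG⟩ := gaussW_le_mul_wide hL0 τ hη0
  -- On a compact interval dominated convergence applies, with the majorant built from the local
  -- zeros.
  have hcomp : Tendsto (fun σ ↦ ∫ u in Icc (-A) A, logNormQuot σ u * G u) (𝓝[>] (1 / 2))
      (𝓝 (∫ u in Icc (-A) A, logNormQuot (1 / 2) u * G u)) := by
    obtain ⟨δ, hδ, b, hb, hb0, hbound⟩ := exists_logNormQuot_bound hRH A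
    have hev : ∀ᶠ σ in 𝓝[>] (1 / 2 : ℝ), σ ∈ Ioo (1 / 2) (1 / 2 + δ) :=
      Ioo_mem_nhdsGT (by linarith)
    refine tendsto_integral_filter_of_dominated_convergence (fun u ↦ b u * K) ?_ ?_ ?_ ?_
    · filter_upwards [hev] with σ hσ
      exact ((measurable_logNormQuot hσ.1.le).mul hG.measurable).aestronglyMeasurable
    · filter_upwards [hev] with σ hσ
      rw [ae_restrict_iff' measurableSet_Icc]
      filter_upwards [hbound σ hσ] with u hu hmem
      rw [norm_mul]
      have h1 : |G u| ≤ K := (hK u).trans (mul_le_of_le_one_right hK0 (gaussW_le_one _ _ _))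
      exact mul_le_mul (hu hmem) h1 (abs_nonneg _) (hb0 u)
    · rw [← IntegrableOn, integrableOn_Icc_iff_integrableOn_Ioc]
      have := (hb (-A) A).mul_const K
      rwa [intervalIntegrable_iff_integrableOn_Ioc_of_le (by linarith)] at this
    · refine ae_restrict_of_ae ?_
      filter_upwards [ae_tendsto_logNormQuot] with u hu
      exact hu.mul_const _
  -- Outside it, the `L¹` bound at width `2L` makes the tail small uniformly in `σ`; `η` is chosen
  -- so that the tails at `σ` and at `1/2` total less than `ε / 2`.
  have htail : ∀ f : ℝ → ℝ, Integrable (fun u ↦ |f u| * gaussW (2 * L) τ u) →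
      (∫ u, |f u| * gaussW (2 * L) τ u ≤ M) →
      |∫ u in (Icc (-A) A)ᶜ, f u * G u| ≤ K * M * η := by
    intro f hf hfM
    have hb : ∀ᵐ u ∂(volume.restrict (Icc (-A) A)ᶜ), ‖f u * G u‖ ≤
        (K * η) * (|f u| * gaussW (2 * L) τ u) := by
      rw [ae_restrict_iff' measurableSet_Icc.compl]
      refine ae_of_all _ fun u hu ↦ ?_
      rw [norm_mul, Real.norm_eq_abs, Real.norm_eq_abs]
      calc _ ≤ |f u| * (K * (η * gaussW (2 * L) τ u)) := by
            gcongr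
            exact (hK u).trans (by gcongr; exact hAG u hu)
        _ = _ := by ring
    refine (norm_integral_le_of_norm_le (hf.integrableOn.const_mul _) hb).trans ?_
    rw [integral_const_mul]
    have h2 : ∫ u in (Icc (-A) A)ᶜ, |f u| * gaussW (2 * L) τ u ≤ M :=
      (setIntegral_le_integral hf (ae_of_all _ fun u ↦
        mul_nonneg (abs_nonneg _) (gaussW_pos _ _ _).le)).trans hfM
    calc _ ≤ K * η * M := by gcongr
      _ = _ := by ring
  have hlt : K * M * η + K * M * η < ε / 2 := by
    have h : (2 * (2 * (K * M) + 1)) * η = ε := by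
      rw [hη]; field_simp
    nlinarith
  have hsplit : ∀ f : ℝ → ℝ, Integrable (fun u ↦ f u * G u) → ∫ u, f u * G u =
      (∫ u in Icc (-A) A, f u * G u) + ∫ u in (Icc (-A) A)ᶜ, f u * G u := fun f hf ↦
    (integral_add_compl measurableSet_Icc hf).symm
  have hev2 : ∀ᶠ σ in 𝓝[>] (1 / 2 : ℝ), σ ∈ Ioo (1 / 2) 2 := Ioo_mem_nhdsGT (by norm_num)
  filter_upwards [hev2, (Metric.tendsto_nhds.1 hcomp) (ε / 2) (by positivity)] with σ hσ hd
  rw [Real.dist_eq] at hd ⊢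
  rw [hsplit _ (hl.integrable_logNormQuot_mul hσ.1 hσ.2.le hL0 τ hG hK),
    hsplit _ (hl.integrable_half_mul hL τ hG hK)]
  have t1 := htail (logNormQuot σ) (by
      have := (hl.integrable_logNormQuot_mul hσ.1 hσ.2.le (by linarith : 0 < 2 * L) τ
        (continuous_gaussW (2 * L) τ) (K := 1) fun u ↦ by
          rw [one_mul, abs_of_pos (gaussW_pos _ τ u)]).norm
      refine this.congr (ae_of_all _ fun u ↦ ?_)
      simp [abs_of_pos (gaussW_pos _ τ u)])
    (hl.integral_abs_logNormQuot_le hσ.1 hσ.2.le (by linarith) τ)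
  have h5 := hl.integrable_half_and_integral_le (by linarith : 6 ≤ 2 * L) τ
  have t2 := htail (logNormQuot (1 / 2)) h5.1 h5.2
  rw [abs_lt] at hd ⊢
  rw [abs_le] at t1 t2
  constructor <;> linarith [hd.1, hd.2, t1.1, t1.2, t2.1, t2.2]

/-! ### Resonators and the main term -/

/-- A Dirichlet polynomial with real coefficients. -/
noncomputable def resonator {ι : Type*} (S : Finset ι) (n : ι → ℕ) (r : ι → ℝ) (t : ℝ) : ℂ :=
  ∑ a ∈ S, (r a : ℂ) * Complex.exp (Complex.I * Real.log (n a) * t)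

section Resonator

variable {ι : Type*} {S : Finset ι} {n : ι → ℕ} {r : ι → ℝ}

lemma continuous_resonator : Continuous (resonator S n r) := by
  unfold resonator; fun_prop

lemma norm_resonator_le (t : ℝ) : ‖resonator S n r t‖ ≤ ∑ a ∈ S, |r a| := by
  refine (norm_sum_le _ _).trans (le_of_eq (Finset.sum_congr rfl fun a _ ↦ ?_))
  rw [norm_mul, Complex.norm_real, Real.norm_eq_abs, mul_assoc, ← Complex.ofReal_mul,
    mul_comm Complex.I, Complex.norm_exp_ofReal_mul_I, mul_one]

lemma norm_sq_resonator (t : ℝ) : ((‖resonator S n r t‖ ^ 2 : ℝ) : ℂ) =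
    ∑ a ∈ S, ∑ b ∈ S, ((r a * r b : ℝ) : ℂ) *
      Complex.exp (Complex.I * (Real.log (n a) - Real.log (n b) : ℝ) * t) := by
  have h : ((‖resonator S n r t‖ ^ 2 : ℝ) : ℂ) =
      resonator S n r t * (starRingEnd ℂ) (resonator S n r t) := by
    rw [Complex.mul_conj, Complex.normSq_eq_norm_sq]
  rw [h, resonator, map_sum, Finset.sum_mul_sum]
  refine Finset.sum_congr rfl fun a _ ↦ Finset.sum_congr rfl fun b _ ↦ ?_
  rw [map_mul, Complex.conj_ofReal, ← Complex.exp_conj]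
  simp only [map_mul, Complex.conj_I, Complex.conj_ofReal]
  rw [mul_mul_mul_comm, ← Complex.exp_add]
  push_cast
  congr 2
  ring

/-- The resonator weight. -/
noncomputable def resonatorWeight (S : Finset ι) (n : ι → ℕ) (r : ι → ℝ) (L τ t : ℝ) : ℝ :=
  ‖resonator S n r t‖ ^ 2 * gaussW L τ t

lemma resonatorWeight_nonneg (L τ t : ℝ) : 0 ≤ resonatorWeight S n r L τ t :=
  mul_nonneg (by positivity) (gaussW_pos _ _ _).le

lemma continuous_resonatorWeight (L τ : ℝ) : Continuous (resonatorWeight S n r L τ) :=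
  (continuous_resonator.norm.pow 2).mul (continuous_gaussW L τ)

lemma resonatorWeight_le (L τ t : ℝ) :
    resonatorWeight S n r L τ t ≤ (∑ a ∈ S, |r a|) ^ 2 * gaussW L τ t := by
  have := (gaussW_pos L τ t).le
  unfold resonatorWeight
  gcongr
  exact norm_resonator_le t

lemma gaussW_sub (L τ u v : ℝ) : gaussW L τ (u - v) = gaussW L (τ + v) u := by
  unfold gaussW; congr 3; ring

lemma abs_resonatorWeight_sub_le (L τ v u : ℝ) :
    |resonatorWeight S n r L τ (u - v)| ≤ (∑ a ∈ S, |r a|) ^ 2 * gaussW L (τ + v) u := by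
  rw [abs_of_nonneg (resonatorWeight_nonneg _ _ _), ← gaussW_sub]
  exact resonatorWeight_le _ _ _

/-- The main term of the resonance method on the line `Re s = σ`. -/
noncomputable def resonanceMain (S : Finset ι) (n : ι → ℕ) (r : ι → ℝ) (σ v : ℝ) : ℝ :=
  ∑ a ∈ S, ∑ b ∈ S, r a * r b * (Real.cos ((Real.log (n a) - Real.log (n b)) * v) *
    diagTerm σ (n a) (n b))

/-- Expanding `|R|²` gives the frequencies `log (n a) - log (n b)`, each handled by the twisted
average. Shifting by `v` recentres the Gaussian and multiplies each pair by a phase, whose real part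
is the cosine. -/
lemma IsLogZetaQuot.abs_integral_sub_resonanceMain_le_of_lt {l : ℂ → ℂ} (hl : IsLogZetaQuot l)
    {σ : ℝ} (hσ : 1 / 2 < σ) (hσ2 : σ ≤ 2) {L : ℝ} (hL : 1 ≤ L) (τ v : ℝ) {N : ℕ}
    (hn : ∀ a ∈ S, 0 < n a ∧ n a ≤ N) (hLN : 32 * (N : ℝ) ≤ L ^ 2) :
    |(∫ u, logNormQuot σ u * resonatorWeight S n r L τ (u - v)) -
      L * √Real.pi * resonanceMain S n r σ v| ≤ (∑ a ∈ S, |r a|) ^ 2 *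
        (twistConst * (N : ℝ) ^ 2 * ((N : ℝ) ^ 2 / L + L ^ 2 / (1 + |τ + v|))) := by
  have hL0 : 0 < L := by linarith
  set E := twistConst * (N : ℝ) ^ 2 * ((N : ℝ) ^ 2 / L + L ^ 2 / (1 + |τ + v|)) with hE
  set μ : ι → ι → ℝ := fun a b ↦ Real.log (n a) - Real.log (n b) with hμ
  set J : ι → ι → ℂ := fun a b ↦ ∫ u : ℝ, l (σ + Complex.I * u) *
    (Complex.exp (Complex.I * (μ a b : ℝ) * u) * gaussC L (τ + v) u) with hJ
  have hint : ∀ a b, Integrable fun u : ℝ ↦ l (σ + Complex.I * u) *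
      (Complex.exp (Complex.I * (μ a b : ℝ) * u) * gaussC L (τ + v) u) := by
    intro a b
    refine hl.integrable_mul hσ hσ2 hL0 (τ + v) (K := 1) (by
      have := (differentiable_gaussC L (τ + v)).continuous
      fun_prop) fun u ↦ ?_
    rw [norm_mul, mul_assoc, ← Complex.ofReal_mul, mul_comm Complex.I,
      Complex.norm_exp_ofReal_mul_I, gaussC_ofReal, Complex.norm_real,
      Real.norm_of_nonneg (gaussW_pos _ _ _).le]
  have hsum : ((∫ u : ℝ, l (σ + Complex.I * u) * (resonatorWeight S n r L τ (u - v) : ℂ))) =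
      ∑ a ∈ S, ∑ b ∈ S, ((r a * r b : ℝ) : ℂ) * Complex.exp (-(Complex.I * μ a b * v)) * J a b := by
    have : ∀ u : ℝ, l (σ + Complex.I * u) * (resonatorWeight S n r L τ (u - v) : ℂ) =
        ∑ a ∈ S, ∑ b ∈ S, ((r a * r b : ℝ) : ℂ) * Complex.exp (-(Complex.I * μ a b * v)) *
          (l (σ + Complex.I * u) *
            (Complex.exp (Complex.I * (μ a b : ℝ) * u) * gaussC L (τ + v) u)) := by
      intro u
      rw [resonatorWeight, Complex.ofReal_mul, norm_sq_resonator, gaussW_sub, gaussC_ofReal,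
        Finset.sum_mul, Finset.mul_sum]
      refine Finset.sum_congr rfl fun a _ ↦ ?_
      rw [Finset.sum_mul, Finset.mul_sum]
      refine Finset.sum_congr rfl fun b _ ↦ ?_
      have : Complex.exp (Complex.I * (μ a b : ℝ) * ((u - v : ℝ) : ℂ)) =
          Complex.exp (-(Complex.I * μ a b * v)) * Complex.exp (Complex.I * (μ a b : ℝ) * u) := by
        rw [← Complex.exp_add]; push_cast; congr 1; ring
      rw [this]
      ring
    simp_rw [this]
    rw [integral_finsetSum _ fun a _ ↦ integrable_finsetSum _ fun b _ ↦ (hint a b).const_mul _]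
    refine Finset.sum_congr rfl fun a _ ↦ ?_
    rw [integral_finsetSum _ fun b _ ↦ (hint a b).const_mul _]
    exact Finset.sum_congr rfl fun b _ ↦ integral_const_mul _ _
  have hre : (∫ u, logNormQuot σ u * resonatorWeight S n r L τ (u - v)) =
      (∫ u : ℝ, l (σ + Complex.I * u) * (resonatorWeight S n r L τ (u - v) : ℂ)).re := by
    have hc : Continuous fun u ↦ resonatorWeight S n r L τ (u - v) :=
      (continuous_resonatorWeight L τ).comp (by fun_prop)
    have := integral_re (hl.integrable_mul hσ hσ2 hL0 (τ + v)
      (G := fun u ↦ (resonatorWeight S n r L τ (u - v) : ℂ)) (by fun_prop)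
      (K := (∑ a ∈ S, |r a|) ^ 2) fun u ↦ by
        simpa using abs_resonatorWeight_sub_le L τ v u)
    simp only [RCLike.re_to_complex] at this
    rw [← this]
    congr 1; ext u
    simp [hl.re_line hσ]
  have hmain : L * √Real.pi * resonanceMain S n r σ v =
      (∑ a ∈ S, ∑ b ∈ S, ((r a * r b : ℝ) : ℂ) * Complex.exp (-(Complex.I * μ a b * v)) *
        ((L * √Real.pi * diagTerm σ (n a) (n b) : ℝ) : ℂ)).re := by
    rw [resonanceMain, Finset.mul_sum, Complex.re_sum]
    refine Finset.sum_congr rfl fun a _ ↦ ?_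
    rw [Finset.mul_sum, Complex.re_sum]
    refine Finset.sum_congr rfl fun b _ ↦ ?_
    rw [Complex.re_mul_ofReal, Complex.re_ofReal_mul]
    have : Complex.exp (-(Complex.I * μ a b * v)) =
        Complex.exp (((-(μ a b * v) : ℝ) : ℂ) * Complex.I) := by
      congr 1; push_cast; ring
    rw [this, Complex.exp_ofReal_mul_I_re, Real.cos_neg]
    ring
  rw [hre, hsum, hmain, ← Complex.sub_re]
  refine (Complex.abs_re_le_norm _).trans ?_
  rw [← Finset.sum_sub_distrib, sq, Finset.sum_mul_sum, Finset.sum_mul]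
  refine (norm_sum_le _ _).trans (Finset.sum_le_sum fun a ha ↦ ?_)
  rw [← Finset.sum_sub_distrib, Finset.sum_mul]
  refine (norm_sum_le _ _).trans (Finset.sum_le_sum fun b hb ↦ ?_)
  rw [← mul_sub, norm_mul, norm_mul, Complex.norm_real, Real.norm_eq_abs, abs_mul]
  have e1 : ‖Complex.exp (-(Complex.I * μ a b * v))‖ = 1 := by
    have : -(Complex.I * μ a b * v) = ((-(μ a b * v) : ℝ) : ℂ) * Complex.I := by
      push_cast; ring
    rw [this, Complex.norm_exp_ofReal_mul_I]
  rw [e1, mul_one]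
  refine mul_le_mul_of_nonneg_left ?_ (by positivity)
  exact hl.norm_integral_sub_diagTerm_le hσ hσ2 hL (τ + v) (hn a ha).1 (hn b hb).1 (hn a ha).2 hLN

lemma tendsto_resonanceMain (hn : ∀ a ∈ S, 0 < n a) (v : ℝ) :
    Tendsto (fun σ ↦ resonanceMain S n r σ v) (𝓝[>] (1 / 2))
      (𝓝 (resonanceMain S n r (1 / 2) v)) := by
  refine Tendsto.mono_left ?_ nhdsWithin_le_nhds
  unfold resonanceMain
  refine tendsto_finsetSum _ fun a ha ↦ tendsto_finsetSum _ fun b hb ↦ ?_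
  refine Tendsto.const_mul _ (Tendsto.const_mul _ ?_)
  unfold diagTerm
  split_ifs with h
  · refine Tendsto.const_mul _ ?_
    have hpos : ((n a / n b : ℕ) : ℝ) ≠ 0 := by
      have := Nat.div_pos (Nat.le_of_dvd (hn a ha) h) (hn b hb)
      exact_mod_cast this.ne'
    have : Continuous fun σ : ℝ ↦ ((n a / n b : ℕ) : ℝ) ^ (-σ) :=
      Continuous.rpow continuous_const (by fun_prop) fun _ ↦ Or.inl hpos
    exact this.tendsto _
  · exact tendsto_const_nhds

/-- Both sides are continuous as `σ → 1/2` and the error bound does not depend on `σ`. -/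
lemma IsLogZetaQuot.abs_integral_sub_resonanceMain_le {l : ℂ → ℂ} (hl : IsLogZetaQuot l)
    (hRH : RiemannHypothesis) {L : ℝ} (hL : 6 ≤ L) (τ v : ℝ) {N : ℕ}
    (hn : ∀ a ∈ S, 0 < n a ∧ n a ≤ N) (hLN : 32 * (N : ℝ) ≤ L ^ 2) :
    |(∫ u, logNormQuot (1 / 2) u * resonatorWeight S n r L τ (u - v)) -
      L * √Real.pi * resonanceMain S n r (1 / 2) v| ≤ (∑ a ∈ S, |r a|) ^ 2 *
        (twistConst * (N : ℝ) ^ 2 * ((N : ℝ) ^ 2 / L + L ^ 2 / (1 + |τ + v|))) := by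
  have hc : Continuous fun u ↦ resonatorWeight S n r L τ (u - v) :=
    (continuous_resonatorWeight L τ).comp (by fun_prop)
  have h1 := hl.tendsto_integral hRH hL (τ + v) hc fun u ↦ abs_resonatorWeight_sub_le L τ v u
  have h2 := (tendsto_resonanceMain (r := r) (fun a ha ↦ (hn a ha).1) v).const_mul (L * √Real.pi)
  refine le_of_tendsto (h1.sub h2).abs ?_
  have hev : ∀ᶠ σ in 𝓝[>] (1 / 2 : ℝ), σ ∈ Ioo (1 / 2) 2 := Ioo_mem_nhdsGT (by norm_num)
  filter_upwards [hev] with σ hσ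
  exact hl.abs_integral_sub_resonanceMain_le_of_lt hσ.1 hσ.2.le (by linarith) τ v hn hLN

end Resonator

/-! ### Reciprocal sums over primes from Chebyshev bounds -/

/-- The primes in `(x, y]`. -/
noncomputable def primesIoc (x y : ℝ) : Finset ℕ := {p ∈ Finset.Ioc ⌊x⌋₊ ⌊y⌋₊ | p.Prime}

lemma mem_primesIoc {x y : ℝ} (hx : 0 ≤ x) (hy : 0 ≤ y) {p : ℕ} :
    p ∈ primesIoc x y ↔ x < p ∧ (p : ℝ) ≤ y ∧ p.Prime := by
  rw [primesIoc, Finset.mem_filter, Finset.mem_Ioc, Nat.floor_lt hx, Nat.le_floor_iff hy, and_assoc]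

lemma sum_primesIoc_add {x y z : ℝ} (hxy : x ≤ y) (hyz : y ≤ z) (f : ℕ → ℝ) :
    ∑ p ∈ primesIoc x z, f p = ∑ p ∈ primesIoc x y, f p + ∑ p ∈ primesIoc y z, f p := by
  unfold primesIoc
  rw [← Finset.Ioc_union_Ioc_eq_Ioc (Nat.floor_mono hxy) (Nat.floor_mono hyz), Finset.filter_union,
    Finset.sum_union]
  refine Finset.disjoint_filter_filter ?_
  exact Finset.Ioc_disjoint_Ioc_of_le le_rfl

lemma theta_sub_theta {x y : ℝ} (hxy : x ≤ y) :
    Chebyshev.theta y - Chebyshev.theta x = ∑ p ∈ primesIoc x y, Real.log p := by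
  have h := Nat.floor_mono hxy
  rw [Chebyshev.theta, Chebyshev.theta, primesIoc,
    ← Finset.Ioc_union_Ioc_eq_Ioc (Nat.zero_le _) h, Finset.filter_union, Finset.sum_union]
  · ring
  · exact Finset.disjoint_filter_filter (Finset.Ioc_disjoint_Ioc_of_le le_rfl)

/-- Chebyshev gives `θ(4x) ≥ 4x log 2 - o(x)` and `θ(x) ≤ 2x log 2`. The difference is about `1.38
x`; the ratio `4` leaves room that a ratio `2` would not. -/
lemma eventually_le_theta_sub_theta :
    ∀ᶠ x : ℝ in atTop, x ≤ Chebyshev.theta (4 * x) - Chebyshev.theta x := by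
  have h1 : Tendsto (fun x : ℝ ↦ 4 * x) atTop atTop := tendsto_id.const_mul_atTop (by norm_num)
  have h2 : (fun x : ℝ ↦ √(4 * x) * Real.log (4 * x)) =o[atTop] fun x ↦ x := by
    have h3 : (fun x : ℝ ↦ √x * Real.log x) =o[atTop] fun x ↦ x := by
      have := (isBigO_refl (fun x : ℝ ↦ x ^ (1 / 2 : ℝ)) atTop).mul_isLittleO
        (isLittleO_log_rpow_atTop (show (0 : ℝ) < 1 / 2 by norm_num))
      refine (this.congr' ?_ ?_)
      · exact Eventually.of_forall fun x ↦ by simp [Real.sqrt_eq_rpow]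
      · filter_upwards [eventually_gt_atTop 0] with x hx
        rw [← Real.rpow_add hx]; norm_num
    refine (h3.comp_tendsto h1).trans_isBigO ?_
    exact IsBigO.of_bound 4 (Eventually.of_forall fun x ↦ by simp)
  filter_upwards [h2.bound (show (0 : ℝ) < 1 / 20 by norm_num), eventually_ge_atTop (100 : ℝ)]
    with x hx hx1
  have h4 := Chebyshev.theta_ge' (x := 4 * x) (by linarith)
  have h5 := Chebyshev.theta_le_log4_mul_x (x := x) (by linarith)
  have hlog : 0 ≤ Real.log (4 * x) := Real.log_nonneg (by linarith)
  rw [Real.norm_of_nonneg (by positivity), Real.norm_of_nonneg (by linarith)] at hx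
  have h6 : Real.log (4 * x + 2) ≤ √(4 * x) * Real.log (4 * x) := by
    have e1 : Real.log (4 * x + 2) ≤ 2 * Real.log (4 * x) := by
      rw [← Real.log_rpow (by linarith)]
      apply Real.log_le_log (by linarith)
      norm_cast
      nlinarith
    have e2 : 2 ≤ √(4 * x) := by
      rw [Real.le_sqrt' (by norm_num)]; linarith
    exact e1.trans (by gcongr)
  have h7 : Real.log 4 = 2 * Real.log 2 := by
    rw [show (4 : ℝ) = 2 ^ 2 by norm_num, Real.log_pow]; norm_num
  have h8 := Real.log_two_gt_d9
  have h9 := Real.log_two_lt_d9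
  rw [h7] at h5
  nlinarith

lemma quarter_le_sum_primesIoc {x : ℝ} (hx : 0 < x)
    (h : x ≤ Chebyshev.theta (4 * x) - Chebyshev.theta x) :
    1 / 4 ≤ ∑ p ∈ primesIoc x (4 * x), Real.log p / p := by
  rw [theta_sub_theta (by linarith)] at h
  have h1 : (∑ p ∈ primesIoc x (4 * x), Real.log p) / (4 * x) ≤
      ∑ p ∈ primesIoc x (4 * x), Real.log p / p := by
    rw [Finset.sum_div]
    refine Finset.sum_le_sum fun p hp ↦ ?_
    obtain ⟨h2, h3, h4⟩ := (mem_primesIoc hx.le (by linarith)).1 hp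
    have := Real.log_natCast_nonneg p
    have : (0 : ℝ) < p := by linarith
    gcongr
  refine le_trans ?_ h1
  rw [le_div_iff₀ (by linarith)]
  linarith

lemma eventually_sum_primesIoc_pow : ∀ᶠ x : ℝ in atTop, ∀ J : ℕ,
    (J : ℝ) / 4 ≤ ∑ p ∈ primesIoc x (4 ^ J * x), Real.log p / p := by
  obtain ⟨x₀, hx₀⟩ := eventually_atTop.1 eventually_le_theta_sub_theta
  filter_upwards [eventually_ge_atTop x₀, eventually_gt_atTop 0] with x hx hx0 J
  induction J with
  | zero => simp [primesIoc]
  | succ J ih =>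
    have h1 : (1 : ℝ) ≤ 4 ^ J := one_le_pow₀ (by norm_num)
    have h2 : x ≤ 4 ^ J * x := le_mul_of_one_le_left hx0.le h1
    have h3 := quarter_le_sum_primesIoc (x := 4 ^ J * x) (by positivity) (hx₀ _ (hx.trans h2))
    have h4 : 4 * (4 ^ J * x) = 4 ^ (J + 1) * x := by ring
    rw [h4] at h3
    rw [sum_primesIoc_add h2 (by rw [← h4]; linarith)]
    push_cast
    linarith

/-- A weak form of Mertens' theorem. About `log x / (2 log 4)` blocks of ratio `4` fit into `(x,
x^(3/2)]`, each contributing at least `1/4` to the sum of `log p / p`, and `log p ≤ (3/2) log x`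
throughout. -/
lemma eventually_sum_inv_primesIoc : ∀ᶠ x : ℝ in atTop,
    1 / 30 ≤ ∑ p ∈ primesIoc x (x ^ (3 / 2 : ℝ)), (p : ℝ)⁻¹ := by
  filter_upwards [eventually_sum_primesIoc_pow, eventually_gt_atTop 1,
    Real.tendsto_log_atTop.eventually_ge_atTop 10] with x hx hx1 hlog
  have hx0 : 0 < x := by linarith
  set lx := Real.log x with hlx
  set J := ⌊lx / (2 * Real.log 4)⌋₊ with hJ
  have h8 := Real.log_two_gt_d9
  have h9 := Real.log_two_lt_d9
  have h7 : Real.log 4 = 2 * Real.log 2 := by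
    rw [show (4 : ℝ) = 2 ^ 2 by norm_num, Real.log_pow]; norm_num
  have hl4 : 0 < Real.log 4 := by linarith
  have hJ1 : lx / (2 * Real.log 4) - 1 ≤ J := (Nat.sub_one_lt_floor _).le
  have hJ2 : (J : ℝ) ≤ lx / (2 * Real.log 4) := Nat.floor_le (by positivity)
  have hy0 : 0 < x ^ (3 / 2 : ℝ) := by positivity
  have hpow : 4 ^ J * x ≤ x ^ (3 / 2 : ℝ) := by
    rw [← Real.log_le_log_iff (by positivity) hy0, Real.log_mul (by positivity) hx0.ne',
      Real.log_pow, Real.log_rpow hx0]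
    rw [le_div_iff₀ (by positivity)] at hJ2
    linarith
  have h1 := hx J
  have h2 : x ≤ 4 ^ J * x := le_mul_of_one_le_left hx0.le (one_le_pow₀ (by norm_num))
  have h3 : ∑ p ∈ primesIoc x (4 ^ J * x), Real.log p / p ≤
      (3 / 2 * lx) * ∑ p ∈ primesIoc x (x ^ (3 / 2 : ℝ)), (p : ℝ)⁻¹ := by
    rw [sum_primesIoc_add h2 hpow, mul_add, Finset.mul_sum, Finset.mul_sum,
      ← add_zero (∑ p ∈ _, _ / _)]
    refine add_le_add (Finset.sum_le_sum fun p hp ↦ ?_) (Finset.sum_nonneg fun p _ ↦ by positivity)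
    obtain ⟨h4, h5, h6⟩ := (mem_primesIoc hx0.le (by positivity)).1 hp
    rw [div_eq_mul_inv]
    refine mul_le_mul_of_nonneg_right ?_ (by positivity)
    rw [← Real.log_rpow hx0]
    exact Real.log_le_log (by linarith) (h5.trans hpow)
  have h4 : lx / 2.8 ≤ lx / (2 * Real.log 4) := by
    apply div_le_div_of_nonneg_left (by linarith) (by linarith)
    linarith
  have h5 : lx / 20 ≤ (3 / 2 * lx) * ∑ p ∈ primesIoc x (x ^ (3 / 2 : ℝ)), (p : ℝ)⁻¹ := by
    refine le_trans ?_ (h1.trans h3)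
    norm_num at h4
    linarith
  have h6 : lx * (1 / 30) ≤ lx * ∑ p ∈ primesIoc x (x ^ (3 / 2 : ℝ)), (p : ℝ)⁻¹ := by linarith
  exact le_of_mul_le_mul_left h6 (by linarith)

/-! ### Combinatorics of the squarefree resonator -/

/-- The signed multiplicative resonator coefficient attached to a finite set of primes. -/
noncomputable def resCoeff (ε : ℝ) (ρ : ℕ → ℝ) (A : Finset ℕ) : ℝ := ε ^ A.card * ∏ p ∈ A, ρ p

/-- The integer attached to a finite set of primes. -/
def resInt (A : Finset ℕ) : ℕ := ∏ p ∈ A, p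

/-- The subsets of `P` with at most `k` elements. -/
def smallSubsets (P : Finset ℕ) (k : ℕ) : Finset (Finset ℕ) := {A ∈ P.powerset | A.card ≤ k}

lemma mem_smallSubsets {P : Finset ℕ} {k : ℕ} {A : Finset ℕ} :
    A ∈ smallSubsets P k ↔ A ⊆ P ∧ A.card ≤ k := by
  simp [smallSubsets]

section Combinatorics

variable {P : Finset ℕ} {ε : ℝ} {ρ : ℕ → ℝ}

lemma resCoeff_sq (hε : ε ^ 2 = 1) (A : Finset ℕ) :
    resCoeff ε ρ A ^ 2 = ∏ p ∈ A, ρ p ^ 2 := by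
  rw [resCoeff, mul_pow, ← pow_mul, mul_comm A.card, pow_mul, hε, one_pow, one_mul,
    Finset.prod_pow]

/-- One more prime brings exactly one more factor `ε`, so each product of coefficients of `insert p
B` and `B` has the sign `ε`. -/
lemma resCoeff_insert {p : ℕ} {B : Finset ℕ} (hp : p ∉ B) :
    resCoeff ε ρ (insert p B) = ε * ρ p * resCoeff ε ρ B := by
  rw [resCoeff, resCoeff, Finset.card_insert_of_notMem hp, Finset.prod_insert hp]
  ring

lemma resInt_insert {p : ℕ} {B : Finset ℕ} (hp : p ∉ B) :
    resInt (insert p B) = p * resInt B := by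
  rw [resInt, resInt, Finset.prod_insert hp]

lemma resInt_pos {A : Finset ℕ} (hA : ∀ p ∈ A, p.Prime) : 0 < resInt A :=
  Finset.prod_pos fun p hp ↦ (hA p hp).pos

lemma primeFactors_resInt {A : Finset ℕ} (hA : ∀ p ∈ A, p.Prime) : (resInt A).primeFactors = A :=
  Nat.primeFactors_prod hA

/-- Double counting of pairs: a set `A` with a marked element `p` corresponds to `B = A \ {p}` with
a new element `p`. -/
lemma sum_prod_powersetCard_succ (w : ℕ → ℝ) (P : Finset ℕ) (j : ℕ) :
    (j + 1 : ℝ) * ∑ A ∈ P.powersetCard (j + 1), ∏ p ∈ A, w p =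
      ∑ B ∈ P.powersetCard j, ∑ p ∈ P \ B, w p * ∏ q ∈ B, w q := by
  have h1 : (j + 1 : ℝ) * ∑ A ∈ P.powersetCard (j + 1), ∏ p ∈ A, w p =
      ∑ A ∈ P.powersetCard (j + 1), ∑ _p ∈ A, ∏ q ∈ A, w q := by
    rw [Finset.mul_sum]
    refine Finset.sum_congr rfl fun A hA ↦ ?_
    rw [Finset.sum_const, (Finset.mem_powersetCard.1 hA).2, nsmul_eq_mul]
    push_cast; ring
  rw [h1, Finset.sum_sigma', Finset.sum_sigma']
  refine Finset.sum_bij' (fun x _ ↦ ⟨x.1.erase x.2, x.2⟩) (fun x _ ↦ ⟨insert x.2 x.1, x.2⟩)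
    ?_ ?_ ?_ ?_ ?_
  · rintro ⟨A, p⟩ h
    simp only [Finset.mem_sigma, Finset.mem_powersetCard, Finset.mem_sdiff] at h ⊢
    obtain ⟨⟨hA, hc⟩, hp⟩ := h
    refine ⟨⟨(Finset.erase_subset _ _).trans hA, ?_⟩, hA hp, Finset.notMem_erase _ _⟩
    rw [Finset.card_erase_of_mem hp, hc]; rfl
  · rintro ⟨B, p⟩ h
    simp only [Finset.mem_sigma, Finset.mem_powersetCard, Finset.mem_sdiff] at h ⊢
    obtain ⟨⟨hB, hc⟩, hp, hpB⟩ := h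
    refine ⟨⟨Finset.insert_subset hp hB, ?_⟩, Finset.mem_insert_self _ _⟩
    rw [Finset.card_insert_of_notMem hpB, hc]
  · rintro ⟨A, p⟩ h
    simp only [Finset.mem_sigma] at h
    simp [Finset.insert_erase h.2]
  · rintro ⟨B, p⟩ h
    simp only [Finset.mem_sigma, Finset.mem_sdiff] at h
    simp [Finset.erase_insert h.2.2]
  · rintro ⟨A, p⟩ h
    simp only [Finset.mem_sigma] at h
    exact (Finset.mul_prod_erase A w h.2).symm

/-- For elementary symmetric functions, `(j + 1) e_{j+1} ≤ e_1 e_j`; once `e_1 ≤ j + 1` the layers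
stop growing. -/
lemma sum_powersetCard_succ_le {w : ℕ → ℝ} (hw : ∀ p ∈ P, 0 ≤ w p) {j : ℕ}
    (hP : ∑ p ∈ P, w p ≤ j + 1) :
    ∑ A ∈ P.powersetCard (j + 1), ∏ p ∈ A, w p ≤ ∑ A ∈ P.powersetCard j, ∏ p ∈ A, w p := by
  have h := sum_prod_powersetCard_succ w P j
  have h2 : ∑ B ∈ P.powersetCard j, ∑ p ∈ P \ B, w p * ∏ q ∈ B, w q ≤
      (j + 1 : ℝ) * ∑ A ∈ P.powersetCard j, ∏ p ∈ A, w p := by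
    rw [Finset.mul_sum]
    refine Finset.sum_le_sum fun B hB ↦ ?_
    have hBP := (Finset.mem_powersetCard.1 hB).1
    rw [← Finset.sum_mul]
    refine mul_le_mul_of_nonneg_right ?_ (Finset.prod_nonneg fun q hq ↦ hw q (hBP hq))
    refine le_trans ?_ hP
    exact Finset.sum_le_sum_of_subset_of_nonneg Finset.sdiff_subset fun p hp _ ↦ hw p hp
  rw [← h] at h2
  exact le_of_mul_le_mul_left h2 (by positivity)

lemma smallSubsets_succ (P : Finset ℕ) (k : ℕ) :
    smallSubsets P (k + 1) = smallSubsets P k ∪ P.powersetCard (k + 1) := by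
  ext A
  simp only [mem_smallSubsets, Finset.mem_union, Finset.mem_powersetCard]
  grind

/-- Discarding the top layer loses at most half of the mass. This matters because `insert p B` must
stay in the resonator, which restricts `B` to one element fewer. -/
lemma sum_smallSubsets_succ_le {w : ℕ → ℝ} (hw : ∀ p ∈ P, 0 ≤ w p) {k : ℕ}
    (hP : ∑ p ∈ P, w p ≤ k + 1) :
    ∑ A ∈ smallSubsets P (k + 1), ∏ p ∈ A, w p ≤
      2 * ∑ A ∈ smallSubsets P k, ∏ p ∈ A, w p := by
  rw [smallSubsets_succ, Finset.sum_union, two_mul]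
  · refine add_le_add le_rfl ((sum_powersetCard_succ_le hw hP).trans ?_)
    refine Finset.sum_le_sum_of_subset_of_nonneg (fun A hA ↦ ?_) fun A hA _ ↦
      Finset.prod_nonneg fun p hp ↦ hw p ((mem_smallSubsets.1 hA).1 hp)
    have := Finset.mem_powersetCard.1 hA
    exact mem_smallSubsets.2 ⟨this.1, this.2.le⟩
  · rw [Finset.disjoint_left]
    intro A h1 h2
    have := (mem_smallSubsets.1 h1).2
    have := (Finset.mem_powersetCard.1 h2).2
    omega

lemma logZetaCoeff_prime {p : ℕ} (hp : p.Prime) : logZetaCoeff p = 1 := by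
  rw [logZetaCoeff, ArithmeticFunction.vonMangoldt_apply_prime hp]
  exact div_self hp.log_ne_zero

lemma diagTerm_insert {p : ℕ} {B : Finset ℕ} (hB : ∀ q ∈ B, q.Prime) (hp : p.Prime) (hpB : p ∉ B)
    (σ : ℝ) : diagTerm σ (resInt (insert p B)) (resInt B) = (p : ℝ) ^ (-σ) := by
  rw [resInt_insert hpB, diagTerm, if_pos (Dvd.intro_left p rfl),
    Nat.mul_div_cancel _ (resInt_pos hB), logZetaCoeff_prime hp, one_mul]

/-- The quotient must be a prime power for `Λ` not to vanish, and squarefreeness forces it to be a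
single prime. -/
lemma exists_insert_of_diagTerm_ne_zero {A B : Finset ℕ} (hA : ∀ q ∈ A, q.Prime)
    (hB : ∀ q ∈ B, q.Prime) {σ : ℝ} (h : diagTerm σ (resInt A) (resInt B) ≠ 0) :
    ∃ p ∈ A, p ∉ B ∧ A = insert p B := by
  rw [diagTerm] at h
  split_ifs at h with hd
  swap
  · exact absurd rfl h
  have hBA : B ⊆ A := by
    have := Nat.primeFactors_mono hd (resInt_pos hA).ne'
    rwa [primeFactors_resInt hA, primeFactors_resInt hB] at this
  have hprod : resInt A = resInt (A \ B) * resInt B := by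
    rw [resInt, resInt, resInt, Finset.prod_sdiff hBA]
  rw [hprod, Nat.mul_div_cancel _ (resInt_pos hB)] at h
  have hpp : IsPrimePow (resInt (A \ B)) := by
    by_contra hn
    apply h
    rw [logZetaCoeff, ArithmeticFunction.vonMangoldt_eq_zero_iff.2 hn]
    simp
  have hAB : ∀ q ∈ A \ B, q.Prime := fun q hq ↦ hA q (Finset.mem_sdiff.1 hq).1
  have hcard := isPrimePow_iff_card_primeFactors_eq_one.1 hpp
  rw [primeFactors_resInt hAB] at hcard
  obtain ⟨p, hp⟩ := Finset.card_eq_one.1 hcard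
  have hpm : p ∈ A \ B := by rw [hp]; exact Finset.mem_singleton_self p
  refine ⟨p, (Finset.mem_sdiff.1 hpm).1, (Finset.mem_sdiff.1 hpm).2, ?_⟩
  rw [← Finset.sdiff_union_of_subset hBA, hp, Finset.insert_eq]

/-- Lower bound for the resonance main term. -/
lemma le_resonanceMain (hP : ∀ p ∈ P, p.Prime) (hε : ε ^ 2 = 1) (hρ : ∀ p ∈ P, 0 ≤ ρ p)
    {c v : ℝ} (hc : 0 ≤ c) (hv : ∀ p ∈ P, c ≤ Real.cos (Real.log p * v)) (k : ℕ) :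
    c * ∑ B ∈ smallSubsets P k, resCoeff ε ρ B ^ 2 * ∑ p ∈ P \ B, ρ p * (p : ℝ) ^ (-(1 / 2) : ℝ) ≤
      ε * resonanceMain (smallSubsets P (k + 1)) resInt (resCoeff ε ρ) (1 / 2) v := by
  have hprime : ∀ {A k}, A ∈ smallSubsets P k → ∀ q ∈ A, q.Prime := fun hA q hq ↦
    hP q ((mem_smallSubsets.1 hA).1 hq)
  set f : Finset ℕ → Finset ℕ → ℝ := fun A B ↦ ε * (resCoeff ε ρ A * resCoeff ε ρ B *
    (Real.cos ((Real.log (resInt A) - Real.log (resInt B)) * v) *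
      diagTerm (1 / 2) (resInt A) (resInt B))) with hf
  have hfins : ∀ B ⊆ P, ∀ p ∈ P, p ∉ B → f (insert p B) B =
      resCoeff ε ρ B ^ 2 * (ρ p * (p : ℝ) ^ (-(1 / 2) : ℝ)) * Real.cos (Real.log p * v) := by
    intro B hB p hp hpB
    have hBp : ∀ q ∈ B, q.Prime := fun q hq ↦ hP q (hB hq)
    have h0 : (p : ℝ) ≠ 0 := by exact_mod_cast (hP p hp).ne_zero
    have h1 : (resInt B : ℝ) ≠ 0 := by exact_mod_cast (resInt_pos hBp).ne'
    rw [hf]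
    simp only
    rw [diagTerm_insert hBp (hP p hp) hpB, resCoeff_insert hpB, resInt_insert hpB]
    push_cast
    rw [Real.log_mul h0 h1, add_sub_cancel_right]
    linear_combination (ρ p * resCoeff ε ρ B ^ 2 * Real.cos (Real.log p * v) *
      (p : ℝ) ^ (-(1 / 2) : ℝ)) * hε
  -- After multiplication by `ε` every term is nonnegative, so for a lower bound any collection of
  -- pairs may be dropped.
  have hfnn : ∀ A ∈ smallSubsets P (k + 1), ∀ B ∈ smallSubsets P (k + 1), 0 ≤ f A B := by
    intro A hA B hB
    by_cases hd : diagTerm (1 / 2) (resInt A) (resInt B) = 0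
    · simp only [hf, hd, mul_zero, le_refl]
    · obtain ⟨p, hpA, hpB, rfl⟩ := exists_insert_of_diagTerm_ne_zero (hprime hA) (hprime hB) hd
      have hpP := (mem_smallSubsets.1 hA).1 hpA
      rw [hfins B (mem_smallSubsets.1 hB).1 p hpP hpB]
      have h1 := hρ p hpP
      have h2 := hc.trans (hv p hpP)
      positivity
  have hsum : ε * resonanceMain (smallSubsets P (k + 1)) resInt (resCoeff ε ρ) (1 / 2) v =
      ∑ B ∈ smallSubsets P (k + 1), ∑ A ∈ smallSubsets P (k + 1), f A B := by
    rw [resonanceMain, Finset.sum_comm, Finset.mul_sum]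
    refine Finset.sum_congr rfl fun B _ ↦ ?_
    rw [Finset.mul_sum]
  have hsub : smallSubsets P k ⊆ smallSubsets P (k + 1) := by
    rw [smallSubsets_succ]; exact Finset.subset_union_left
  rw [hsum, Finset.mul_sum]
  refine le_trans (Finset.sum_le_sum fun B hB ↦ ?_) (Finset.sum_le_sum_of_subset_of_nonneg hsub
    fun B hB _ ↦ Finset.sum_nonneg fun A hA ↦ hfnn A hA B hB)
  obtain ⟨hBP, hBk⟩ := mem_smallSubsets.1 hB
  have himg : (P \ B).image (fun p ↦ insert p B) ⊆ smallSubsets P (k + 1) := by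
    intro A hA
    obtain ⟨p, hp, rfl⟩ := Finset.mem_image.1 hA
    rw [Finset.mem_sdiff] at hp
    refine mem_smallSubsets.2 ⟨Finset.insert_subset hp.1 hBP, ?_⟩
    rw [Finset.card_insert_of_notMem hp.2]
    omega
  refine le_trans ?_ (Finset.sum_le_sum_of_subset_of_nonneg himg
    fun A hA _ ↦ hfnn A hA B (hsub hB))
  rw [Finset.sum_image]
  · rw [Finset.mul_sum, Finset.mul_sum]
    refine Finset.sum_le_sum fun p hp ↦ ?_
    rw [Finset.mem_sdiff] at hp
    rw [hfins B hBP p hp.1 hp.2, mul_comm c]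
    refine mul_le_mul_of_nonneg_left (hv p hp.1) ?_
    have := hρ p hp.1
    positivity
  · intro p hp q hq hpq
    have hp' := (Finset.mem_sdiff.1 hp).2
    have : p ∈ insert q B := by
      rw [← show insert p B = insert q B from hpq]; exact Finset.mem_insert_self _ _
    rcases Finset.mem_insert.1 this with h | h
    · exact h
    · exact absurd h hp'

end Combinatorics

/-! ### Mass of the resonator weight -/

section Resonator

variable {ι : Type*} {S : Finset ι} {n : ι → ℕ} {r : ι → ℝ}

/-- Equal integers give the diagonal `∑ r²`. Distinct ones have frequencies at least `1/(2N)`, where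
the Gaussian transform is at most `16 N² / L²`. -/
lemma integral_resonatorWeight_le {L : ℝ} (hL : 0 < L) (τ : ℝ) {N : ℕ}
    (hn : ∀ a ∈ S, 0 < n a ∧ n a ≤ N) (hinj : InjOn n S) :
    ∫ t, resonatorWeight S n r L τ t ≤
      L * √Real.pi * (∑ a ∈ S, r a ^ 2 + (∑ a ∈ S, |r a|) ^ 2 * (16 * N ^ 2 / L ^ 2)) := by
  classical
  set μ : ι → ι → ℝ := fun a b ↦ Real.log (n a) - Real.log (n b) with hμ
  have hint : ∀ a b, Integrable fun t : ℝ ↦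
      Complex.exp (Complex.I * (μ a b : ℝ) * t) * gaussC L τ t := by
    intro a b
    refine (integrable_gaussW hL τ).mono' (by
      have := (differentiable_gaussC L τ).continuous
      exact Continuous.aestronglyMeasurable (by fun_prop)) (ae_of_all _ fun t ↦ ?_)
    rw [norm_mul, mul_assoc, ← Complex.ofReal_mul, mul_comm Complex.I,
      Complex.norm_exp_ofReal_mul_I, gaussC_ofReal, Complex.norm_real,
      Real.norm_of_nonneg (gaussW_pos _ _ _).le, one_mul]
  have hsum : ((∫ t, resonatorWeight S n r L τ t : ℝ) : ℂ) =
      ∑ a ∈ S, ∑ b ∈ S, ((r a * r b : ℝ) : ℂ) *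
        ∫ t : ℝ, Complex.exp (Complex.I * (μ a b : ℝ) * t) * gaussC L τ t := by
    rw [← integral_complex_ofReal]
    have : ∀ t : ℝ, (resonatorWeight S n r L τ t : ℂ) = ∑ a ∈ S, ∑ b ∈ S,
        ((r a * r b : ℝ) : ℂ) * (Complex.exp (Complex.I * (μ a b : ℝ) * t) * gaussC L τ t) := by
      intro t
      rw [resonatorWeight, Complex.ofReal_mul, norm_sq_resonator, gaussC_ofReal, Finset.sum_mul]
      refine Finset.sum_congr rfl fun a _ ↦ ?_
      rw [Finset.sum_mul]
      exact Finset.sum_congr rfl fun b _ ↦ mul_assoc _ _ _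
    simp_rw [this]
    rw [integral_finsetSum _ fun a _ ↦ integrable_finsetSum _ fun b _ ↦ (hint a b).const_mul _]
    refine Finset.sum_congr rfl fun a _ ↦ ?_
    rw [integral_finsetSum _ fun b _ ↦ (hint a b).const_mul _]
    exact Finset.sum_congr rfl fun b _ ↦ integral_const_mul _ _
  have hZ : 0 ≤ L * √Real.pi := by positivity
  have hterm : ∀ a ∈ S, ∀ b ∈ S,
      ‖∫ t : ℝ, Complex.exp (Complex.I * (μ a b : ℝ) * t) * gaussC L τ t‖ ≤
        L * √Real.pi * ((if a = b then 1 else 0) + 16 * N ^ 2 / L ^ 2) := by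
    intro a ha b hb
    have h := integral_cexp_mul_gaussC hL τ 0 (μ a b)
    simp only [Complex.ofReal_zero, mul_zero, sub_zero, add_zero] at h
    rw [h, norm_mul, Complex.norm_real, Real.norm_of_nonneg hZ, Complex.norm_exp]
    refine mul_le_mul_of_nonneg_left ?_ hZ
    have e : (-((L ^ 2 * μ a b ^ 2 / 4 : ℝ) : ℂ) + Complex.I * μ a b * τ).re =
        -(L ^ 2 * μ a b ^ 2 / 4) := by
      rw [Complex.add_re, ← Complex.ofReal_neg, Complex.ofReal_re]
      simp
    rw [e]
    have hnn : 0 ≤ 16 * (N : ℝ) ^ 2 / L ^ 2 := by positivity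
    split_ifs with hab
    · have : Real.exp (-(L ^ 2 * μ a b ^ 2 / 4)) ≤ 1 := by
        rw [Real.exp_le_one_iff]
        have : 0 ≤ L ^ 2 * μ a b ^ 2 / 4 := by positivity
        linarith
      linarith
    · have hN0 : 0 < N := (hn a ha).1.trans_le (hn a ha).2
      have hN : (0 : ℝ) < N := by exact_mod_cast hN0
      have h1 : 1 / (2 * N : ℝ) ≤ |μ a b| := inv_le_abs_log_sub_log (hn a ha).1 (hn b hb).1
        (fun h ↦ hab (hinj ha hb h)) (hn a ha).2
      have h2 : (1 / (2 * N : ℝ)) ^ 2 ≤ μ a b ^ 2 := by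
        rw [← sq_abs (μ a b)]; gcongr
      have h3 : 0 < μ a b ^ 2 := lt_of_lt_of_le (by positivity) h2
      rw [zero_add]
      refine (exp_neg_le_inv (by positivity)).trans ?_
      calc (L ^ 2 * μ a b ^ 2 / 4)⁻¹ ≤ (L ^ 2 * (1 / (2 * N : ℝ)) ^ 2 / 4)⁻¹ := by gcongr
        _ = 16 * N ^ 2 / L ^ 2 := by field_simp; norm_num
  have hnorm : ∫ t, resonatorWeight S n r L τ t ≤
      ‖((∫ t, resonatorWeight S n r L τ t : ℝ) : ℂ)‖ := by
    rw [Complex.norm_real]; exact Real.le_norm_self _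
  refine hnorm.trans ?_
  rw [hsum]
  calc _ ≤ ∑ a ∈ S, ∑ b ∈ S, |r a| * |r b| *
        (L * √Real.pi * ((if a = b then 1 else 0) + 16 * N ^ 2 / L ^ 2)) := by
        refine (norm_sum_le _ _).trans (Finset.sum_le_sum fun a ha ↦ ?_)
        refine (norm_sum_le _ _).trans (Finset.sum_le_sum fun b hb ↦ ?_)
        rw [norm_mul, Complex.norm_real, Real.norm_eq_abs, abs_mul]
        exact mul_le_mul_of_nonneg_left (hterm a ha b hb) (by positivity)
    _ = _ := by
        rw [sq (∑ a ∈ S, |r a|), Finset.sum_mul_sum, Finset.sum_mul, mul_add, Finset.mul_sum, Finset.mul_sum,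
          ← Finset.sum_add_distrib]
        refine Finset.sum_congr rfl fun a ha ↦ ?_
        have : ∀ b, |r a| * |r b| * (L * √Real.pi * ((if a = b then 1 else 0) + 16 * N ^ 2 / L ^ 2)) =
            (if a = b then L * √Real.pi * (|r a| * |r b|) else 0) +
              L * √Real.pi * (|r a| * |r b| * (16 * N ^ 2 / L ^ 2)) := by
          intro b; split_ifs <;> ring
        simp_rw [this]
        rw [Finset.sum_add_distrib, Finset.sum_ite_eq, if_pos ha, abs_mul_abs_self, ← sq,
          Finset.sum_mul, Finset.mul_sum]

lemma integrable_resonatorWeight {L : ℝ} (hL : 0 < L) (τ : ℝ) :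
    Integrable (resonatorWeight S n r L τ) :=
  ((integrable_gaussW hL τ).const_mul ((∑ a ∈ S, |r a|) ^ 2)).mono'
    (continuous_resonatorWeight L τ).aestronglyMeasurable (ae_of_all _ fun t ↦ by
      rw [Real.norm_of_nonneg (resonatorWeight_nonneg _ _ _)]
      exact resonatorWeight_le _ _ _)

end Resonator

/-! ### Averaging over shifts -/

/-- Exchanging a short average with a weighted average over a long interval. -/
lemma two_mul_le_mul_integral_of_averages {w G : ℝ → ℝ} (hw : ∀ x y, IntervalIntegrable w volume x y)
    (hG : Continuous G) (hG0 : ∀ t, 0 ≤ G t) {K : ℝ} (hK : ∀ t, G t ≤ K) {a b h B Y : ℝ}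
    (hab : a ≤ b) (hh : 0 ≤ h)
    (hB : ∀ v ∈ Icc (-h) h, B ≤ ∫ t in a..b, w (t - v) * G t)
    (hY : ∀ t ∈ Icc a b, ∫ u in (t - h)..(t + h), w u ≤ Y) :
    2 * h * B ≤ Y * ∫ t in a..b, G t := by
  have hmh : -h ≤ h := by linarith
  -- Only values of `w` on a bounded interval occur. Truncating there makes `w` integrable on the
  -- line, so joint integrability follows from that of a convolution integrand.
  set w0 : ℝ → ℝ := (Ioc (a - h - 1) (b + h)).indicator w with hw0
  have hw0i : Integrable w0 := by
    rw [hw0, integrable_indicator_iff measurableSet_Ioc]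
    exact (intervalIntegrable_iff_integrableOn_Ioc_of_le (by linarith)).1 (hw _ _)
  have hone : Integrable ((Ioc (-h) h).indicator fun _ ↦ (1 : ℝ)) := by
    rw [integrable_indicator_iff measurableSet_Ioc]
    exact integrableOn_const (by simp)
  have hconv := hone.convolution_integrand (ContinuousLinearMap.mul ℝ ℝ) hw0i
  have hprod : Integrable (Function.uncurry fun t v ↦ w (t - v) * G t)
      ((volume.restrict (Ioc a b)).prod (volume.restrict (Ioc (-h) h))) := by
    rw [Measure.prod_restrict]
    have h1 : IntegrableOn (fun p : ℝ × ℝ ↦ G p.1 * (((ContinuousLinearMap.mul ℝ ℝ)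
        ((Ioc (-h) h).indicator (fun _ ↦ (1 : ℝ)) p.2)) (w0 (p.1 - p.2))))
        (Ioc a b ×ˢ Ioc (-h) h) (volume.prod volume) := by
      refine Integrable.integrableOn ?_
      refine hconv.bdd_mul (c := K) (hG.comp continuous_fst).aestronglyMeasurable
        (ae_of_all _ fun p ↦ ?_)
      rw [Real.norm_of_nonneg (hG0 _)]
      exact hK _
    refine h1.congr_fun (fun p hp ↦ ?_) (measurableSet_Ioc.prod measurableSet_Ioc)
    obtain ⟨hp1, hp2⟩ := hp
    have hmem : p.1 - p.2 ∈ Ioc (a - h - 1) (b + h) :=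
      ⟨by linarith [hp1.1, hp2.2], by linarith [hp1.2, hp2.1]⟩
    simp only [hw0, indicator_of_mem hp2, indicator_of_mem hmem, ContinuousLinearMap.mul_apply',
      one_mul, Function.uncurry]
    ring
  have hswap := integral_integral_swap hprod
  have hL : 2 * h * B ≤ ∫ v in Ioc (-h) h, ∫ t in Ioc a b, w (t - v) * G t := by
    have h1 : ∫ _v in Ioc (-h) h, B = 2 * h * B := by
      rw [setIntegral_const, Measure.real, Real.volume_Ioc, ENNReal.toReal_ofReal (by linarith),
        smul_eq_mul]
      ring
    rw [← h1]
    refine setIntegral_mono_on (integrableOn_const (by simp)) hprod.integral_prod_right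
      measurableSet_Ioc fun v hv ↦ ?_
    have := hB v ⟨hv.1.le, hv.2⟩
    rwa [intervalIntegral.integral_of_le hab] at this
  refine hL.trans ?_
  rw [← hswap, intervalIntegral.integral_of_le hab, ← integral_const_mul]
  refine setIntegral_mono_on hprod.integral_prod_left
    ((hG.integrableOn_Icc.mono_set Ioc_subset_Icc_self).const_mul Y) measurableSet_Ioc fun t ht ↦ ?_
  rw [integral_mul_const]
  refine mul_le_mul_of_nonneg_right ?_ (hG0 t)
  -- After Fubini the inner integral over the shifts `v` is the short integral of `w` around `t`.
  rw [← intervalIntegral.integral_of_le hmh, intervalIntegral.integral_comp_sub_left]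
  rw [sub_neg_eq_add]
  exact hY t ⟨ht.1.le, ht.2⟩

/-! ### Choice of the resonator -/

lemma eventually_exists_resonator : ∃ c > 0, ∀ᶠ T : ℝ in atTop, ∀ ε : ℝ, ε ^ 2 = 1 →
    ∃ (S : Finset (Finset ℕ)) (r : Finset ℕ → ℝ),
      (∀ A ∈ S, 0 < resInt A ∧ resInt A ≤ ⌊T ^ (1 / 8 : ℝ)⌋₊) ∧ InjOn resInt S ∧
      (∑ A ∈ S, |r A|) ^ 2 ≤ T ^ (1 / 8 : ℝ) * ∑ A ∈ S, r A ^ 2 ∧ 0 < ∑ A ∈ S, r A ^ 2 ∧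
      ∀ v : ℝ, |v| ≤ (Real.log (Real.log T))⁻¹ →
        c * √(Real.log T / Real.log (Real.log T)) * ∑ A ∈ S, r A ^ 2 ≤
          ε * resonanceMain S resInt r (1 / 2) v := by
  have hcos : 0 < Real.cos (3 / 2) :=
    Real.cos_pos_of_mem_Ioo ⟨by linarith [Real.pi_pos], by linarith [Real.pi_gt_d2]⟩
  -- Here `108 = 2 · 54`: the factor `2` pays for the discarded top layer, and `54` is the loss in
  -- the sum over primes below.
  refine ⟨Real.cos (3 / 2) / 108, by positivity, ?_⟩
  have hxbig : ∀ᶠ x : ℝ in atTop, 12 * Real.log x ≤ x := by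
    have := Real.isLittleO_log_id_atTop.bound (show (0 : ℝ) < 1 / 12 by norm_num)
    filter_upwards [this, eventually_ge_atTop 1] with x hx hx1
    rw [Real.norm_of_nonneg (Real.log_nonneg hx1), id, Real.norm_of_nonneg (by linarith)] at hx
    linarith
  have hX : ∀ᶠ x : ℝ in atTop, 1 < x ∧ 5 ≤ Real.log x ∧ 12 * Real.log x ≤ x ∧
      1 / 30 ≤ ∑ p ∈ primesIoc x (x ^ (3 / 2 : ℝ)), (p : ℝ)⁻¹ := by
    filter_upwards [eventually_gt_atTop 1, Real.tendsto_log_atTop.eventually_ge_atTop 5, hxbig,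
      eventually_sum_inv_primesIoc] with x h1 h2 h3 h4
    exact ⟨h1, h2, h3, h4⟩
  filter_upwards [Real.tendsto_log_atTop.eventually hX, eventually_gt_atTop 1]
    with T ⟨hx1, hlx, h12, hsum⟩ hT ε hε
  set x := Real.log T with hx
  set lx := Real.log x with hlx'
  have hx0 : 0 < x := by linarith
  have hlx0 : 0 < lx := by linarith
  have hy0 : 0 < x ^ (3 / 2 : ℝ) := by positivity
  set P := primesIoc x (x ^ (3 / 2 : ℝ)) with hPdef
  set s := ∑ p ∈ P, (p : ℝ)⁻¹ with hs
  have hs0 : 0 < s := by linarith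
  have hmemP : ∀ p ∈ P, x < p ∧ (p : ℝ) ≤ x ^ (3 / 2 : ℝ) ∧ p.Prime := fun p hp ↦
    (mem_primesIoc hx0.le hy0.le).1 hp
  have hPprime : ∀ p ∈ P, p.Prime := fun p hp ↦ (hmemP p hp).2.2
  have hlogp : ∀ p ∈ P, Real.log p ≤ 3 / 2 * lx := fun p hp ↦ by
    rw [← Real.log_rpow hx0]
    exact Real.log_le_log (by linarith [(hmemP p hp).1]) (hmemP p hp).2.1
  have hone : 1 ≤ x / (12 * lx) := by rw [le_div_iff₀ (by positivity)]; linarith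
  -- With at most `x / (12 lx)` primes, each at most `exp((3/2) lx)`, every product is at most
  -- `exp(x / 8) = T^(1/8)`.
  obtain ⟨k, hk⟩ : ∃ k, ⌊x / (12 * lx)⌋₊ = k + 1 :=
    Nat.exists_eq_succ_of_ne_zero (Nat.floor_pos.2 hone).ne'
  have hk1 : (k + 1 : ℝ) ≤ x / (12 * lx) := by
    have := Nat.floor_le (show 0 ≤ x / (12 * lx) by positivity)
    rw [hk] at this
    exact_mod_cast this
  have hk2 : x / (24 * lx) ≤ k + 1 := by
    have := Nat.lt_floor_add_one (x / (12 * lx))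
    rw [hk] at this
    push_cast at this
    have e : x / (24 * lx) = x / (12 * lx) / 2 := by field_simp; norm_num
    have : (0 : ℝ) ≤ k := k.cast_nonneg
    linarith
  -- The shape `p^(-1/2)` is the Cauchy–Schwarz optimum for `∑ ρ(p) p^(-1/2)`. The scaling makes `∑
  -- ρ² = k + 1`, exactly the hypothesis for discarding the top layer.
  set ρ : ℕ → ℝ := fun p ↦ √((k + 1) / s) * (p : ℝ) ^ (-(1 / 2) : ℝ) with hρ
  have hρ0 : ∀ p ∈ P, 0 ≤ ρ p := fun p _ ↦ by positivity
  have hhalf : ∀ p : ℕ, (p : ℝ) ^ (-(1 / 2) : ℝ) * (p : ℝ) ^ (-(1 / 2) : ℝ) = (p : ℝ)⁻¹ := by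
    intro p
    rcases Nat.eq_zero_or_pos p with rfl | hp
    · norm_num
    · rw [← Real.rpow_add (by exact_mod_cast hp)]
      norm_num
      exact Real.rpow_neg_one _
  have hρsq : ∑ p ∈ P, ρ p ^ 2 = k + 1 := by
    have : ∀ p : ℕ, ρ p ^ 2 = (k + 1) / s * (p : ℝ)⁻¹ := by
      intro p
      rw [hρ]
      simp only
      rw [mul_pow, Real.sq_sqrt (by positivity), sq ((p : ℝ) ^ _), hhalf]
    simp_rw [this]
    rw [← Finset.mul_sum, ← hs]
    field_simp
  set S := smallSubsets P (k + 1) with hS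
  have hSprime : ∀ A ∈ S, ∀ q ∈ A, q.Prime := fun A hA q hq ↦
    hPprime q ((mem_smallSubsets.1 hA).1 hq)
  have hSinj : InjOn resInt (S : Set (Finset ℕ)) := by
    intro A hA B hB h
    rw [← primeFactors_resInt (hSprime A hA), ← primeFactors_resInt (hSprime B hB), h]
  have hSN : ∀ A ∈ S, 0 < resInt A ∧ resInt A ≤ ⌊T ^ (1 / 8 : ℝ)⌋₊ := by
    intro A hA
    refine ⟨resInt_pos (hSprime A hA), Nat.le_floor ?_⟩
    obtain ⟨hAP, hAk⟩ := mem_smallSubsets.1 hA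
    have h1 : (resInt A : ℝ) ≤ Real.exp (3 / 2 * lx) ^ A.card := by
      rw [resInt, Nat.cast_prod]
      refine (Finset.prod_le_prod (fun p _ ↦ by positivity) fun p hp ↦ ?_).trans_eq
        (Finset.prod_const _)
      rw [← Real.log_le_iff_le_exp (by linarith [(hmemP p (hAP hp)).1])]
      exact hlogp p (hAP hp)
    refine h1.trans ?_
    rw [← Real.exp_nat_mul, Real.rpow_def_of_pos (by linarith), ← hx]
    apply Real.exp_le_exp.2
    have h2 : (A.card : ℝ) ≤ x / (12 * lx) := le_trans (by exact_mod_cast hAk) hk1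
    rw [le_div_iff₀ (by positivity)] at h2
    linarith
  refine ⟨S, resCoeff ε ρ, hSN, hSinj, ?_, ?_, fun v hv ↦ ?_⟩
  · have hcard : S.card ≤ ⌊T ^ (1 / 8 : ℝ)⌋₊ := by
      have := Finset.card_le_card_of_injOn (t := Finset.Icc 1 ⌊T ^ (1 / 8 : ℝ)⌋₊) resInt
        (fun A hA ↦ by
          have := hSN A hA
          simp only [Finset.coe_Icc, Set.mem_Icc]
          exact ⟨this.1, this.2⟩) hSinj
      simpa using this
    -- Cauchy–Schwarz; the number of sets is at most the length of the polynomial because `resInt`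
    -- is injective on `S`.
    have h1 := sq_sum_le_card_mul_sum_sq (s := S) (f := fun A ↦ |resCoeff ε ρ A|)
    simp only [sq_abs] at h1
    refine h1.trans (mul_le_mul_of_nonneg_right ?_ (Finset.sum_nonneg fun A _ ↦ sq_nonneg _))
    exact (Nat.cast_le.2 hcard).trans (Nat.floor_le (by positivity))
  · have hmem : (∅ : Finset ℕ) ∈ S := mem_smallSubsets.2 ⟨Finset.empty_subset _, by simp⟩
    refine lt_of_lt_of_le ?_ (Finset.single_le_sum (fun A _ ↦ sq_nonneg _) hmem)
    simp [resCoeff]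
  · have hv' : ∀ p ∈ P, Real.cos (3 / 2) ≤ Real.cos (Real.log p * v) := by
      intro p hp
      rw [← Real.cos_abs (Real.log p * v)]
      refine Real.cos_le_cos_of_nonneg_of_le_pi (abs_nonneg _) (by linarith [Real.pi_gt_three]) ?_
      rw [abs_mul, abs_of_nonneg (Real.log_natCast_nonneg p)]
      calc Real.log p * |v| ≤ 3 / 2 * lx * lx⁻¹ := by
            have := hlogp p hp
            gcongr
        _ = 3 / 2 := by field_simp
    have hmain := le_resonanceMain hPprime hε hρ0 hcos.le hv' k
    refine le_trans ?_ hmain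
    have hB : ∀ B ∈ smallSubsets P k, √(x / lx) / 54 ≤
        ∑ p ∈ P \ B, ρ p * (p : ℝ) ^ (-(1 / 2) : ℝ) := by
      intro B hB
      obtain ⟨hBP, hBk⟩ := mem_smallSubsets.1 hB
      have e1 : ∀ p : ℕ, ρ p * (p : ℝ) ^ (-(1 / 2) : ℝ) = √((k + 1) / s) * (p : ℝ)⁻¹ := by
        intro p; rw [hρ]; simp only; rw [mul_assoc, hhalf]
      simp_rw [e1]
      rw [← Finset.mul_sum]
      have e2 : ∑ p ∈ P \ B, (p : ℝ)⁻¹ + ∑ p ∈ B, (p : ℝ)⁻¹ = s := Finset.sum_sdiff hBP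
      -- The set `B` has fewer than `x / (12 lx)` primes, all exceeding `x`, so with `lx ≥ 5` its
      -- removal costs at most `1/60 ≤ s/2`.
      have e3 : ∑ p ∈ B, (p : ℝ)⁻¹ ≤ 1 / 60 := by
        have : ∑ p ∈ B, (p : ℝ)⁻¹ ≤ B.card • x⁻¹ :=
          Finset.sum_le_card_nsmul _ _ _ fun p hp ↦
            inv_anti₀ hx0 (hmemP p (hBP hp)).1.le
        refine this.trans ?_
        rw [nsmul_eq_mul]
        have h2 : (B.card : ℝ) ≤ x / (12 * lx) := by
          have : (B.card : ℝ) ≤ k := by exact_mod_cast hBk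
          linarith
        calc (B.card : ℝ) * x⁻¹ ≤ x / (12 * lx) * x⁻¹ := by gcongr
          _ = 1 / (12 * lx) := by field_simp
          _ ≤ 1 / 60 := by
            apply one_div_le_one_div_of_le (by norm_num); linarith
      have e4 : s / 2 ≤ ∑ p ∈ P \ B, (p : ℝ)⁻¹ := by linarith
      -- From `k + 1 ≥ x / (24 lx)` and `s ≥ 1/30` one gets `(k + 1) s ≥ (x / lx) / 720`, and `720 ≤
      -- 27²`.
      have e5 : √(x / lx) / 27 ≤ √((k + 1) / s) * s := by
        rw [div_le_iff₀ (by norm_num)]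
        apply Real.sqrt_le_iff.2
        refine ⟨by positivity, ?_⟩
        rw [mul_pow, mul_pow, Real.sq_sqrt (by positivity)]
        have e6 : ((k : ℝ) + 1) / s * s ^ 2 = (k + 1) * s := by field_simp
        rw [e6]
        have e7 : x / lx = 24 * (x / (24 * lx)) := by field_simp
        rw [e7]
        have e8 : (k + 1 : ℝ) * (1 / 30) ≤ (k + 1) * s := by gcongr
        linarith
      calc √(x / lx) / 54 = √(x / lx) / 27 / 2 := by ring
        _ ≤ √((k + 1) / s) * s / 2 := by linarith
        _ = √((k + 1) / s) * (s / 2) := by ring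
        _ ≤ _ := by gcongr
    have hE := sum_smallSubsets_succ_le (P := P) (w := fun p ↦ ρ p ^ 2) (fun p _ ↦ sq_nonneg _)
      (k := k) hρsq.le
    simp_rw [← resCoeff_sq (ρ := ρ) hε] at hE
    calc _ ≤ Real.cos (3 / 2) / 108 * √(x / lx) *
          (2 * ∑ B ∈ smallSubsets P k, resCoeff ε ρ B ^ 2) := by gcongr
      _ = Real.cos (3 / 2) * ∑ B ∈ smallSubsets P k, resCoeff ε ρ B ^ 2 * (√(x / lx) / 54) := by
          rw [← Finset.sum_mul]; ring
      _ ≤ _ := by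
          gcongr with B hB'
          exact hB B hB'

/-! ### Truncation to `[T, 2T]` and conclusion -/

lemma exp_neg_le_six_div_cube {z : ℝ} (hz : 0 < z) : Real.exp (-z) ≤ 6 / z ^ 3 := by
  have h := Real.pow_div_factorial_le_exp z hz.le 3
  rw [Real.exp_neg, inv_le_comm₀ (Real.exp_pos z) (by positivity)]
  simpa [Nat.factorial] using h

/-- Outside the interval the distance to `3T/2` is at least `T/2`, and `(3/4) (T/2)² / L² = 3T/16`
when `L² = T`. -/
lemma gaussW_le_of_notMem {T L t : ℝ} (hL : 0 < L) (hLT : L ^ 2 = T)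
    (ht : t ∉ Ioc T (2 * T)) :
    gaussW L (3 / 2 * T) t ≤ Real.exp (-(3 / 16 * T)) * gaussW (2 * L) (3 / 2 * T) t := by
  have hL' : L ≠ 0 := hL.ne'
  have hT : 0 < T := by rw [← hLT]; positivity
  rw [gaussW, gaussW, ← Real.exp_add]
  apply Real.exp_le_exp.2
  have h1 : (T / 2) ^ 2 ≤ (t - 3 / 2 * T) ^ 2 := by
    rw [mem_Ioc, not_and_or, not_lt, not_le] at ht
    rcases ht with ht | ht
    · nlinarith
    · nlinarith
  have h2 : 3 / 16 * T ≤ 3 / 4 * ((t - 3 / 2 * T) / L) ^ 2 := by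
    rw [div_pow, hLT, mul_div_assoc', le_div_iff₀ hT]
    nlinarith
  have h3 : ((t - 3 / 2 * T) / (2 * L)) ^ 2 = ((t - 3 / 2 * T) / L) ^ 2 / 4 := by
    field_simp; ring
  rw [h3]
  linarith

section Resonator

variable {ι : Type*} {S : Finset ι} {n : ι → ℕ} {r : ι → ℝ}

/-- Truncating the resonance integral to `[T, 2T]`. -/
lemma IsLogZetaQuot.abs_setIntegral_sub_le {l : ℂ → ℂ} (hl : IsLogZetaQuot l)
    (hRH : RiemannHypothesis) {T L : ℝ} (hL : 6 ≤ L) (hLT : L ^ 2 = T) (v : ℝ) {N : ℕ}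
    (hn : ∀ a ∈ S, 0 < n a ∧ n a ≤ N) (hLN : 32 * (N : ℝ) ≤ L ^ 2) :
    |(∫ t in T..(2 * T), logNormQuot (1 / 2) (t - v) * resonatorWeight S n r L (3 / 2 * T) t) -
      L * √Real.pi * resonanceMain S n r (1 / 2) (-v)| ≤ (∑ a ∈ S, |r a|) ^ 2 *
        (twistConst * (N : ℝ) ^ 2 * ((N : ℝ) ^ 2 / L + L ^ 2 / (1 + |3 / 2 * T - v|)) +
          Real.exp (-(3 / 16 * T)) * (logL1Const * (1 + |3 / 2 * T - v|) * (2 * L) ^ 2)) := by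
  have hL0 : 0 < L := by linarith
  have hT : 0 < T := by rw [← hLT]; positivity
  set τ := 3 / 2 * T with hτ
  set G := resonatorWeight S n r L τ with hG
  set R := (∑ a ∈ S, |r a|) ^ 2 with hR
  have hR0 : 0 ≤ R := by positivity
  have h1 := hl.abs_integral_sub_resonanceMain_le (r := r) hRH hL τ (-v) hn hLN
  rw [sub_eq_add_neg] at h1
  simp only [← sub_eq_add_neg, sub_neg_eq_add] at h1
  have hc : Continuous fun u ↦ G (u + v) := (continuous_resonatorWeight L τ).comp (by fun_prop)
  have hi0 : Integrable fun u ↦ logNormQuot (1 / 2) u * G (u + v) :=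
    hl.integrable_half_mul hL (τ - v) hc fun u ↦ by
      have := abs_resonatorWeight_sub_le (S := S) (n := n) (r := r) L τ (-v) u
      rwa [sub_neg_eq_add, ← sub_eq_add_neg] at this
  have hi : Integrable fun t ↦ logNormQuot (1 / 2) (t - v) * G t := by
    simpa using hi0.comp_sub_right v
  have htrans : ∫ u, logNormQuot (1 / 2) u * G (u + v) =
      ∫ t, logNormQuot (1 / 2) (t - v) * G t := by
    rw [← integral_sub_right_eq_self (fun u ↦ logNormQuot (1 / 2) u * G (u + v)) v]
    simp
  have hsplit := integral_add_compl (measurableSet_Ioc (a := T) (b := 2 * T)) hi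
  have hL1 := hl.integrable_half_and_integral_le (by linarith : 6 ≤ 2 * L) (τ - v)
  have hW : ∀ t, gaussW (2 * L) (τ - v) (t - v) = gaussW (2 * L) τ t := by
    intro t; rw [gaussW_sub]; congr 1; ring
  have hwi : Integrable fun t ↦ |logNormQuot (1 / 2) (t - v)| * gaussW (2 * L) τ t := by
    have := hL1.1.comp_sub_right v
    simpa only [hW] using this
  have hwint : ∫ t, |logNormQuot (1 / 2) (t - v)| * gaussW (2 * L) τ t ≤
      logL1Const * (1 + |τ - v|) * (2 * L) ^ 2 := by
    refine le_of_eq_of_le ?_ hL1.2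
    rw [← integral_sub_right_eq_self
      (fun u ↦ |logNormQuot (1 / 2) u| * gaussW (2 * L) (τ - v) u) v]
    simp only [hW]
  -- The exponential gain is paired with the `L¹` bound for the Gaussian of width `2L`, which grows
  -- only polynomially in `T`.
  have htail : |∫ t in (Ioc T (2 * T))ᶜ, logNormQuot (1 / 2) (t - v) * G t| ≤
      R * (Real.exp (-(3 / 16 * T)) * (logL1Const * (1 + |τ - v|) * (2 * L) ^ 2)) := by
    have hb : ∀ᵐ t ∂(volume.restrict (Ioc T (2 * T))ᶜ), ‖logNormQuot (1 / 2) (t - v) * G t‖ ≤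
        (R * Real.exp (-(3 / 16 * T))) *
          (|logNormQuot (1 / 2) (t - v)| * gaussW (2 * L) τ t) := by
      rw [ae_restrict_iff' measurableSet_Ioc.compl]
      refine ae_of_all _ fun t ht ↦ ?_
      rw [norm_mul, Real.norm_eq_abs, Real.norm_of_nonneg (resonatorWeight_nonneg _ _ _)]
      calc _ ≤ |logNormQuot (1 / 2) (t - v)| *
            (R * (Real.exp (-(3 / 16 * T)) * gaussW (2 * L) τ t)) := by
            gcongr
            refine (resonatorWeight_le _ _ _).trans ?_
            gcongr
            exact gaussW_le_of_notMem hL0 hLT ht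
        _ = _ := by ring
    refine (norm_integral_le_of_norm_le (hwi.integrableOn.const_mul _) hb).trans ?_
    rw [integral_const_mul, mul_assoc]
    have h2 := (setIntegral_le_integral (s := (Ioc T (2 * T))ᶜ) hwi (ae_of_all _ fun u ↦
        mul_nonneg (abs_nonneg _) (gaussW_pos _ _ _).le)).trans hwint
    gcongr
  rw [intervalIntegral.integral_of_le (by linarith), mul_add]
  rw [htrans, ← hsplit] at h1
  rw [abs_le] at h1 htail ⊢
  constructor <;> linarith [h1.1, h1.2, htail.1, htail.2]

end Resonator

/-- Replaces the normalisation at `t` by the one at `T`, so that a single bound serves the whole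
interval. -/
lemma sqrt_log_div_log_log_le {T t : ℝ} (hT : 16 ≤ T) (ht : t ∈ Icc T (2 * T)) :
    √(Real.log t / Real.log (Real.log t)) ≤ 2 * √(Real.log T / Real.log (Real.log T)) := by
  have h1 : 1 < Real.log T := by
    rw [Real.lt_log_iff_exp_lt (by linarith)]
    linarith [Real.exp_one_lt_d9]
  have h2 : Real.log T ≤ Real.log t := Real.log_le_log (by linarith) ht.1
  have h3 : Real.log t ≤ 2 * Real.log T := by
    rw [← Real.log_rpow (by linarith)]
    apply Real.log_le_log (by linarith [ht.1])
    refine ht.2.trans ?_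
    norm_cast
    nlinarith
  have h4 : 0 < Real.log (Real.log T) := Real.log_pos h1
  have h5 : Real.log (Real.log T) ≤ Real.log (Real.log t) := Real.log_le_log (by linarith) h2
  have h6 : Real.log t / Real.log (Real.log t) ≤
      2 ^ 2 * (Real.log T / Real.log (Real.log T)) := by
    rw [mul_div_assoc']
    apply div_le_div₀ (by linarith) (by linarith) h4 h5
  refine (Real.sqrt_le_sqrt h6).trans ?_
  rw [Real.sqrt_mul (by positivity), Real.sqrt_sq (by norm_num)]

/-- Both signs of the `Ω`-result, uniformly in the length of the interval. -/
lemma eventually_exists_integral_log_zeta (hRH : RiemannHypothesis) :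
    ∃ c > 0, ∀ᶠ T : ℝ in atTop, ∀ ε : ℝ, ε ^ 2 = 1 →
      ∀ h ∈ Icc (0 : ℝ) (Real.log (Real.log T))⁻¹, ∃ t ∈ Icc T (2 * T),
        c * (h * √(Real.log t / Real.log (Real.log t))) ≤
          ε * ∫ u in (t - h)..(t + h), Real.log ‖riemannZeta (1 / 2 + Complex.I * u)‖ := by
  obtain ⟨l, hl1, hl2, hl3⟩ := exists_log_zetaQuot hRH
  have hl : IsLogZetaQuot l := ⟨hl1, hl2, hl3⟩
  obtain ⟨c₁, hc₁, hres⟩ := eventually_exists_resonator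
  refine ⟨c₁ / 8, by positivity, ?_⟩
  -- With `y = T^(1/8)` and `D = ∑ r²`, both errors together are at most `K₀ y² · (y D)`, whereas
  -- the main term is at least of order `c₁ y⁴ D`. Taking `y ≥ 2 K₀ / c₁` makes the error at most
  -- half of it.
  set K₀ := 2 * twistConst + 11000 * logL1Const with hK₀
  have htw := twistConst_nonneg
  have hL1 := logL1Const_nonneg
  have hy : ∀ᶠ T : ℝ in atTop, max 2 (2 * K₀ / c₁) ≤ T ^ (1 / 8 : ℝ) :=
    (tendsto_rpow_atTop (by norm_num)).eventually_ge_atTop _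
  have hll : ∀ᶠ T : ℝ in atTop, 1 ≤ Real.log (Real.log T) :=
    (Real.tendsto_log_atTop.comp Real.tendsto_log_atTop).eventually_ge_atTop 1
  filter_upwards [hres, hy, hll, eventually_ge_atTop 16] with T hres hy hll hT16 ε hε h hh
  obtain ⟨S, r, hSN, hinj, hcs, hD0, hmain⟩ := hres ε hε
  set y := T ^ (1 / 8 : ℝ) with hydef
  have hy2 : 2 ≤ y := (le_max_left _ _).trans hy
  have hyK : 2 * K₀ ≤ c₁ * y := by
    have := (le_max_right _ _).trans hy
    rw [div_le_iff₀ hc₁] at this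
    linarith
  have hTy : y ^ 8 = T := by
    rw [hydef, ← Real.rpow_natCast, ← Real.rpow_mul (by linarith)]
    norm_num
  have hy0 : 0 < y := by linarith
  set N := ⌊y⌋₊ with hN
  have hNy : (N : ℝ) ≤ y := Nat.floor_le hy0.le
  set L := y ^ 4 with hLdef
  have hLT : L ^ 2 = T := by rw [hLdef, ← hTy]; ring
  have hL16 : 16 ≤ L := by
    calc (16 : ℝ) = 2 ^ 4 := by norm_num
      _ ≤ y ^ 4 := by gcongr
  have hL0 : 0 < L := by linarith
  have hLN : 32 * (N : ℝ) ≤ L ^ 2 := by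
    have : (2 : ℝ) ^ 7 ≤ y ^ 7 := by gcongr
    rw [hLT, ← hTy]
    nlinarith
  set D := ∑ A ∈ S, r A ^ 2 with hD
  set X := √(Real.log T / Real.log (Real.log T)) with hX
  set Z := L * √Real.pi with hZ
  have hpi : 1 ≤ √Real.pi := by
    rw [Real.one_le_sqrt]; linarith [Real.pi_gt_three]
  have hZL : L ≤ Z := le_mul_of_one_le_right hL0.le hpi
  have hZ0 : 0 < Z := by linarith
  have hlogT : 0 < Real.log T := Real.log_pos (by linarith)
  have hX1 : 1 ≤ X := by
    rw [hX, Real.one_le_sqrt, one_le_div (by linarith)]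
    exact Real.log_le_self hlogT.le
  set G := resonatorWeight S resInt r L (3 / 2 * T) with hG
  have hG0 : ∀ t, 0 ≤ G t := fun t ↦ resonatorWeight_nonneg _ _ _
  have hGint : ∫ t in T..(2 * T), G t ≤ 2 * (Z * D) := by
    have hGi : Integrable G := integrable_resonatorWeight hL0 _
    rw [intervalIntegral.integral_of_le (by linarith)]
    refine (setIntegral_le_integral hGi (ae_of_all _ hG0)).trans ?_
    refine (integral_resonatorWeight_le hL0 _ hSN hinj).trans ?_
    have h1 : (∑ A ∈ S, |r A|) ^ 2 * (16 * (N : ℝ) ^ 2 / L ^ 2) ≤ D := by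
      calc _ ≤ (y * D) * (16 * y ^ 2 / L ^ 2) := by gcongr
        _ = D * (16 / y ^ 5) := by rw [hLdef]; field_simp
        _ ≤ D * 1 := by
          gcongr
          rw [div_le_one (by positivity)]
          calc (16 : ℝ) ≤ 2 ^ 5 := by norm_num
            _ ≤ y ^ 5 := by gcongr
        _ = D := mul_one D
    calc _ ≤ Z * (D + D) := by gcongr
      _ = _ := by ring
  have hv1 : ∀ v ∈ Icc (-h) h, |v| ≤ (Real.log (Real.log T))⁻¹ := fun v hv ↦
    (abs_le.2 hv).trans hh.2
  have hinv1 : (Real.log (Real.log T))⁻¹ ≤ 1 := inv_le_one_of_one_le₀ hll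
  have hB : ∀ v ∈ Icc (-h) h, Z * D * c₁ * X / 2 ≤
      ∫ t in T..(2 * T), (ε * logNormQuot (1 / 2) (t - v)) * G t := by
    intro v hv
    have h1 := hl.abs_setIntegral_sub_le (r := r) hRH (by linarith : 6 ≤ L) hLT v hSN hLN
    have h2 := hmain (-v) (by rw [abs_neg]; exact hv1 v hv)
    have hv' := (hv1 v hv).trans hinv1
    rw [abs_le] at hv'
    have hτ : |3 / 2 * T - v| = 3 / 2 * T - v := abs_of_nonneg (by linarith [hv'.2])
    rw [hτ] at h1
    have hqT : T ≤ 3 / 2 * T - v := by linarith [hv'.2]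
    have hq2 : 1 + (3 / 2 * T - v) ≤ 2 * T := by linarith [hv'.1]
    generalize 3 / 2 * T - v = q at h1 hqT hq2
    have hq0 : 0 ≤ q := by linarith
    have hE1 : twistConst * (N : ℝ) ^ 2 * ((N : ℝ) ^ 2 / L + L ^ 2 / (1 + q)) ≤
        2 * twistConst * y ^ 2 := by
      have a1 : (N : ℝ) ^ 2 / L ≤ 1 := by
        rw [div_le_one hL0]
        calc (N : ℝ) ^ 2 ≤ y ^ 2 := by gcongr
          _ ≤ y ^ 4 := pow_le_pow_right₀ (by linarith) (by norm_num)
      have a2 : L ^ 2 / (1 + q) ≤ 1 := by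
        rw [hLT, div_le_one (by linarith)]
        linarith
      calc _ ≤ twistConst * y ^ 2 * (1 + 1) := by gcongr
        _ = _ := by ring
    have hE2 : Real.exp (-(3 / 16 * T)) * (logL1Const * (1 + q) * (2 * L) ^ 2) ≤
        11000 * logL1Const * y ^ 2 := by
      have a1 : Real.exp (-(3 / 16 * T)) ≤ 6 / (3 / 16 * T) ^ 3 :=
        exp_neg_le_six_div_cube (by positivity)
      have a2 : 1 + q ≤ 2 * T := hq2
      have a3 : (2 * L) ^ 2 = 4 * T := by rw [mul_pow, hLT]; norm_num
      rw [a3]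
      calc _ ≤ 6 / (3 / 16 * T) ^ 3 * (logL1Const * (2 * T) * (4 * T)) := by gcongr
        _ = 65536 / 9 * logL1Const * T⁻¹ := by field_simp; ring
        _ ≤ 11000 * logL1Const * y ^ 2 := by
          have b1 : T⁻¹ ≤ 1 := inv_le_one_of_one_le₀ (by linarith)
          have b2 : 1 ≤ y ^ 2 := one_le_pow₀ (by linarith)
          gcongr
          · norm_num
          · linarith
    have hErr : |(∫ t in T..(2 * T), logNormQuot (1 / 2) (t - v) * G t) -
        Z * resonanceMain S resInt r (1 / 2) (-v)| ≤ Z * D * (c₁ / 2) := by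
      refine h1.trans ?_
      calc _ ≤ (y * D) * (2 * twistConst * y ^ 2 + 11000 * logL1Const * y ^ 2) := by
            gcongr
        _ = y ^ 3 * D * K₀ := by rw [hK₀]; ring
        _ ≤ y ^ 3 * D * (c₁ * y / 2) := by
            gcongr; linarith
        _ = L * D * (c₁ / 2) := by rw [hLdef]; ring
        _ ≤ Z * D * (c₁ / 2) := by gcongr
    have e1 : ∫ t in T..(2 * T), (ε * logNormQuot (1 / 2) (t - v)) * G t =
        ε * ∫ t in T..(2 * T), logNormQuot (1 / 2) (t - v) * G t := by
      rw [← intervalIntegral.integral_const_mul]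
      simp only [mul_assoc]
    have hεabs : |ε| = 1 := by
      rw [← sq_abs] at hε
      exact (pow_eq_one_iff_of_nonneg (abs_nonneg ε) two_ne_zero).1 hε
    have h3 : |ε * (∫ t in T..(2 * T), logNormQuot (1 / 2) (t - v) * G t) -
        Z * (ε * resonanceMain S resInt r (1 / 2) (-v))| ≤ Z * D * (c₁ / 2) := by
      have : ε * (∫ t in T..(2 * T), logNormQuot (1 / 2) (t - v) * G t) -
          Z * (ε * resonanceMain S resInt r (1 / 2) (-v)) =
          ε * ((∫ t in T..(2 * T), logNormQuot (1 / 2) (t - v) * G t) -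
            Z * resonanceMain S resInt r (1 / 2) (-v)) := by ring
      rw [this, abs_mul, hεabs, one_mul]
      exact hErr
    rw [e1]
    have h4 := (abs_le.1 h3).1
    have h5 : Z * (c₁ * X * D) ≤ Z * (ε * resonanceMain S resInt r (1 / 2) (-v)) := by gcongr
    have h6 : Z * D * (c₁ / 2) * 1 ≤ Z * D * (c₁ / 2) * X := by gcongr
    linarith
  -- If every short integral were below the claimed bound with `c₁ / 8`, comparison of `t` with `T`
  -- gives `c₁ / 4`, and the mass bound `2 Z D` then yields only half of the lower bound `h Z D c₁
  -- X`.
  by_contra hcon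
  push Not at hcon
  -- For `h = 0` both sides vanish, so the strict inequality already fails at `t = T`.
  have hh0 : 0 < h := by
    rcases hh.1.eq_or_lt with h0 | h0
    · have := hcon T ⟨le_rfl, by linarith⟩
      simp [← h0] at this
    · exact h0
  have hY : ∀ t ∈ Icc T (2 * T), ∫ u in (t - h)..(t + h), ε * logNormQuot (1 / 2) u ≤
      c₁ / 4 * (h * X) := by
    intro t ht
    have h1 := hcon t ht
    have h2 := sqrt_log_div_log_log_le hT16 ht
    rw [intervalIntegral.integral_const_mul]
    simp_rw [logNormQuot_half]
    refine h1.le.trans ?_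
    calc _ ≤ c₁ / 8 * (h * (2 * X)) := by gcongr
      _ = _ := by ring
  have hfin := two_mul_le_mul_integral_of_averages
    (fun x y ↦ (intervalIntegrable_logNormQuot_half x y).const_mul ε)
    (continuous_resonatorWeight L (3 / 2 * T)) hG0 (K := (∑ A ∈ S, |r A|) ^ 2)
    (fun t ↦ (resonatorWeight_le _ _ _).trans
      (mul_le_of_le_one_right (by positivity) (gaussW_le_one _ _ _)))
    (by linarith : T ≤ 2 * T) hh0.le hB hY
  have h1 : c₁ / 4 * (h * X) * ∫ t in T..(2 * T), G t ≤ c₁ / 4 * (h * X) * (2 * (Z * D)) := by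
    gcongr
  have h2 : 0 < h * Z * D * c₁ * X := by positivity
  linarith

theorem theorem3 (hRH : RiemannHypothesis) :
    (∃ c : ℝ, 0 < c ∧ ∀ᶠ T : ℝ in atTop,
      ∀ h ∈ Set.Icc (0 : ℝ) (Real.log (Real.log T))⁻¹, ∃ t ∈ Set.Icc T (2 * T),
        c * (h * Real.sqrt (Real.log t / Real.log (Real.log t))) ≤
          ∫ u in (t - h)..(t + h), Real.log ‖riemannZeta (1 / 2 + Complex.I * (u : ℂ))‖) ∧
    (∃ c : ℝ, 0 < c ∧ ∀ᶠ T : ℝ in atTop,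
      ∀ h ∈ Set.Icc (0 : ℝ) (Real.log (Real.log T))⁻¹, ∃ t ∈ Set.Icc T (2 * T),
        (∫ u in (t - h)..(t + h), Real.log ‖riemannZeta (1 / 2 + Complex.I * (u : ℂ))‖) ≤
          -(c * (h * Real.sqrt (Real.log t / Real.log (Real.log t))))) := by
  obtain ⟨c, hc, hev⟩ := eventually_exists_integral_log_zeta hRH
  refine ⟨⟨c, hc, ?_⟩, c, hc, ?_⟩
  · filter_upwards [hev] with T hT h hh
    obtain ⟨t, ht, hle⟩ := hT 1 (by norm_num) h hh
    exact ⟨t, ht, by rwa [one_mul] at hle⟩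
  · filter_upwards [hev] with T hT h hh
    obtain ⟨t, ht, hle⟩ := hT (-1) (by norm_num) h hh
    exact ⟨t, ht, by rw [neg_one_mul] at hle; linarith⟩
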